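/- **Model.** A base station with $N$ antennas serves a single-antenna user terminal. The channel is $\mathbf h\sim\mathcal{CN}(\mathbf 0,\mathbf R)$ with $\mathbf R=\mathbf R_N\in\mathbb C^{N\times N}$ positive semidefinite. The uplink pilot observation is $\mathbf z=\mathbf h(d+\eta_t^{\rm UT})+\boldsymbol\nu+\boldsymbol\eta_r^{\rm BS}$, where $d\neq0$ is a deterministic pilot with $p^{\rm UT}=|d|^2$, $\eta_t^{\rm UT}\sim\mathcal{CN}(0,\kappa_t^{\rm UT}p^{\rm UT})$, $\boldsymbol\nu\sim\mathcal{CN}(\mathbf 0,\mathbf S)$ with $\mathbf S=\mathbf S_N$ positive definite, and, given $\mathbf h$, $\boldsymbol\eta_r^{\rm BS}\sim\mathcal{CN}(\mathbf 0,\kappa_r^{\rm BS}p^{\rm UT}\,\mathrm{diag}(|h_1|^2,\dots,|h_N|^2))$; $\mathbf h$, $\eta_t^{\rm UT}$, $\boldsymbol\nu$ are independent, and independent of the normalized noise that drives $\boldsymbol\eta_r^{\rm BS}$. Put $\mathbf R_{\rm diag}=\mathrm{diag}(r_{11},\dots,r_{NN})$, $$\boldsymbol\Psi=p^{\rm UT}\kappa_r^{\rm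 BS}\mathbf R_{\rm diag}+\mathbf S,\qquad \mathbf A=d^*\mathbf R\big(p^{\rm UT}(1+\kappa_t^{\rm UT})\mathbf R+\boldsymbol\Psi\big)^{-1},$$ $$\hat{\mathbf h}=\mathbf A\mathbf z,\qquad \mathbf C=\mathbb E\{(\hat{\mathbf h}-\mathbf h)(\hat{\mathbf h}-\mathbf h)^H\}.$$ The downlink signal is $y=\mathbf h^T(\mathbf w s+\boldsymbol\eta_t^{\rm BS})+n+\eta_r^{\rm UT}$, where $\mathbf w=\mathbf w(\hat{\mathbf h})$ with $\|\mathbf w\|=1$, and where, given $\mathbf h$ and $\mathbf w$, the noises $\boldsymbol\eta_t^{\rm BS}\sim\mathcal{CN}(\mathbf 0,\kappa_t^{\rm BS}p^{\rm BS}\mathrm{diag}(|w_1|^2,\dots,|w_N|^2))$, $n\sim\mathcal{CN}(0,\sigma_{\rm UT}^2)$ and $\eta_r^{\rm UT}\sim\mathcal{CN}(0,\kappa_r^{\rm UT}p^{\rm BS}|\mathbf h^T\mathbf w|^2)$ are independent of each other and of $s$; $p^{\rm BS},\sigma^2_{\rm UT}>0$ and all $\kappa$'s are nonnegative. The receiver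 has side information $u$ drawn from an arbitrary fixed conditional law given $(\mathbf h,\hat{\mathbf h},\mathbf w)$ (anything from no channel knowledge to perfect knowledge). The capacity ${\tt C}$ is the supremum, over $\mathbf w(\cdot)$ and over laws of $s$ with $\mathbb E|s|^2\le p^{\rm BS}$ ($s$ independent of $\mathbf h,\hat{\mathbf h},u$), of the mutual information in bits between $s$ and $(y,u)$. For $\mathbf v=\hat{\mathbf h}^*/\|\hat{\mathbf h}\|$ let $${\tt C}_{\rm lower}=\log_2\!\left(1+\frac{|\mathbb E\{\mathbf h^T\mathbf v\}|^2}{(1+\kappa_r^{\rm UT})\mathbb E\{|\mathbf h^T\mathbf v|^2\}-|\mathbb E\{\mathbf h^T\mathbf v\}|^2+\kappa_t^{\rm BS}\sum_{i=1}^N\mathbb E\{|h_i|^2|v_i|^2\}+\sigma_{\rm UT}^2/p^{\rm BS}}\right).$$ **Assumptions.** $d$ and the $\kappa$'s do not depend on $N$. The spectral norms of $\mathbf R_N$ and $\mathbf S_N$ are bounded uniformly in $N$. There is $c>0$ such that $\mathrm{tr}(\mathbf R_N)\ge cN$ and $\boldsymbol\Psi_N\succeq c\mathbf I$ for all $N\ge1$.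 **Claim.** $\hat{\mathbf h}$ is the linear minimum mean square error estimate of $\mathbf h$ from $\mathbf z$, and ${\tt C}\ge{\tt C}_{\rm lower}$ for all $N\ge1$. Let $$m_N=\bigg|\mathbb E\bigg\{\frac{(1+d^{-1}\eta_t^{\rm UT})\sqrt{\mathrm{tr}(\mathbf R-\mathbf C)}}{\sqrt{\mathrm{tr}(\mathbf A(|d+\eta_t^{\rm UT}|^2\mathbf R+\boldsymbol\Psi)\mathbf A^H)}}\bigg\}\bigg|^2,\qquad q_N=\mathbb E\bigg\{\frac{|1+d^{-1}\eta_t^{\rm UT}|^2\,\mathrm{tr}(\mathbf R-\mathbf C)}{\mathrm{tr}(\mathbf A(|d+\eta_t^{\rm UT}|^2\mathbf R+\boldsymbol\Psi)\mathbf A^H)}\bigg\}.$$ All the expectations in these expressions exist, and: 1. If $p^{\rm BS}$ is fixed and the noise variance $\sigma^2_{\rm UT}$ is fixed or depends on $N$ with $\sigma^2_{\rm UT}=\mathcal O(\sqrt N)$, there are real sequences $a_N,b_N=\mathcal O(1/\sqrt N)$ such that for all $N\ge1$ $${\tt C}_{\rm lower}=\log_2\!\left(1+\frac{m_N+a_N}{(1+\kappa_r^{\rm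 UT})\,q_N-m_N+\frac1N\frac{\sigma_{\rm UT}^2}{p^{\rm UT}p^{\rm BS}}+b_N}\right).$$ 2. If the noise term $\frac1N\frac{\sigma_{\rm UT}^2}{p^{\rm UT}p^{\rm BS}}$ is replaced by $\frac{\sigma_{\rm UT}^2}{p^{\rm BS}\,\mathrm{tr}(\mathbf R-\mathbf C)}$, the same holds with sequences $a_N,b_N=\mathcal O(1/\sqrt N)$ that do not depend on $\sigma_{\rm UT}^2>0$ and $p^{\rm BS}>0$. Here $\mathrm{tr}(\mathbf R-\mathbf C)$ lies between two positive constant multiples of $N$. 3. $m_N$ and $q_N$ are bounded below by a positive constant for all $N\ge1$; if $\kappa_r^{\rm UT}>0$ or $\kappa_t^{\rm UT}>0$, so is $(1+\kappa_r^{\rm UT})q_N-m_N$. -/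

import Mathlib

open MeasureTheory ProbabilityTheory Filter Asymptotics
open scoped ENNReal Matrix ComplexOrder

noncomputable section

namespace Miso

/-- Complex column vectors of length `N`. -/
abbrev Vec (N : ℕ) : Type := Fin N → ℂ

/-- The Euclidean norm of a complex vector. -/
def eucNorm {N : ℕ} (x : Vec N) : ℝ := ‖WithLp.toLp 2 x‖

/-- The spectral norm of a square complex matrix. -/
def specNorm {N : ℕ} (M : Matrix (Fin N) (Fin N) ℂ) : ℝ :=
  ‖Matrix.toEuclideanCLM (n := Fin N) (𝕜 := ℂ) M‖

/-! ### Circularly-symmetric complex Gaussian laws -/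

/-- The standard circularly-symmetric complex Gaussian law `CN(0, 1)`: independent real and
imaginary parts, each of variance `1/2`. -/
def stdCN : Measure ℂ :=
  ((gaussianReal 0 (1 / 2)).prod (gaussianReal 0 (1 / 2))).map (fun x => (⟨x.1, x.2⟩ : ℂ))

/-- The scalar law `CN(0, v)`, for a variance `v ≥ 0`. -/
def scalarCN (v : ℝ) : Measure ℂ := stdCN.map (fun z => ((Real.sqrt v : ℝ) : ℂ) * z)

/-- The law `CN(0, I)` on `ℂ^N`. -/
def stdVecCN (N : ℕ) : Measure (Vec N) := Measure.pi (fun _ => stdCN)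

open scoped MatrixOrder in
/-- The law `CN(0, Q)` on `ℂ^N`, for a positive semidefinite covariance matrix `Q`. -/
def vecCN {N : ℕ} (Q : Matrix (Fin N) (Fin N) ℂ) : Measure (Vec N) :=
  (stdVecCN N).map (fun z => CFC.sqrt Q *ᵥ z)

/-! ### Parameters -/

/-- The parameters that do not depend on the number of antennas: the levels of impairments of the
transmitter and receiver hardware at the base station and at the user terminal, and the nonzero
deterministic pilot signal `d`. -/
structure Params where
  κtBS : ℝ
  κrBS : ℝ
  κtUT : ℝ
  κrUT : ℝ
  d : ℂ
  κtBS_nonneg : 0 ≤ κtBS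
  κrBS_nonneg : 0 ≤ κrBS
  κtUT_nonneg : 0 ≤ κtUT
  κrUT_nonneg : 0 ≤ κrUT
  d_ne_zero : d ≠ 0

/-- The pilot power `p^UT = |d|^2`. -/
def Params.pUT (P : Params) : ℝ := ‖P.d‖ ^ 2

variable {N : ℕ}

/-! ### Uplink pilot transmission -/

/-- Sample space of the uplink: a sample is `(h, η_t^UT, ν, ξ)`, where `ξ` is the normalized
receiver distortion. -/
abbrev Uplink (N : ℕ) : Type := Vec N × ℂ × Vec N × Vec N

/-- The uplink law: `h ∼ CN(0, R)`, `η_t^UT ∼ CN(0, κ_t^UT p^UT)`, `ν ∼ CN(0, S)` and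
`ξ ∼ CN(0, I)`, all independent. -/
def uplinkLaw (P : Params) (R S : Matrix (Fin N) (Fin N) ℂ) : Measure (Uplink N) :=
  (vecCN R).prod ((scalarCN (P.κtUT * P.pUT)).prod ((vecCN S).prod (stdVecCN N)))

/-- The channel `h`. -/
def chan (ω : Uplink N) : Vec N := ω.1

/-- The receiver distortion at the base station. Conditionally on `h` its law is
`CN(0, κ_r^BS p^UT diag(|h_1|^2, …, |h_N|^2))`. -/
def etaRBS (P : Params) (ω : Uplink N) : Vec N :=
  fun i => ((Real.sqrt (P.κrBS * P.pUT) * ‖ω.1 i‖ : ℝ) : ℂ) * ω.2.2.2 i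

/-- The received pilot signal `z = h (d + η_t^UT) + ν + η_r^BS`. -/
def pilotObs (P : Params) (ω : Uplink N) : Vec N :=
  fun i => ω.1 i * (P.d + ω.2.1) + ω.2.2.1 i + etaRBS P ω i

/-- `Ψ = p^UT κ_r^BS R_diag + S`, the covariance matrix of `ν + η_r^BS`. -/
def psi (P : Params) (R S : Matrix (Fin N) (Fin N) ℂ) : Matrix (Fin N) (Fin N) ℂ :=
  ((P.pUT * P.κrBS : ℝ) : ℂ) • Matrix.diagonal (fun i => R i i) + S

/-- The matrix `A = d^* R (p^UT (1 + κ_t^UT) R + p^UT κ_r^BS R_diag + S)⁻¹`. -/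
def lmmseMatrix (P : Params) (R S : Matrix (Fin N) (Fin N) ℂ) : Matrix (Fin N) (Fin N) ℂ :=
  star P.d • (R * (((P.pUT * (1 + P.κtUT) : ℝ) : ℂ) • R + psi P R S)⁻¹)

/-- The channel estimate `ĥ = A z`. -/
def chanEst (P : Params) (R S : Matrix (Fin N) (Fin N) ℂ) (ω : Uplink N) : Vec N :=
  lmmseMatrix P R S *ᵥ pilotObs P ω

/-- The mean square error `E ‖B z - h‖^2` of the linear estimator `B z`. -/
def mse (P : Params) (R S : Matrix (Fin N) (Fin N) ℂ) (B : Matrix (Fin N) (Fin N) ℂ) : ℝ :=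
  ∫ ω, eucNorm (B *ᵥ pilotObs P ω - chan ω) ^ 2 ∂(uplinkLaw P R S)

/-- The error covariance matrix `C = E{(ĥ - h)(ĥ - h)^H}`. -/
def errCov (P : Params) (R S : Matrix (Fin N) (Fin N) ℂ) : Matrix (Fin N) (Fin N) ℂ :=
  Matrix.of fun i j => ∫ ω, (chanEst P R S ω i - chan ω i) *
    star (chanEst P R S ω j - chan ω j) ∂(uplinkLaw P R S)

/-- `tr(R - C)`, a nonnegative real number. -/
def estPower (P : Params) (R S : Matrix (Fin N) (Fin N) ℂ) : ℝ :=
  (R - errCov P R S).trace.re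

/-! ### Downlink transmission and the capacity -/

/-- Normalized downlink noises: `(ξ_t, ξ_r, ξ_n)`. -/
abbrev DownNoise (N : ℕ) : Type := Vec N × ℂ × ℂ

/-- The normalized downlink noises are independent standard complex Gaussians. -/
def downNoiseLaw (N : ℕ) : Measure (DownNoise N) := (stdVecCN N).prod (stdCN.prod stdCN)

/-- The received downlink signal `y = h^T (w s + η_t^BS) + n + η_r^UT`, where
`η_t^BS ∼ CN(0, κ_t^BS p^BS diag(|w_1|^2, …, |w_N|^2))`, `n ∼ CN(0, σ_UT^2)` and
`η_r^UT ∼ CN(0, κ_r^UT p^BS |h^T w|^2)`, given `h` and `w`. -/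
def received (P : Params) (pBS σ2 : ℝ) (h w : Vec N) (s : ℂ) (ξ : DownNoise N) : ℂ :=
  h ⬝ᵥ (fun i => w i * s + ((Real.sqrt (P.κtBS * pBS) * ‖w i‖ : ℝ) : ℂ) * ξ.1 i)
    + ((Real.sqrt σ2 : ℝ) : ℂ) * ξ.2.2
    + ((Real.sqrt (P.κrUT * pBS) * ‖h ⬝ᵥ w‖ : ℝ) : ℂ) * ξ.2.1

/-- The mutual information (in nats) of two random variables: the Kullback-Leibler divergence of
their joint law from the product of their laws. -/
def mutualInfo {Ω X Y : Type*} [MeasurableSpace Ω] [MeasurableSpace X] [MeasurableSpace Y]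
    (μ : Measure Ω) (f : Ω → X) (g : Ω → Y) : ℝ≥0∞ :=
  InformationTheory.klDiv (μ.map (fun ω => (f ω, g ω))) ((μ.map f).prod (μ.map g))

/-- Joint law of `(((h, ĥ, w(ĥ)), u), (s, ξ))`. The receiver side information `u` is drawn by the
kernel `K` from `(h, ĥ, w(ĥ))`. The data signal `s` with law `f` and the downlink noises are
independent of these and of each other. -/
def downlinkLaw (P : Params) (R S : Matrix (Fin N) (Fin N) ℂ) {U : Type} [MeasurableSpace U]
    (K : Kernel (Vec N × Vec N × Vec N) U) (w : Vec N → Vec N) (f : Measure ℂ) :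
    Measure (((Vec N × Vec N × Vec N) × U) × (ℂ × DownNoise N)) :=
  (((uplinkLaw P R S).map
      (fun ω => (chan ω, chanEst P R S ω, w (chanEst P R S ω)))) ⊗ₘ K).prod
    (f.prod (downNoiseLaw N))

/-- The downlink capacity, in bits per channel use, when the receiver has the side information
produced by `K`: the supremum, over measurable unit-norm beamforming vectors `w(ĥ)` and over data
signal laws with `E|s|^2 ≤ p^BS`, of the mutual information between `s` and the pair `(y, u)`.
As `s` is independent of `u`, this is the average over `u` of the mutual information between `s`
and `y` given `u`. If `K` is constant, the receiver has no channel information beyond statistics;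
if `u = (h, ĥ, w(ĥ))`, the receiver knows the channel perfectly. -/
def capacity (P : Params) (R S : Matrix (Fin N) (Fin N) ℂ) (pBS σ2 : ℝ)
    {U : Type} [MeasurableSpace U] (K : Kernel (Vec N × Vec N × Vec N) U) : ℝ≥0∞ :=
  ⨆ (w : Vec N → Vec N) (_ : Measurable w) (_ : ∀ x, eucNorm (w x) = 1)
    (f : Measure ℂ) (_ : IsProbabilityMeasure f)
    (_ : ∫⁻ s, ‖s‖ₑ ^ 2 ∂f ≤ ENNReal.ofReal pBS),
    mutualInfo (downlinkLaw P R S K w f) (fun q => q.2.1)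
        (fun q => (received P pBS σ2 q.1.1.1 q.1.1.2.2 q.2.1 q.2.2, q.1.2))
      / ENNReal.ofReal (Real.log 2)

/-! ### The lower bound -/

/-- The effective channel `h^T v` for the beamforming `v = v(ĥ)`. -/
def effChan (P : Params) (R S : Matrix (Fin N) (Fin N) ℂ) (v : Vec N → Vec N)
    (ω : Uplink N) : ℂ :=
  chan ω ⬝ᵥ v (chanEst P R S ω)

/-- The effective signal-to-interference-and-noise ratio of the lower bound for the beamforming
`v = v(ĥ)`. -/
def sinrTilde (P : Params) (R S : Matrix (Fin N) (Fin N) ℂ) (v : Vec N → Vec N)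
    (pBS σ2 : ℝ) : ℝ :=
  ‖∫ ω, effChan P R S v ω ∂(uplinkLaw P R S)‖ ^ 2 /
    ((1 + P.κrUT) * (∫ ω, ‖effChan P R S v ω‖ ^ 2 ∂(uplinkLaw P R S))
      - ‖∫ ω, effChan P R S v ω ∂(uplinkLaw P R S)‖ ^ 2
      + P.κtBS * ∑ i, (∫ ω, ‖chan ω i‖ ^ 2 * ‖v (chanEst P R S ω) i‖ ^ 2 ∂(uplinkLaw P R S))
      + σ2 / pBS)

/-- The lower bound `C_lower = log₂(1 + SINR)`. -/
def capacityLower (P : Params) (R S : Matrix (Fin N) (Fin N) ℂ) (v : Vec N → Vec N)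
    (pBS σ2 : ℝ) : ℝ :=
  Real.logb 2 (1 + sinrTilde P R S v pBS σ2)

/-- Approximate maximum ratio transmission, `x ↦ x^* / ‖x‖`. -/
def mrt (x : Vec N) : Vec N := fun i => star (x i) / (eucNorm x : ℂ)

/-! ### The expectations over `η_t^UT` -/

/-- `tr(A (|d + η|^2 R + Ψ) A^H)`, a nonnegative real number. -/
def condPower (P : Params) (R S : Matrix (Fin N) (Fin N) ℂ) (η : ℂ) : ℝ :=
  (lmmseMatrix P R S * (((‖P.d + η‖ ^ 2 : ℝ) : ℂ) • R + psi P R S) *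
    (lmmseMatrix P R S)ᴴ).trace.re

/-- `(1 + d⁻¹ η) √tr(R - C) / √tr(A (|d + η|^2 R + Ψ) A^H)`. -/
def gain (P : Params) (R S : Matrix (Fin N) (Fin N) ℂ) (η : ℂ) : ℂ :=
  (1 + P.d⁻¹ * η) * ((Real.sqrt (estPower P R S) : ℝ) : ℂ) /
    ((Real.sqrt (condPower P R S η) : ℝ) : ℂ)

/-- `|E{(1 + d⁻¹ η_t^UT) √tr(R - C) / √tr(A (|d + η_t^UT|^2 R + Ψ) A^H)}|^2`. -/
def sqMeanGain (P : Params) (R S : Matrix (Fin N) (Fin N) ℂ) : ℝ :=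
  ‖∫ η, gain P R S η ∂(scalarCN (P.κtUT * P.pUT))‖ ^ 2

/-- `E{|1 + d⁻¹ η_t^UT|^2 tr(R - C) / tr(A (|d + η_t^UT|^2 R + Ψ) A^H)}`. -/
def meanSqGain (P : Params) (R S : Matrix (Fin N) (Fin N) ℂ) : ℝ :=
  ∫ η, ‖1 + P.d⁻¹ * η‖ ^ 2 * estPower P R S / condPower P R S η
    ∂(scalarCN (P.κtUT * P.pUT))

end Miso

end

namespace Miso

/-! ### The standard scalar law -/

/-! Estimator. With Q = E zzᴴ (`obsCov`) and E zhᴴ = d R, the matrix A solves A Q = d* R. Hence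
mse(B) − mse(A) = tr((B − A) Q (B − A)ᴴ) ≥ 0 and R − C = A Q Aᴴ. Write T = tr(R − C).

Capacity. Take s Gaussian and w maximum ratio transmission. In the Donsker–Varadhan inequality the
test function is the log-ratio of the densities of CN(ay, v) and CN(0, p), where ay is the linear
minimum mean square error estimate of s from y and v is its error variance. Its exponential
integrates to 1 under the product law, its mean under the joint law is log(p/v), and it ignores u,
so that any side information is allowed (`ofReal_log_le_mutualInfo`). The received signal is a
combination of uncorrelated sources with coefficients that depend on (h, w). Its second moments are
therefore explicit (`received_moments`), and p/v = 1 + SINR.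

Asymptotics. Fix η = η_t^UT. Then ĥᴴh and ‖ĥ‖² are quadratic forms in h, ν and the distortion, with
means (1 + η/d)* T and G(η) = tr(A(|d + η|²R + Ψ)Aᴴ). Bounded spectral norms keep their variances at
O(N) (`lintegral_inner_deviation_le`, `lintegral_norm_deviation_le`), whereas T and G are at least
of order N. The latter is Cauchy–Schwarz: |d| tr R = |tr(AQ)| ≤ ‖A‖_F ‖Q‖_F, so ‖A‖_F² is at least
of order N (`estNoisePower_ge`). Consequently hᵀv = ĥᴴh/‖ĥ‖ is within O(1) of (1 + η/d)* T/√G in L¹,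
and the squared moduli are within O(√N). A small ‖ĥ‖ does no harm, because |hᵀv| ≤ ‖h‖ lets all
divisions be by G. The bounds are polynomial in |d + η|, so they can be averaged over η; division by
T leaves O(1/√N).

Noise term. The error sequences are exact differences after division by T, so they contain neither
σ² nor p^BS. If σ² = O(√N), then σ²/(p^BS T) and σ²/(N p^UT p^BS) are each O(1/√N), so one may
replace the other although T/N need not approach p^UT.

Positivity. ζ = η/d is circularly symmetric. Pairing ζ with its reflection in the imaginary axis
shows that the real part of the gain has mean bounded below. Conjugation shows that the imaginary
part has mean zero, so q − m is at least its second moment, which is bounded below when κ_t^UT > 0.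
-/

lemma measurable_complexMk : Measurable (fun x : ℝ × ℝ => (⟨x.1, x.2⟩ : ℂ)) :=
  Complex.measurableEquivRealProd.symm.measurable

instance : IsProbabilityMeasure stdCN :=
  Measure.isProbabilityMeasure_map measurable_complexMk.aemeasurable

instance (v : ℝ) : IsProbabilityMeasure (scalarCN v) :=
  Measure.isProbabilityMeasure_map (by fun_prop)

instance (N : ℕ) : IsProbabilityMeasure (stdVecCN N) := by
  unfold stdVecCN; infer_instance

lemma measurable_mulVec {m n : ℕ} (B : Matrix (Fin m) (Fin n) ℂ) :
    Measurable (fun x : Fin n → ℂ => B *ᵥ x) := by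
  unfold Matrix.mulVec dotProduct; fun_prop

instance {N : ℕ} (Q : Matrix (Fin N) (Fin N) ℂ) : IsProbabilityMeasure (vecCN Q) :=
  Measure.isProbabilityMeasure_map (measurable_mulVec _).aemeasurable

instance {N : ℕ} (P : Params) (R S : Matrix (Fin N) (Fin N) ℂ) :
    IsProbabilityMeasure (uplinkLaw P R S) := by
  unfold uplinkLaw; infer_instance

instance (N : ℕ) : IsProbabilityMeasure (downNoiseLaw N) := by
  unfold downNoiseLaw; infer_instance

instance : SFinite stdCN := inferInstance

instance (v : ℝ) : SFinite (scalarCN v) := inferInstance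

instance (N : ℕ) : SFinite (stdVecCN N) := inferInstance

instance {N : ℕ} (Q : Matrix (Fin N) (Fin N) ℂ) : SFinite (vecCN Q) := inferInstance

instance {N : ℕ} (P : Params) (R S : Matrix (Fin N) (Fin N) ℂ) : SFinite (uplinkLaw P R S) :=
  inferInstance

instance (N : ℕ) : SFinite (downNoiseLaw N) := inferInstance

lemma measurePreserving_complexMk : MeasurePreserving (fun x : ℝ × ℝ => (⟨x.1, x.2⟩ : ℂ))
    ((gaussianReal 0 (1 / 2)).prod (gaussianReal 0 (1 / 2))) stdCN :=
  ⟨measurable_complexMk, rfl⟩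

lemma memLp_id_stdCN (k : ℕ) : MemLp (fun z : ℂ => z) k stdCN := by
  unfold stdCN
  rw [memLp_map_measure_iff (by fun_prop) measurable_complexMk.aemeasurable]
  have h := memLp_id_gaussianReal' (μ := 0) (v := 1 / 2) (k : ℝ≥0∞) (by simp)
  have h1 : MemLp (fun x : ℝ × ℝ => (x.1 : ℂ)) k
      ((gaussianReal 0 (1 / 2)).prod (gaussianReal 0 (1 / 2))) :=
    (h.comp_fst _).ofReal
  have h2 : MemLp (fun x : ℝ × ℝ => (x.2 : ℂ) * Complex.I) k
      ((gaussianReal 0 (1 / 2)).prod (gaussianReal 0 (1 / 2))) :=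
    ((h.comp_snd _).ofReal (K := ℂ)).mul_const _
  convert h1.add h2 using 1
  ext x
  simp [Complex.ext_iff]

lemma integrable_norm_pow_stdCN (k : ℕ) : Integrable (fun z : ℂ => ‖z‖ ^ k) stdCN := by
  rcases eq_or_ne k 0 with rfl | hk
  · simp
  · exact (memLp_id_stdCN k).integrable_norm_pow hk

lemma measurePreserving_neg_gaussianReal (v : NNReal) :
    MeasurePreserving (fun x : ℝ => -x) (gaussianReal 0 v) (gaussianReal 0 v) :=
  ⟨measurable_neg, by simpa using gaussianReal_map_neg (μ := 0) (v := v)⟩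

/-- Symmetries of CN(0, 1) replace explicit integration throughout: multiplication by i or −1 makes
cross moments vanish, and conjugation and reflection control the gain. -/
lemma measurePreserving_conj_stdCN : MeasurePreserving (fun z : ℂ => star z) stdCN stdCN := by
  refine MeasurePreserving.of_semiconj measurePreserving_complexMk
    ((MeasurePreserving.id _).prod (measurePreserving_neg_gaussianReal (1 / 2))) ?_ (by fun_prop)
  intro x
  simp [Complex.ext_iff]

lemma measurePreserving_I_mul_stdCN :
    MeasurePreserving (fun z : ℂ => Complex.I * z) stdCN stdCN := by
  have h := ((measurePreserving_neg_gaussianReal (1 / 2)).prod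
    (MeasurePreserving.id (gaussianReal 0 (1 / 2)))).comp
    (Measure.measurePreserving_swap (μ := gaussianReal 0 (1 / 2)) (ν := gaussianReal 0 (1 / 2)))
  refine MeasurePreserving.of_semiconj measurePreserving_complexMk h ?_ (by fun_prop)
  intro x
  simp [Complex.ext_iff]

lemma measurePreserving_neg_stdCN : MeasurePreserving (fun z : ℂ => -z) stdCN stdCN := by
  convert measurePreserving_I_mul_stdCN.comp measurePreserving_I_mul_stdCN using 1
  ext z
  simp [← mul_assoc]

/-- A function that is multiplied by a constant other than `1` under a measure-preserving map has
integral zero. -/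
lemma integral_eq_zero_of_semi_invariant {Ω : Type*} [MeasurableSpace Ω] {μ : Measure Ω}
    {T : Ω → Ω} (hT : MeasurePreserving T μ μ) {f : Ω → ℂ} (hf : AEStronglyMeasurable f μ) {c : ℂ}
    (hc : c ≠ 1) (h : ∀ x, f (T x) = c * f x) : ∫ x, f x ∂μ = 0 := by
  have h1 : ∫ x, f (T x) ∂μ = ∫ x, f x ∂μ := by
    rw [← integral_map hT.measurable.aemeasurable (by rwa [hT.map_eq]), hT.map_eq]
  simp_rw [h, integral_const_mul] at h1
  have h2 : (c - 1) * ∫ x, f x ∂μ = 0 := by rw [sub_mul, h1, one_mul, sub_self]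
  exact (mul_eq_zero.1 h2).resolve_left (sub_ne_zero.2 hc)

lemma I_ne_one : Complex.I ≠ 1 := by simp [Complex.ext_iff]

lemma integral_id_stdCN : ∫ z, z ∂stdCN = 0 :=
  integral_eq_zero_of_semi_invariant measurePreserving_I_mul_stdCN (by fun_prop) I_ne_one
    fun _ => rfl

lemma integral_sq_gaussianReal (v : NNReal) : ∫ x, x ^ 2 ∂(gaussianReal 0 v) = v := by
  have h := variance_eq_sub (memLp_id_gaussianReal' (μ := 0) (v := v) 2 (by simp))
  rw [variance_id_gaussianReal] at h
  simpa using h.symm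

lemma integrable_sq_gaussianReal (v : NNReal) : Integrable (fun x => x ^ 2) (gaussianReal 0 v) :=
  (memLp_id_gaussianReal' (μ := 0) (v := v) 2 (by simp)).integrable_sq

lemma integral_norm_sq_stdCN : ∫ z, ‖z‖ ^ 2 ∂stdCN = 1 := by
  rw [← measurePreserving_complexMk.map_eq, integral_map measurable_complexMk.aemeasurable
    (by fun_prop)]
  simp_rw [Complex.sq_norm, Complex.normSq_mk, ← sq]
  rw [integral_add ((integrable_sq_gaussianReal _).comp_fst _)
    ((integrable_sq_gaussianReal _).comp_snd _)]
  rw [integral_fun_fst (fun x : ℝ => x ^ 2), integral_fun_snd (fun x : ℝ => x ^ 2)]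
  simp [integral_sq_gaussianReal]
  norm_num

lemma integral_mul_conj_stdCN : ∫ z, z * star z ∂stdCN = 1 := by
  simp_rw [RCLike.star_def, RCLike.mul_conj]
  norm_cast
  rw [integral_norm_sq_stdCN]; simp

/-- Makes affine hyperplanes null, and hence the channel estimate almost surely nonzero. -/
lemma noAtoms_stdCN : NullSingletonClass stdCN := by
  have : NullSingletonClass (gaussianReal 0 (1 / 2)) :=
    nullSingletonClass_gaussianReal (by norm_num)
  refine ⟨fun z => ?_⟩
  unfold stdCN
  rw [Measure.map_apply measurable_complexMk (measurableSet_singleton z)]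
  refine measure_mono_null (t := ({z.re} : Set ℝ) ×ˢ Set.univ) ?_ ?_
  swap
  · rw [Measure.prod_prod, measure_singleton, zero_mul]
  intro x hx
  simp [Complex.ext_iff] at hx
  simp [hx.1]

/-- Gives positive probability to the sets of distortions on which the gain is bounded below. -/
lemma stdCN_pos_of_isOpen {U : Set ℂ} (hU : IsOpen U) (hne : U.Nonempty) : 0 < stdCN U := by
  have hpos : ∀ {V : Set ℝ}, IsOpen V → V.Nonempty → gaussianReal 0 (1 / 2) V ≠ 0 := by
    intro V hV hne h
    exact (hV.measure_pos volume hne).ne'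
      (gaussianReal_absolutelyContinuous' 0 (by norm_num) h)
  have : (gaussianReal 0 (1 / 2)).IsOpenPosMeasure := ⟨fun V hV hne => hpos hV hne⟩
  have hc : Continuous (fun x : ℝ × ℝ => (⟨x.1, x.2⟩ : ℂ)) :=
    Complex.equivRealProdCLM.symm.continuous
  unfold stdCN
  rw [Measure.map_apply measurable_complexMk hU.measurableSet]
  refine (hU.preimage hc).measure_pos _ ?_
  obtain ⟨z, hz⟩ := hne
  exact ⟨(z.re, z.im), hz⟩

/-! ### Orthogonal families of square-integrable variables -/

section Orthogonal

variable {Ω ι : Type*} [MeasurableSpace Ω] {μ : Measure Ω}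

lemma lintegral_enorm_sq_eq {f : Ω → ℂ} (hf : MemLp f 2 μ) :
    ∫⁻ x, ‖f x‖ₑ ^ 2 ∂μ = ENNReal.ofReal (∫ x, ‖f x‖ ^ 2 ∂μ) := by
  rw [ofReal_integral_eq_lintegral_ofReal
    ((memLp_two_iff_integrable_sq_norm hf.1).1 hf) (ae_of_all _ fun _ => by positivity)]
  refine lintegral_congr fun x => ?_
  rw [ENNReal.ofReal_pow (norm_nonneg _), ofReal_norm]

lemma integrable_mul_conj {f g : Ω → ℂ} (hf : MemLp f 2 μ) (hg : MemLp g 2 μ) :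
    Integrable (fun x => f x * star (g x)) μ :=
  hf.integrable_mul hg.star

lemma ofReal_norm_sq (z : ℂ) : ((‖z‖ ^ 2 : ℝ) : ℂ) = z * star z := by
  rw [RCLike.star_def, RCLike.mul_conj]; norm_cast

lemma integral_norm_sq_eq (f : Ω → ℂ) :
    ((∫ x, ‖f x‖ ^ 2 ∂μ : ℝ) : ℂ) = ∫ x, f x * star (f x) ∂μ := by
  rw [← integral_complex_ofReal]
  simp_rw [ofReal_norm_sq]

/-- Orthogonality removes the cross terms, leaving ∑ |c_i|² E|e_i|². The lower Lebesgue integral is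
used so that later conditioning by Tonelli requires no integrability. -/
lemma lintegral_enorm_sq_sum_le [Fintype ι] {e : ι → Ω → ℂ}
    (he : ∀ i, MemLp (e i) 2 μ) (horth : ∀ i j, i ≠ j → ∫ x, e i x * star (e j x) ∂μ = 0) {K : ℝ}
    (hK : ∀ i, ∫ x, ‖e i x‖ ^ 2 ∂μ ≤ K) (c : ι → ℂ) :
    ∫⁻ x, ‖∑ i, c i * e i x‖ₑ ^ 2 ∂μ ≤ ENNReal.ofReal (K * ∑ i, ‖c i‖ ^ 2) := by
  classical
  have hm : MemLp (fun x => ∑ i, c i * e i x) 2 μ :=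
    memLp_finsetSum _ fun i _ => (he i).const_mul (c i)
  rw [lintegral_enorm_sq_eq hm]
  refine ENNReal.ofReal_le_ofReal ?_
  have key : ((∫ x, ‖∑ i, c i * e i x‖ ^ 2 ∂μ : ℝ) : ℂ) =
      ((∑ i, ‖c i‖ ^ 2 * ∫ x, ‖e i x‖ ^ 2 ∂μ : ℝ) : ℂ) := by
    rw [integral_norm_sq_eq]
    simp_rw [star_sum, Finset.sum_mul_sum, star_mul']
    have hint : ∀ i j, Integrable (fun x => c i * e i x * (star (c j) * star (e j x))) μ := by
      intro i j
      convert (integrable_mul_conj (he i) (he j)).const_mul (c i * star (c j)) using 2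
      ring
    rw [integral_finsetSum _ fun i _ => integrable_finsetSum _ fun j _ => hint i j]
    simp_rw [integral_finsetSum _ fun j _ => hint _ j]
    push_cast
    refine Finset.sum_congr rfl fun i _ => ?_
    have hij : ∀ j, ∫ x, c i * e i x * (star (c j) * star (e j x)) ∂μ =
        c i * star (c j) * ∫ x, e i x * star (e j x) ∂μ := by
      intro j
      rw [← integral_const_mul]
      congr 1; ext x; ring
    simp_rw [hij]
    rw [Finset.sum_eq_single i (fun j _ hj => by rw [horth i j hj.symm, mul_zero]) (by simp),
      integral_norm_sq_eq, ← ofReal_norm_sq]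
    push_cast; rfl
  rw [Complex.ofReal_inj.1 key, Finset.mul_sum]
  refine Finset.sum_le_sum fun i _ => ?_
  rw [mul_comm]
  exact mul_le_mul_of_nonneg_right (hK i) (by positivity)

end Orthogonal

/-! ### The standard vector law -/

section StdVec

variable {N : ℕ}

lemma measurePreserving_eval_stdVecCN (i : Fin N) :
    MeasurePreserving (fun g : Vec N => g i) (stdVecCN N) stdCN :=
  measurePreserving_eval (fun _ => stdCN) i

lemma memLp_eval_stdVecCN (i : Fin N) (k : ℕ) : MemLp (fun g : Vec N => g i) k (stdVecCN N) :=
  (memLp_id_stdCN k).comp_measurePreserving (measurePreserving_eval_stdVecCN i)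

lemma memLp_two_eval_stdVecCN (i : Fin N) : MemLp (fun g : Vec N => g i) 2 (stdVecCN N) := by
  exact_mod_cast memLp_eval_stdVecCN i 2

lemma integrable_norm_pow_stdVecCN (i : Fin N) (k : ℕ) :
    Integrable (fun g : Vec N => ‖g i‖ ^ k) (stdVecCN N) :=
  (measurePreserving_eval_stdVecCN i).integrable_comp_of_integrable (integrable_norm_pow_stdCN k)

lemma integral_comp_eval_stdVecCN {E : Type*} [NormedAddCommGroup E] [NormedSpace ℝ E]
    (i : Fin N) {f : ℂ → E} (hf : StronglyMeasurable f) :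
    ∫ g, f (g i) ∂(stdVecCN N) = ∫ z, f z ∂stdCN := by
  rw [← (measurePreserving_eval_stdVecCN i).map_eq, integral_map
    (measurePreserving_eval_stdVecCN i).measurable.aemeasurable hf.aestronglyMeasurable]

/-- Multiplication of the `m`-th coordinate by the imaginary unit. -/
def rotCoord (m : Fin N) (g : Vec N) : Vec N := fun i => (if i = m then Complex.I else 1) * g i

/-- The factor is i rather than −1 because the rotation must also detect g_m², which a change of
sign leaves fixed. -/
lemma measurePreserving_rotCoord (m : Fin N) :
    MeasurePreserving (rotCoord m) (stdVecCN N) (stdVecCN N) := by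
  refine measurePreserving_pi (fun _ => stdCN) (fun _ => stdCN)
    (f := fun i z => (if i = m then Complex.I else 1) * z) fun i => ?_
  split_ifs
  · exact measurePreserving_I_mul_stdCN
  · simpa [Function.id_def] using MeasurePreserving.id stdCN

lemma integral_eval_stdVecCN (i : Fin N) : ∫ g, g i ∂(stdVecCN N) = 0 := by
  rw [integral_comp_eval_stdVecCN i (f := fun z => z) (by fun_prop), integral_id_stdCN]

lemma integral_mul_conj_stdVecCN (i j : Fin N) :
    ∫ g, g i * star (g j) ∂(stdVecCN N) = if i = j then 1 else 0 := by
  split_ifs with h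
  · subst h
    rw [integral_comp_eval_stdVecCN i (f := fun z => z * star z)
      (by apply Measurable.stronglyMeasurable; fun_prop), integral_mul_conj_stdCN]
  · refine integral_eq_zero_of_semi_invariant (measurePreserving_rotCoord i)
      (by apply Measurable.aestronglyMeasurable; fun_prop) I_ne_one fun g => ?_
    simp [rotCoord, Ne.symm h]
    ring

lemma lintegral_linear_stdVecCN_le (c : Vec N) :
    ∫⁻ g, ‖c ⬝ᵥ g‖ₑ ^ 2 ∂(stdVecCN N) ≤ ENNReal.ofReal (∑ i, ‖c i‖ ^ 2) := by
  have := lintegral_enorm_sq_sum_le (e := fun i (g : Vec N) => g i) memLp_two_eval_stdVecCN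
    (fun i j hij => by rw [integral_mul_conj_stdVecCN, if_neg hij]) (K := 1)
    (fun i => by rw [integral_comp_eval_stdVecCN i (f := fun z => ‖z‖ ^ 2)
      (by apply Measurable.stronglyMeasurable; fun_prop), integral_norm_sq_stdCN]) c
  simpa [dotProduct] using this

/-- The centred products `conj(g_i) g_j - δ_ij`. -/
def centProd (p : Fin N × Fin N) (g : Vec N) : ℂ :=
  star (g p.1) * g p.2 - if p.1 = p.2 then 1 else 0

lemma measurable_centProd (p : Fin N × Fin N) : Measurable (centProd p) := by
  unfold centProd; fun_prop

/-- A constant that bounds the second moments of the centred products. -/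
noncomputable def quadConst : ℝ := 2 * ∫ z, ‖z‖ ^ 4 ∂stdCN + 2

lemma quadConst_pos : 0 < quadConst := by
  have : 0 ≤ ∫ z, ‖z‖ ^ 4 ∂stdCN := integral_nonneg fun _ => by positivity
  unfold quadConst; positivity

/-- With a = |g_i| and b = |g_j|: (ab + 1)² ≤ 2a²b² + 2 ≤ a⁴ + b⁴ + 2. -/
lemma norm_centProd_sq_le (p : Fin N × Fin N) (g : Vec N) :
    ‖centProd p g‖ ^ 2 ≤ ‖g p.1‖ ^ 4 + ‖g p.2‖ ^ 4 + 2 := by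
  have h1 : ‖centProd p g‖ ≤ ‖g p.1‖ * ‖g p.2‖ + 1 := by
    unfold centProd
    refine (norm_sub_le _ _).trans (add_le_add (by simp) ?_)
    split_ifs <;> simp
  have h0 := norm_nonneg (centProd p g)
  nlinarith [sq_nonneg (‖g p.1‖ ^ 2 - ‖g p.2‖ ^ 2), sq_nonneg (‖g p.1‖ * ‖g p.2‖ - 1),
    norm_nonneg (g p.1), norm_nonneg (g p.2)]

lemma integrable_centProd_bound (p : Fin N × Fin N) :
    Integrable (fun g : Vec N => ‖g p.1‖ ^ 4 + ‖g p.2‖ ^ 4 + 2) (stdVecCN N) :=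
  ((integrable_norm_pow_stdVecCN _ 4).add (integrable_norm_pow_stdVecCN _ 4)).add
    (integrable_const _)

lemma memLp_centProd (p : Fin N × Fin N) : MemLp (centProd p) 2 (stdVecCN N) := by
  rw [memLp_two_iff_integrable_sq_norm (measurable_centProd p).aestronglyMeasurable]
  refine (integrable_centProd_bound p).mono' ?_ (ae_of_all _ fun g => ?_)
  · exact ((measurable_centProd p).norm.pow_const 2).aestronglyMeasurable
  · rw [Real.norm_of_nonneg (by positivity)]
    exact norm_centProd_sq_le p g

lemma integral_norm_centProd_sq_le (p : Fin N × Fin N) :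
    ∫ g, ‖centProd p g‖ ^ 2 ∂(stdVecCN N) ≤ quadConst := by
  have h : ∀ i : Fin N, ∫ g, ‖g i‖ ^ 4 ∂(stdVecCN N) = ∫ z, ‖z‖ ^ 4 ∂stdCN := fun i =>
    integral_comp_eval_stdVecCN i (f := fun z => ‖z‖ ^ 4)
      (by apply Measurable.stronglyMeasurable; fun_prop)
  calc ∫ g, ‖centProd p g‖ ^ 2 ∂(stdVecCN N)
      ≤ ∫ g, (‖g p.1‖ ^ 4 + ‖g p.2‖ ^ 4 + 2) ∂(stdVecCN N) :=
        integral_mono ((memLp_two_iff_integrable_sq_norm (memLp_centProd p).1).1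
          (memLp_centProd p)) (integrable_centProd_bound p) (norm_centProd_sq_le p)
    _ = quadConst := by
        have h2 : Integrable (fun g : Vec N => ‖g p.1‖ ^ 4 + ‖g p.2‖ ^ 4) (stdVecCN N) :=
          (integrable_norm_pow_stdVecCN _ 4).add (integrable_norm_pow_stdVecCN _ 4)
        rw [integral_add h2 (integrable_const _), integral_add (integrable_norm_pow_stdVecCN _ 4)
          (integrable_norm_pow_stdVecCN _ 4), h, h]
        simp [quadConst]
        ring

lemma centProd_rotCoord (p : Fin N × Fin N) (m : Fin N) (g : Vec N) :
    centProd p (rotCoord m g) = (if p.1 = m then -Complex.I else 1) *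
      (if p.2 = m then Complex.I else 1) * centProd p g := by
  unfold centProd rotCoord
  by_cases h1 : p.1 = m <;> by_cases h2 : p.2 = m
  · simp only [h1, h2, if_true, star_mul', RCLike.star_def, Complex.conj_I]
    linear_combination -Complex.I_mul_I
  · simp [h1, h2, Ne.symm h2]; ring
  · simp [h1, h2]; ring
  · simp [h1, h2]

/-- For distinct pairs, rotating a suitable coordinate multiplies the product by a constant other
than 1. The exception is two diagonal pairs, whose factors are independent and centred. -/
lemma integral_centProd_mul_conj {p q : Fin N × Fin N} (hpq : p ≠ q) :
    ∫ g, centProd p g * star (centProd q g) ∂(stdVecCN N) = 0 := by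
  have hmeas : AEStronglyMeasurable (fun g => centProd p g * star (centProd q g)) (stdVecCN N) :=
    ((measurable_centProd p).mul (continuous_star.measurable.comp
      (measurable_centProd q))).aestronglyMeasurable
  have key : ∀ m : Fin N, (if p.1 = m then -Complex.I else 1) * (if p.2 = m then Complex.I else 1) *
      ((if q.1 = m then Complex.I else 1) * (if q.2 = m then -Complex.I else 1)) ≠ 1 →
      ∫ g, centProd p g * star (centProd q g) ∂(stdVecCN N) = 0 := by
    intro m hm
    refine integral_eq_zero_of_semi_invariant (measurePreserving_rotCoord m) hmeas hm fun g => ?_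
    rw [centProd_rotCoord, centProd_rotCoord, star_mul', star_mul']
    have h1 : star (if q.1 = m then -Complex.I else 1) = if q.1 = m then Complex.I else 1 := by
      split_ifs <;> simp
    have h2 : star (if q.2 = m then Complex.I else 1) = if q.2 = m then -Complex.I else 1 := by
      split_ifs <;> simp
    rw [h1, h2]; ring
  have hI1 : -Complex.I ≠ 1 := by simp [Complex.ext_iff]
  have hI2 : (-1 : ℂ) ≠ 1 := by norm_num
  obtain ⟨i, j⟩ := p
  obtain ⟨k, l⟩ := q
  simp only at key
  by_cases hij : i = j
  · subst hij
    by_cases hkl : k = l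
    · subst hkl
      have hik : i ≠ k := fun h => hpq (by rw [h])
      have hind : IndepFun (fun g : Vec N => centProd (i, i) g)
          (fun g : Vec N => star (centProd (k, k) g)) (stdVecCN N) := by
        have h := (iIndepFun_pi (μ := fun _ : Fin N => stdCN) (X := fun _ z => z)
          (fun _ => aemeasurable_id)).indepFun hik
        exact h.comp (φ := fun z : ℂ => star z * z - if i = i then 1 else 0)
          (ψ := fun z : ℂ => star (star z * z - if k = k then 1 else 0))
          (by fun_prop) (by fun_prop)
      have h0 : ∫ g, centProd (i, i) g ∂(stdVecCN N) = 0 := by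
        unfold centProd
        simp only [if_true]
        rw [integral_sub _ (integrable_const _)]
        · simp_rw [mul_comm (star _)]
          rw [integral_mul_conj_stdVecCN]
          simp
        · simpa [mul_comm] using
            integrable_mul_conj (memLp_two_eval_stdVecCN i) (memLp_two_eval_stdVecCN i)
      have := hind.integral_mul_eq_mul_integral (measurable_centProd _).aestronglyMeasurable
        (continuous_star.measurable.comp (measurable_centProd _)).aestronglyMeasurable
      simp only [Pi.mul_apply] at this
      rw [this, h0, zero_mul]
    · refine key k ?_
      by_cases h : i = k <;> simp [h, Ne.symm hkl, I_ne_one]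
  · by_cases hik : i = k
    · subst hik
      have hjl : j ≠ l := fun h => hpq (by rw [h])
      refine key j ?_
      simp [hij, Ne.symm hjl, I_ne_one]
    · refine key i ?_
      -- If i = l, the first index of p and the second of q both rotate and the total factor is
      -- (−i)² = −1; otherwise it is −i.
      by_cases h : i = l
      · subst h; simp [Ne.symm hij, Ne.symm hik, hI2]
      · simp [Ne.symm hij, Ne.symm hik, Ne.symm h, hI1]

/-- The centred form is ∑ Q_ij (g_i* g_j − δ_ij), an orthogonal expansion, so its second moment is
controlled by the squared Frobenius norm. -/
lemma lintegral_quadForm_stdVecCN_le (Q : Matrix (Fin N) (Fin N) ℂ) :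
    ∫⁻ g, ‖star g ⬝ᵥ Q *ᵥ g - Q.trace‖ₑ ^ 2 ∂(stdVecCN N) ≤
      ENNReal.ofReal (quadConst * ∑ i, ∑ j, ‖Q i j‖ ^ 2) := by
  have := lintegral_enorm_sq_sum_le (e := centProd (N := N)) memLp_centProd
    (fun p q hpq => integral_centProd_mul_conj hpq) integral_norm_centProd_sq_le
    (fun p => Q p.1 p.2)
  rw [Fintype.sum_prod_type] at this
  convert this using 4 with g
  rw [Fintype.sum_prod_type]
  simp only [centProd, dotProduct, Matrix.mulVec, Matrix.trace, Matrix.diag, Finset.mul_sum,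
    mul_sub, Finset.sum_sub_distrib, Pi.star_apply]
  refine congrArg _ (congrArg₂ _ (Finset.sum_congr rfl fun i _ => Finset.sum_congr rfl fun j _ => ?_) ?_)
  · ring
  · simp

end StdVec

/-! ### Spectral norms -/

section Spectral

open scoped Matrix.Norms.L2Operator

variable {N : ℕ}

lemma eucNorm_sq (x : Vec N) : eucNorm x ^ 2 = ∑ i, ‖x i‖ ^ 2 := by
  simp [eucNorm, EuclideanSpace.norm_sq_eq]

lemma eucNorm_nonneg (x : Vec N) : 0 ≤ eucNorm x := norm_nonneg _

lemma eucNorm_mulVec_le (B : Matrix (Fin N) (Fin N) ℂ) (x : Vec N) :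
    eucNorm (B *ᵥ x) ≤ ‖B‖ * eucNorm x :=
  Matrix.l2_opNorm_mulVec B (WithLp.toLp 2 x)

lemma sum_norm_sq_mulVec_le (B : Matrix (Fin N) (Fin N) ℂ) (x : Vec N) :
    ∑ i, ‖(B *ᵥ x) i‖ ^ 2 ≤ ‖B‖ ^ 2 * ∑ i, ‖x i‖ ^ 2 := by
  rw [← eucNorm_sq, ← eucNorm_sq, ← mul_pow]
  exact pow_le_pow_left₀ (eucNorm_nonneg _) (eucNorm_mulVec_le B x) 2

lemma sum_norm_sq_col_le (B : Matrix (Fin N) (Fin N) ℂ) (j : Fin N) :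
    ∑ i, ‖B i j‖ ^ 2 ≤ ‖B‖ ^ 2 := by
  have := sum_norm_sq_mulVec_le B (Pi.single j 1)
  rw [Matrix.mulVec_single_one] at this
  refine this.trans_eq ?_
  rw [Finset.sum_eq_single j (fun i _ hi => by simp [Pi.single_eq_of_ne hi]) (by simp)]
  simp

lemma sum_norm_sq_row_le (B : Matrix (Fin N) (Fin N) ℂ) (i : Fin N) :
    ∑ j, ‖B i j‖ ^ 2 ≤ ‖B‖ ^ 2 := by
  simpa [Matrix.l2_opNorm_conjTranspose] using sum_norm_sq_col_le Bᴴ i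

lemma norm_entry_le (B : Matrix (Fin N) (Fin N) ℂ) (i j : Fin N) : ‖B i j‖ ≤ ‖B‖ := by
  refine (pow_le_pow_iff_left₀ (norm_nonneg _) (norm_nonneg _) two_ne_zero).1 ?_
  exact (Finset.single_le_sum (f := fun j => ‖B i j‖ ^ 2) (fun _ _ => by positivity)
    (Finset.mem_univ j)).trans (sum_norm_sq_row_le B i)

/-- A bounded spectral norm gives a squared Frobenius norm of order N only; this is why the variance
of a quadratic form is O(N) and not O(N²). -/
lemma sum_norm_sq_entries_le (B : Matrix (Fin N) (Fin N) ℂ) :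
    ∑ i, ∑ j, ‖B i j‖ ^ 2 ≤ N * ‖B‖ ^ 2 := by
  refine (Finset.sum_le_sum fun i _ => sum_norm_sq_row_le B i).trans_eq ?_
  simp

lemma norm_diagonal_diag_le (B : Matrix (Fin N) (Fin N) ℂ) :
    ‖(Matrix.diagonal fun i => B i i : Matrix (Fin N) (Fin N) ℂ)‖ ≤ ‖B‖ := by
  rw [Matrix.l2_opNorm_diagonal]
  exact (pi_norm_le_iff_of_nonneg (norm_nonneg _)).2 fun i => norm_entry_le B i i

-- Collects all that later proofs need of the square root: it is Hermitian, squares to Q, and has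
-- squared norm ‖Q‖.
open scoped MatrixOrder in
lemma exists_vecCN_eq_map {Q : Matrix (Fin N) (Fin N) ℂ} (hQ : Q.PosSemidef) :
    ∃ L : Matrix (Fin N) (Fin N) ℂ, vecCN Q = (stdVecCN N).map (fun g => L *ᵥ g) ∧
      L * L = Q ∧ Lᴴ = L ∧ ‖L‖ ^ 2 = ‖Q‖ := by
  have h1 : CFC.sqrt Q * CFC.sqrt Q = Q := CFC.sqrt_mul_sqrt_self Q hQ.nonneg
  have h2 : (CFC.sqrt Q)ᴴ = CFC.sqrt Q :=
    (Matrix.nonneg_iff_posSemidef.1 (CFC.sqrt_nonneg Q)).isHermitian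
  refine ⟨CFC.sqrt Q, rfl, h1, h2, ?_⟩
  have h3 := Matrix.l2_opNorm_conjTranspose_mul_self (CFC.sqrt Q)
  rw [h2, h1] at h3
  rw [h3, sq]

lemma norm_sum_mul_conj_le (x y : Vec N) : ‖star x ⬝ᵥ y‖ ≤ eucNorm x * eucNorm y := by
  have h := norm_inner_le_norm (𝕜 := ℂ) (WithLp.toLp 2 x) (WithLp.toLp 2 y)
  rwa [EuclideanSpace.inner_toLp_toLp, dotProduct_comm] at h

end Spectral

/-! ### Cross-covariance matrices -/

/-- The entries `E{x_i conj(y_j)}` exist and form the matrix `Q`. -/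
structure IsCov {Ω : Type*} [MeasurableSpace Ω] (μ : Measure Ω) {m n : ℕ} (x : Ω → Vec m)
    (y : Ω → Vec n) (Q : Matrix (Fin m) (Fin n) ℂ) : Prop where
  integrable : ∀ i j, Integrable (fun ω => x ω i * star (y ω j)) μ
  integral_eq : ∀ i j, ∫ ω, x ω i * star (y ω j) ∂μ = Q i j

namespace IsCov

variable {Ω Ω' : Type*} [MeasurableSpace Ω] [MeasurableSpace Ω'] {μ : Measure Ω} {ν : Measure Ω'}
  {k m n : ℕ} {x x' : Ω → Vec m} {y y' : Ω → Vec n} {Q Q' : Matrix (Fin m) (Fin n) ℂ}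

lemma symm (h : IsCov μ x y Q) : IsCov μ y x Qᴴ where
  integrable i j := by
    have := Complex.conjLIE.integrable_comp_iff.2 (h.integrable j i)
    simpa [mul_comm] using this
  integral_eq i j := by
    rw [Matrix.conjTranspose_apply, ← h.integral_eq j i, RCLike.star_def, ← integral_conj]
    congr 1; ext ω; simp [mul_comm]

lemma add_left (h : IsCov μ x y Q) (h' : IsCov μ x' y Q') :
    IsCov μ (fun ω => x ω + x' ω) y (Q + Q') where
  integrable i j := by
    simp only [Pi.add_apply, add_mul]
    exact (h.integrable i j).add (h'.integrable i j)
  integral_eq i j := by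
    simp only [Pi.add_apply, add_mul, Matrix.add_apply]
    rw [integral_add (h.integrable i j) (h'.integrable i j), h.integral_eq, h'.integral_eq]

lemma add_right (h : IsCov μ x y Q) (h' : IsCov μ x y' Q') :
    IsCov μ x (fun ω => y ω + y' ω) (Q + Q') := by
  simpa using (h.symm.add_left h'.symm).symm

lemma mulVec_left (B : Matrix (Fin k) (Fin m) ℂ) (h : IsCov μ x y Q) :
    IsCov μ (fun ω => B *ᵥ x ω) y (B * Q) where
  integrable i j := by
    simp only [Matrix.mulVec, dotProduct, Finset.sum_mul, mul_assoc]
    exact integrable_finsetSum _ fun l _ => (h.integrable l j).const_mul _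
  integral_eq i j := by
    simp only [Matrix.mulVec, dotProduct, Finset.sum_mul, mul_assoc, Matrix.mul_apply]
    rw [integral_finsetSum _ fun l _ => (h.integrable l j).const_mul _]
    simp_rw [integral_const_mul, h.integral_eq]

lemma mulVec_right (B : Matrix (Fin k) (Fin n) ℂ) (h : IsCov μ x y Q) :
    IsCov μ x (fun ω => B *ᵥ y ω) (Q * Bᴴ) := by
  simpa using (h.symm.mulVec_left B).symm

lemma neg_left (h : IsCov μ x y Q) : IsCov μ (fun ω => -x ω) y (-Q) := by
  simpa [Matrix.neg_mulVec] using h.mulVec_left (-1 : Matrix (Fin m) (Fin m) ℂ)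

lemma sub_left (h : IsCov μ x y Q) (h' : IsCov μ x' y Q') :
    IsCov μ (fun ω => x ω - x' ω) y (Q - Q') := by
  simpa [sub_eq_add_neg] using h.add_left h'.neg_left

lemma sub_right (h : IsCov μ x y Q) (h' : IsCov μ x y' Q') :
    IsCov μ x (fun ω => y ω - y' ω) (Q - Q') := by
  simpa using (h.symm.sub_left h'.symm).symm

lemma integrable_norm_sq {Q : Matrix (Fin m) (Fin m) ℂ} (h : IsCov μ x x Q) (i : Fin m) :
    Integrable (fun ω => ‖x ω i‖ ^ 2) μ := by
  have := (h.integrable i i).re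
  refine this.congr (ae_of_all _ fun ω => ?_)
  simp only [← ofReal_norm_sq]
  exact Complex.ofReal_re _

lemma integral_sum_norm_sq {Q : Matrix (Fin m) (Fin m) ℂ} (h : IsCov μ x x Q) :
    ∫ ω, ∑ i, ‖x ω i‖ ^ 2 ∂μ = Q.trace.re := by
  rw [integral_finsetSum _ fun i _ => h.integrable_norm_sq i, Matrix.trace, Complex.re_sum]
  refine Finset.sum_congr rfl fun i _ => ?_
  rw [Matrix.diag_apply, ← h.integral_eq, ← integral_norm_sq_eq, Complex.ofReal_re]

lemma lintegral_sum_enorm_sq {Q : Matrix (Fin m) (Fin m) ℂ} (h : IsCov μ x x Q) :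
    ∫⁻ ω, ∑ i, ‖x ω i‖ₑ ^ 2 ∂μ = ENNReal.ofReal Q.trace.re := by
  rw [← h.integral_sum_norm_sq, ofReal_integral_eq_lintegral_ofReal
    (integrable_finsetSum _ fun i _ => h.integrable_norm_sq i)
    (ae_of_all _ fun _ => by positivity)]
  refine lintegral_congr fun ω => ?_
  rw [ENNReal.ofReal_sum_of_nonneg fun _ _ => by positivity]
  refine Finset.sum_congr rfl fun i _ => ?_
  rw [ENNReal.ofReal_pow (norm_nonneg _), ofReal_norm]

end IsCov

/-! ### Gaussian vectors with a given covariance matrix -/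

section VecCN

open scoped Matrix.Norms.L2Operator

variable {N : ℕ}

lemma isCov_stdVecCN : IsCov (stdVecCN N) (fun g => g) (fun g => g) 1 where
  integrable i j := integrable_mul_conj (memLp_two_eval_stdVecCN i) (memLp_two_eval_stdVecCN j)
  integral_eq i j := by rw [integral_mul_conj_stdVecCN, Matrix.one_apply]

lemma isCov_vecCN {Q : Matrix (Fin N) (Fin N) ℂ} (hQ : Q.PosSemidef) :
    IsCov (vecCN Q) (fun x => x) (fun x => x) Q := by
  obtain ⟨L, hL, h1, h2, -⟩ := exists_vecCN_eq_map hQ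
  have h := (isCov_stdVecCN.mulVec_left (L)).mulVec_right (L)
  rw [mul_one, h2, h1] at h
  constructor
  · intro i j
    rw [hL]
    rw [integrable_map_measure (by apply Measurable.aestronglyMeasurable; fun_prop)
      (measurable_mulVec _).aemeasurable]
    exact h.integrable i j
  · intro i j
    rw [hL]
    rw [integral_map (measurable_mulVec _).aemeasurable
      (by apply Measurable.aestronglyMeasurable; fun_prop)]
    exact h.integral_eq i j

lemma memLp_eval_vecCN (Q : Matrix (Fin N) (Fin N) ℂ) (i : Fin N) (k : ℕ) :
    MemLp (fun x : Vec N => x i) k (vecCN Q) := by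
  unfold vecCN
  rw [memLp_map_measure_iff (by apply Measurable.aestronglyMeasurable; fun_prop)
    (measurable_mulVec _).aemeasurable]
  simp only [Function.comp_def, Matrix.mulVec, dotProduct]
  exact memLp_finsetSum _ fun j _ => (memLp_eval_stdVecCN j k).const_mul _

lemma integral_eval_vecCN (Q : Matrix (Fin N) (Fin N) ℂ) (i : Fin N) :
    ∫ x, x i ∂(vecCN Q) = 0 := by
  unfold vecCN
  rw [integral_map (measurable_mulVec _).aemeasurable
    (by apply Measurable.aestronglyMeasurable; fun_prop)]
  simp only [Matrix.mulVec, dotProduct]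
  rw [integral_finsetSum _ fun j _ =>
    ((memLp_two_eval_stdVecCN j).integrable one_le_two).const_mul _]
  simp [integral_const_mul, integral_eval_stdVecCN]

/-- The substitution x = Lg turns the form into gᴴ(LBL)g, whose matrix has trace tr(BQ) and spectral
norm at most ‖B‖‖Q‖. -/
lemma lintegral_quadForm_vecCN_le {Q : Matrix (Fin N) (Fin N) ℂ} (hQ : Q.PosSemidef)
    (B : Matrix (Fin N) (Fin N) ℂ) :
    ∫⁻ x, ‖star x ⬝ᵥ B *ᵥ x - (B * Q).trace‖ₑ ^ 2 ∂(vecCN Q) ≤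
      ENNReal.ofReal (quadConst * (N * (‖B‖ * ‖Q‖) ^ 2)) := by
  obtain ⟨L, hL, h1, h2, h3⟩ := exists_vecCN_eq_map hQ
  rw [hL, lintegral_map (by unfold dotProduct Matrix.mulVec dotProduct; fun_prop) (measurable_mulVec _)]
  have h := lintegral_quadForm_stdVecCN_le (L * B * L)
  have htr : (L * B * L).trace = (B * Q).trace := by
    rw [mul_assoc, Matrix.trace_mul_comm, mul_assoc, h1]
  refine (le_of_eq ?_).trans (h.trans (ENNReal.ofReal_le_ofReal ?_))
  · refine lintegral_congr fun g => ?_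
    rw [htr, Matrix.star_mulVec, h2, ← Matrix.dotProduct_mulVec, Matrix.mulVec_mulVec,
      Matrix.mulVec_mulVec, mul_assoc]
  · refine mul_le_mul_of_nonneg_left ((sum_norm_sq_entries_le _).trans ?_) quadConst_pos.le
    refine mul_le_mul_of_nonneg_left (pow_le_pow_left₀ (norm_nonneg _) ?_ 2) (Nat.cast_nonneg _)
    calc ‖L * B * L‖ ≤ ‖L‖ * ‖B‖ * ‖L‖ :=
          (norm_mul_le _ _).trans (mul_le_mul_of_nonneg_right (norm_mul_le _ _) (norm_nonneg _))
      _ = ‖B‖ * ‖Q‖ := by rw [← h3]; ring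

lemma dotProduct_sqrt_mulVec (Q : Matrix (Fin N) (Fin N) ℂ) (c g : Vec N) :
    c ⬝ᵥ (Q *ᵥ g) = (Qᵀ *ᵥ c) ⬝ᵥ g := by
  rw [Matrix.dotProduct_mulVec, Matrix.mulVec_transpose]

lemma sum_norm_sq_transpose_mulVec_le (B : Matrix (Fin N) (Fin N) ℂ) (c : Vec N) :
    ∑ i, ‖(Bᵀ *ᵥ c) i‖ ^ 2 ≤ ‖B‖ ^ 2 * ∑ i, ‖c i‖ ^ 2 := by
  have h := sum_norm_sq_mulVec_le Bᴴ (star c)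
  rw [Matrix.l2_opNorm_conjTranspose] at h
  simp only [Pi.star_apply, norm_star] at h
  refine (le_of_eq ?_).trans h
  refine Finset.sum_congr rfl fun i _ => ?_
  rw [← norm_star]
  congr 2
  simp [Matrix.mulVec, dotProduct]

lemma lintegral_linear_vecCN_le {Q : Matrix (Fin N) (Fin N) ℂ} (hQ : Q.PosSemidef) (c : Vec N) :
    ∫⁻ x, ‖c ⬝ᵥ x‖ₑ ^ 2 ∂(vecCN Q) ≤ ENNReal.ofReal (‖Q‖ * ∑ i, ‖c i‖ ^ 2) := by
  obtain ⟨L, hL, h1, h2, h3⟩ := exists_vecCN_eq_map hQ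
  rw [hL, lintegral_map (by unfold dotProduct; fun_prop) (measurable_mulVec _)]
  simp_rw [dotProduct_sqrt_mulVec]
  refine (lintegral_linear_stdVecCN_le _).trans (ENNReal.ofReal_le_ofReal ?_)
  rw [← h3]
  exact sum_norm_sq_transpose_mulVec_le _ c

lemma enorm_add_sq_le {E : Type*} [SeminormedAddCommGroup E] (a b : E) :
    ‖a + b‖ₑ ^ 2 ≤ 2 * ‖a‖ₑ ^ 2 + 2 * ‖b‖ₑ ^ 2 := by
  have h : ‖a + b‖ ^ 2 ≤ 2 * ‖a‖ ^ 2 + 2 * ‖b‖ ^ 2 := by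
    have := norm_add_le a b
    nlinarith [norm_nonneg (a + b), sq_nonneg (‖a‖ - ‖b‖)]
  have h2 := ENNReal.ofReal_le_ofReal h
  rw [ENNReal.ofReal_add (by positivity) (by positivity), ENNReal.ofReal_mul (by norm_num),
    ENNReal.ofReal_mul (by norm_num)] at h2
  simpa [ENNReal.ofReal_pow] using h2

/-- |cᵀg|² is a quadratic form whose rank-one matrix has trace and Frobenius norm both equal to ∑
|c_i|², so the fourth moment follows from the second moment of the centred form. -/
lemma lintegral_linear_pow_four_stdVecCN_le (c : Vec N) :
    ∫⁻ g, ‖c ⬝ᵥ g‖ₑ ^ 4 ∂(stdVecCN N) ≤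
      ENNReal.ofReal ((2 * quadConst + 2) * (∑ i, ‖c i‖ ^ 2) ^ 2) := by
  set s := ∑ i, ‖c i‖ ^ 2 with hs
  set Q : Matrix (Fin N) (Fin N) ℂ := Matrix.of fun i j => star (c i) * c j with hQ
  have htr : Q.trace = (s : ℂ) := by
    simp only [Matrix.trace, Matrix.diag, hQ, Matrix.of_apply, hs, Complex.ofReal_sum,
      ofReal_norm_sq, mul_comm]
  have hfr : ∑ i, ∑ j, ‖Q i j‖ ^ 2 = s ^ 2 := by
    simp only [hQ, Matrix.of_apply, norm_mul, norm_star, mul_pow]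
    rw [sq, hs, Finset.sum_mul_sum]
  have hq : ∀ g : Vec N, star g ⬝ᵥ Q *ᵥ g = star (c ⬝ᵥ g) * (c ⬝ᵥ g) := by
    intro g
    simp only [dotProduct, Matrix.mulVec, hQ, Matrix.of_apply, star_sum,
      Finset.mul_sum, Finset.sum_mul, Pi.star_apply, star_mul']
    rw [Finset.sum_comm]
    refine Finset.sum_congr rfl fun i _ => Finset.sum_congr rfl fun j _ => by ring
  have hpt : ∀ g : Vec N, ‖c ⬝ᵥ g‖ₑ ^ 4 ≤
      2 * ‖star g ⬝ᵥ Q *ᵥ g - Q.trace‖ₑ ^ 2 + 2 * ‖(s : ℂ)‖ₑ ^ 2 := by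
    intro g
    refine le_trans (le_of_eq ?_) (enorm_add_sq_le _ _)
    rw [htr, sub_add_cancel, hq, enorm_mul, ← ofReal_norm (star _), norm_star, ofReal_norm]
    ring
  refine (lintegral_mono hpt).trans ?_
  rw [lintegral_add_right _ measurable_const, lintegral_const_mul' _ _ (by simp), lintegral_const,
    measure_univ, mul_one]
  refine (add_le_add_left (mul_le_mul_right (lintegral_quadForm_stdVecCN_le Q) 2) _).trans ?_
  rw [hfr, ← ofReal_norm, ← ENNReal.ofReal_pow (norm_nonneg _), Complex.norm_real, Real.norm_eq_abs,
    sq_abs, add_mul, ENNReal.ofReal_add (by have := quadConst_pos; positivity) (by positivity),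
    mul_assoc, ENNReal.ofReal_mul zero_le_two, ENNReal.ofReal_mul zero_le_two]
  simp

/-- A constant that bounds the fourth moments of linear forms of Gaussian vectors. -/
noncomputable def fourthConst : ℝ := 2 * quadConst + 2

lemma fourthConst_pos : 0 < fourthConst := by
  have := quadConst_pos
  unfold fourthConst; positivity

lemma lintegral_linear_pow_four_vecCN_le {Q : Matrix (Fin N) (Fin N) ℂ} (hQ : Q.PosSemidef)
    (c : Vec N) :
    ∫⁻ x, ‖c ⬝ᵥ x‖ₑ ^ 4 ∂(vecCN Q) ≤
      ENNReal.ofReal (fourthConst * (‖Q‖ * ∑ i, ‖c i‖ ^ 2) ^ 2) := by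
  obtain ⟨L, hL, h1, h2, h3⟩ := exists_vecCN_eq_map hQ
  rw [hL, lintegral_map (by unfold dotProduct; fun_prop) (measurable_mulVec _)]
  simp_rw [dotProduct_sqrt_mulVec]
  refine (lintegral_linear_pow_four_stdVecCN_le _).trans (ENNReal.ofReal_le_ofReal ?_)
  refine mul_le_mul_of_nonneg_left (pow_le_pow_left₀ (by positivity) ?_ 2) fourthConst_pos.le
  rw [← h3]
  exact sum_norm_sq_transpose_mulVec_le _ c

end VecCN

/-! ### Scalar Gaussian laws -/

lemma memLp_id_scalarCN (v : ℝ) (k : ℕ) : MemLp (fun z : ℂ => z) k (scalarCN v) := by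
  unfold scalarCN
  rw [memLp_map_measure_iff (by fun_prop) (by fun_prop)]
  exact (memLp_id_stdCN k).const_mul _

lemma integral_scalarCN {E : Type*} [NormedAddCommGroup E] [NormedSpace ℝ E] (v : ℝ)
    {f : ℂ → E} (hf : StronglyMeasurable f) :
    ∫ z, f z ∂(scalarCN v) = ∫ z, f (((Real.sqrt v : ℝ) : ℂ) * z) ∂stdCN := by
  unfold scalarCN
  rw [integral_map (by fun_prop) hf.aestronglyMeasurable]

lemma integral_id_scalarCN (v : ℝ) : ∫ z, z ∂(scalarCN v) = 0 := by
  rw [integral_scalarCN v (by fun_prop), integral_const_mul, integral_id_stdCN, mul_zero]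

lemma integral_mul_conj_scalarCN {v : ℝ} (hv : 0 ≤ v) : ∫ z, z * star z ∂(scalarCN v) = v := by
  rw [integral_scalarCN v (by apply Measurable.stronglyMeasurable; fun_prop)]
  have : ∀ z : ℂ, ((Real.sqrt v : ℝ) : ℂ) * z * star (((Real.sqrt v : ℝ) : ℂ) * z) =
      v * (z * star z) := by
    intro z
    rw [star_mul', RCLike.star_def, Complex.conj_ofReal]
    have h : ((Real.sqrt v : ℝ) : ℂ) * ((Real.sqrt v : ℝ) : ℂ) = v := by
      exact_mod_cast Real.mul_self_sqrt hv
    linear_combination (z * (starRingEnd ℂ) z) * h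
  simp_rw [this]
  rw [integral_const_mul, integral_mul_conj_stdCN, mul_one]

/-! ### Second-order statistics of the uplink -/

section Uplink

variable {N : ℕ} (P : Params)

lemma Params.pUT_pos : 0 < P.pUT := by
  have := norm_pos_iff.2 P.d_ne_zero
  unfold Params.pUT; positivity

lemma Params.star_d_mul_d : star P.d * P.d = (P.pUT : ℂ) := by
  rw [mul_comm, ← ofReal_norm_sq, Params.pUT]

variable {P} {R S : Matrix (Fin N) (Fin N) ℂ}

lemma uplink_integral_mul {f₁ : Vec N → ℂ} {f₂ : ℂ → ℂ} {f₃ f₄ : Vec N → ℂ}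
    (h₁ : Integrable f₁ (vecCN R)) (h₂ : Integrable f₂ (scalarCN (P.κtUT * P.pUT)))
    (h₃ : Integrable f₃ (vecCN S)) (h₄ : Integrable f₄ (stdVecCN N)) :
    Integrable (fun ω : Uplink N => f₁ ω.1 * (f₂ ω.2.1 * (f₃ ω.2.2.1 * f₄ ω.2.2.2)))
      (uplinkLaw P R S) ∧
    ∫ ω, f₁ ω.1 * (f₂ ω.2.1 * (f₃ ω.2.2.1 * f₄ ω.2.2.2)) ∂(uplinkLaw P R S) =
      (∫ x, f₁ x ∂(vecCN R)) * ((∫ x, f₂ x ∂(scalarCN (P.κtUT * P.pUT))) *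
        ((∫ x, f₃ x ∂(vecCN S)) * ∫ x, f₄ x ∂(stdVecCN N))) := by
  refine ⟨h₁.mul_prod (h₂.mul_prod (h₃.mul_prod h₄)), ?_⟩
  unfold uplinkLaw
  rw [integral_prod_mul f₁ (fun y : ℂ × Vec N × Vec N => f₂ y.1 * (f₃ y.2.1 * f₄ y.2.2)),
    integral_prod_mul f₂ (fun y : Vec N × Vec N => f₃ y.1 * f₄ y.2), integral_prod_mul]

/-- Each product x_i y_j* needed below splits into functions of the four independent sources, so a
covariance is found by listing four factors and multiplying their means. -/
lemma isCov_uplink_of_mul {x y : Uplink N → Vec N} {Q : Matrix (Fin N) (Fin N) ℂ}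
    (f₁ : Fin N → Fin N → Vec N → ℂ) (f₂ : ℂ → ℂ) (f₃ f₄ : Fin N → Fin N → Vec N → ℂ)
    (h₁ : ∀ i j, Integrable (f₁ i j) (vecCN R))
    (h₂ : Integrable f₂ (scalarCN (P.κtUT * P.pUT)))
    (h₃ : ∀ i j, Integrable (f₃ i j) (vecCN S)) (h₄ : ∀ i j, Integrable (f₄ i j) (stdVecCN N))
    (heq : ∀ i j ω, x ω i * star (y ω j) =
      f₁ i j ω.1 * (f₂ ω.2.1 * (f₃ i j ω.2.2.1 * f₄ i j ω.2.2.2)))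
    (hQ : ∀ i j, (∫ x, f₁ i j x ∂(vecCN R)) * ((∫ x, f₂ x ∂(scalarCN (P.κtUT * P.pUT))) *
        ((∫ x, f₃ i j x ∂(vecCN S)) * ∫ x, f₄ i j x ∂(stdVecCN N))) = Q i j) :
    IsCov (uplinkLaw P R S) x y Q where
  integrable i j := by
    simp_rw [heq]
    exact (uplink_integral_mul (h₁ i j) h₂ (h₃ i j) (h₄ i j)).1
  integral_eq i j := by
    simp_rw [heq]
    rw [(uplink_integral_mul (h₁ i j) h₂ (h₃ i j) (h₄ i j)).2, hQ]

/-- The faded pilot `h (d + η_t^UT)`. -/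
def fadedPilot (P : Params) (ω : Uplink N) : Vec N := fun i => ω.1 i * (P.d + ω.2.1)

lemma pilotObs_eq (ω : Uplink N) :
    pilotObs P ω = fadedPilot P ω + (ω.2.2.1 + etaRBS P ω) := by
  ext i
  simp [pilotObs, fadedPilot, add_assoc]

lemma memLp_two_eval_vecCN (Q : Matrix (Fin N) (Fin N) ℂ) (i : Fin N) :
    MemLp (fun x : Vec N => x i) 2 (vecCN Q) := by
  exact_mod_cast memLp_eval_vecCN Q i 2

lemma memLp_two_norm_vecCN (Q : Matrix (Fin N) (Fin N) ℂ) (c : ℝ) (i : Fin N) :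
    MemLp (fun x : Vec N => ((c * ‖x i‖ : ℝ) : ℂ)) 2 (vecCN Q) :=
  (((memLp_two_eval_vecCN Q i).norm).const_mul c).ofReal

lemma integrable_eval_vecCN (Q : Matrix (Fin N) (Fin N) ℂ) (i : Fin N) :
    Integrable (fun x : Vec N => x i) (vecCN Q) :=
  (memLp_two_eval_vecCN Q i).integrable one_le_two

lemma integrable_star_eval_vecCN (Q : Matrix (Fin N) (Fin N) ℂ) (i : Fin N) :
    Integrable (fun x : Vec N => star (x i)) (vecCN Q) :=
  (memLp_two_eval_vecCN Q i).star.integrable one_le_two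

lemma integrable_star_eval_stdVecCN (i : Fin N) :
    Integrable (fun x : Vec N => star (x i)) (stdVecCN N) :=
  (memLp_two_eval_stdVecCN i).star.integrable one_le_two

lemma integral_star_eval_stdVecCN (i : Fin N) : ∫ x, star (x i) ∂(stdVecCN N) = 0 := by
  simp_rw [RCLike.star_def]
  rw [integral_conj, integral_eval_stdVecCN, map_zero]

lemma memLp_two_pilot (P : Params) :
    MemLp (fun η : ℂ => P.d + η) 2 (scalarCN (P.κtUT * P.pUT)) := by
  refine (memLp_const P.d).add ?_
  exact_mod_cast memLp_id_scalarCN _ 2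

lemma integral_pilot (P : Params) : ∫ η, (P.d + η) ∂(scalarCN (P.κtUT * P.pUT)) = P.d := by
  have h : MemLp (fun η : ℂ => η) 2 (scalarCN (P.κtUT * P.pUT)) := by
    exact_mod_cast memLp_id_scalarCN _ 2
  rw [integral_add (integrable_const _) (h.integrable one_le_two), integral_id_scalarCN]
  simp

lemma integral_pilot_mul_conj (P : Params) :
    ∫ η, (P.d + η) * star (P.d + η) ∂(scalarCN (P.κtUT * P.pUT)) =
      ((P.pUT * (1 + P.κtUT) : ℝ) : ℂ) := by
  have h : MemLp (fun η : ℂ => η) 2 (scalarCN (P.κtUT * P.pUT)) := by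
    exact_mod_cast memLp_id_scalarCN _ 2
  have h1 : Integrable (fun η : ℂ => P.d * star η) (scalarCN (P.κtUT * P.pUT)) :=
    (h.star.integrable one_le_two).const_mul _
  have h2 : Integrable (fun η : ℂ => η * star P.d) (scalarCN (P.κtUT * P.pUT)) :=
    (h.integrable one_le_two).mul_const _
  have h3 : Integrable (fun η : ℂ => η * star η) (scalarCN (P.κtUT * P.pUT)) :=
    integrable_mul_conj h h
  have h4 : Integrable (fun η : ℂ => η * star P.d + η * star η) (scalarCN (P.κtUT * P.pUT)) :=
    h2.add h3
  have h5 : Integrable (fun η : ℂ => P.d * star η + (η * star P.d + η * star η))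
    (scalarCN (P.κtUT * P.pUT)) := h1.add h4
  have e : ∀ η : ℂ, (P.d + η) * star (P.d + η) =
      P.d * star P.d + (P.d * star η + (η * star P.d + η * star η)) := by
    intro η; rw [star_add]; ring
  simp_rw [e]
  have h6 : ∫ η, star η ∂(scalarCN (P.κtUT * P.pUT)) = 0 := by
    simp_rw [RCLike.star_def]
    rw [integral_conj, integral_id_scalarCN, map_zero]
  rw [integral_add (integrable_const _) h5, integral_add h1 h4, integral_add h2 h3,
    integral_const_mul P.d star, h6, integral_mul_const (star P.d) (fun η => η),
    integral_id_scalarCN, integral_mul_conj_scalarCN (mul_nonneg P.κtUT_nonneg P.pUT_pos.le),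
    integral_const, mul_comm P.d, P.star_d_mul_d]
  simp
  ring

lemma etaRBS_apply (ω : Uplink N) (i : Fin N) : etaRBS P ω i =
    ((Real.sqrt (P.κrBS * P.pUT) * ‖ω.1 i‖ : ℝ) : ℂ) * ω.2.2.2 i := rfl

lemma integral_norm_sq_eval_vecCN (hR : R.PosSemidef) (c : ℝ) (i : Fin N) :
    ∫ x, ((c * ‖x i‖ : ℝ) : ℂ) * ((c * ‖x i‖ : ℝ) : ℂ) ∂(vecCN R) = (c ^ 2 : ℝ) * R i i := by
  have : ∀ x : Vec N, ((c * ‖x i‖ : ℝ) : ℂ) * ((c * ‖x i‖ : ℝ) : ℂ) =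
      (c ^ 2 : ℝ) * (x i * star (x i)) := by
    intro x
    rw [← ofReal_norm_sq]; push_cast; ring
  simp_rw [this]
  rw [integral_const_mul, (isCov_vecCN hR).integral_eq]

lemma isCov_chan_chan (hR : R.PosSemidef) : IsCov (uplinkLaw P R S) chan chan R := by
  refine isCov_uplink_of_mul (fun i j x => x i * star (x j)) (fun _ => 1) (fun _ _ _ => 1)
    (fun _ _ _ => 1) ((isCov_vecCN hR).integrable) (integrable_const _)
    (fun _ _ => integrable_const _) (fun _ _ => integrable_const _) (fun i j ω => ?_)
    (fun i j => ?_)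
  · simp [chan]
  · simp [← (isCov_vecCN hR).integral_eq]

lemma isCov_fadedPilot_chan (hR : R.PosSemidef) :
    IsCov (uplinkLaw P R S) (fadedPilot P) chan (P.d • R) := by
  refine isCov_uplink_of_mul (fun i j x => x i * star (x j)) (fun η => P.d + η) (fun _ _ _ => 1)
    (fun _ _ _ => 1) ((isCov_vecCN hR).integrable) ((memLp_two_pilot P).integrable one_le_two)
    (fun _ _ => integrable_const _) (fun _ _ => integrable_const _) (fun i j ω => ?_)
    (fun i j => ?_)
  · simp [chan, fadedPilot]; ring
  · rw [(isCov_vecCN hR).integral_eq, integral_pilot]; simp [mul_comm]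

lemma isCov_fadedPilot_fadedPilot (hR : R.PosSemidef) :
    IsCov (uplinkLaw P R S) (fadedPilot P) (fadedPilot P)
      (((P.pUT * (1 + P.κtUT) : ℝ) : ℂ) • R) := by
  refine isCov_uplink_of_mul (fun i j x => x i * star (x j))
    (fun η => (P.d + η) * star (P.d + η)) (fun _ _ _ => 1)
    (fun _ _ _ => 1) ((isCov_vecCN hR).integrable)
    (integrable_mul_conj (memLp_two_pilot P) (memLp_two_pilot P))
    (fun _ _ => integrable_const _) (fun _ _ => integrable_const _) (fun i j ω => ?_)
    (fun i j => ?_)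
  · simp only [fadedPilot, star_mul']; ring
  · rw [(isCov_vecCN hR).integral_eq, integral_pilot_mul_conj]; simp [mul_comm]

lemma isCov_noise_noise (hS : S.PosSemidef) :
    IsCov (uplinkLaw P R S) (fun ω => ω.2.2.1) (fun ω => ω.2.2.1) S := by
  refine isCov_uplink_of_mul (fun _ _ _ => 1) (fun _ => 1) (fun i j x => x i * star (x j))
    (fun _ _ _ => 1) (fun _ _ => integrable_const _) (integrable_const _)
    ((isCov_vecCN hS).integrable) (fun _ _ => integrable_const _) (fun i j ω => ?_)
    (fun i j => ?_)
  · simp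
  · simp [← (isCov_vecCN hS).integral_eq]

lemma isCov_noise_chan : IsCov (uplinkLaw P R S) (fun ω => ω.2.2.1) chan 0 := by
  refine isCov_uplink_of_mul (fun i j x => star (x j)) (fun _ => 1) (fun i j x => x i)
    (fun _ _ _ => 1) (fun _ _ => integrable_star_eval_vecCN _ _) (integrable_const _)
    (fun _ _ => integrable_eval_vecCN _ _) (fun _ _ => integrable_const _) (fun i j ω => ?_)
    (fun i j => ?_)
  · simp [chan]; ring
  · simp [integral_eval_vecCN]

lemma isCov_noise_fadedPilot :
    IsCov (uplinkLaw P R S) (fun ω => ω.2.2.1) (fadedPilot P) 0 := by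
  refine isCov_uplink_of_mul (fun i j x => star (x j)) (fun η => star (P.d + η))
    (fun i j x => x i) (fun _ _ _ => 1) (fun _ _ => integrable_star_eval_vecCN _ _)
    ((memLp_two_pilot P).star.integrable one_le_two)
    (fun _ _ => integrable_eval_vecCN _ _) (fun _ _ => integrable_const _) (fun i j ω => ?_)
    (fun i j => ?_)
  · simp only [fadedPilot, star_mul']; ring
  · simp [integral_eval_vecCN]

/-- The distortion depends on h, but it carries an independent factor ξ_j of mean zero, which makes
it uncorrelated with h. -/
lemma isCov_chan_etaRBS : IsCov (uplinkLaw P R S) chan (etaRBS P) 0 := by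
  refine isCov_uplink_of_mul
    (fun i j x => x i * star ((Real.sqrt (P.κrBS * P.pUT) * ‖x j‖ : ℝ) : ℂ)) (fun η => 1)
    (fun i j x => 1) (fun i j x => star (x j))
    (fun _ _ => integrable_mul_conj (memLp_two_eval_vecCN _ _) (memLp_two_norm_vecCN _ _ _))
    (integrable_const _)
    (fun _ _ => integrable_const _) (fun _ _ => integrable_star_eval_stdVecCN _) (fun i j ω => ?_)
    (fun i j => ?_)
  · simp only [chan, etaRBS_apply, star_mul']; ring
  · rw [integral_star_eval_stdVecCN]; simp

lemma isCov_fadedPilot_etaRBS : IsCov (uplinkLaw P R S) (fadedPilot P) (etaRBS P) 0 := by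
  refine isCov_uplink_of_mul
    (fun i j x => x i * star ((Real.sqrt (P.κrBS * P.pUT) * ‖x j‖ : ℝ) : ℂ)) (fun η => P.d + η)
    (fun i j x => 1) (fun i j x => star (x j))
    (fun _ _ => integrable_mul_conj (memLp_two_eval_vecCN _ _) (memLp_two_norm_vecCN _ _ _))
    ((memLp_two_pilot P).integrable one_le_two)
    (fun _ _ => integrable_const _) (fun _ _ => integrable_star_eval_stdVecCN _) (fun i j ω => ?_)
    (fun i j => ?_)
  · simp only [fadedPilot, etaRBS_apply, star_mul']; ring
  · rw [integral_star_eval_stdVecCN]; simp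

lemma isCov_noise_etaRBS : IsCov (uplinkLaw P R S) (fun ω => ω.2.2.1) (etaRBS P) 0 := by
  refine isCov_uplink_of_mul
    (fun i j x => star ((Real.sqrt (P.κrBS * P.pUT) * ‖x j‖ : ℝ) : ℂ)) (fun η => 1)
    (fun i j x => x i) (fun i j x => star (x j))
    (fun _ _ => (memLp_two_norm_vecCN _ _ _).star.integrable one_le_two)
    (integrable_const _)
    (fun _ _ => integrable_eval_vecCN _ _) (fun _ _ => integrable_star_eval_stdVecCN _)
    (fun i j ω => ?_) (fun i j => ?_)
  · simp only [etaRBS_apply, star_mul']; ring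
  · rw [integral_star_eval_stdVecCN]; simp

lemma isCov_etaRBS_etaRBS (hR : R.PosSemidef) :
    IsCov (uplinkLaw P R S) (etaRBS P) (etaRBS P)
      (((P.pUT * P.κrBS : ℝ) : ℂ) • Matrix.diagonal (fun i => R i i)) := by
  refine isCov_uplink_of_mul
    (fun i j x => ((Real.sqrt (P.κrBS * P.pUT) * ‖x i‖ : ℝ) : ℂ) *
      star ((Real.sqrt (P.κrBS * P.pUT) * ‖x j‖ : ℝ) : ℂ)) (fun η => 1)
    (fun i j x => 1) (fun i j x => x i * star (x j))
    (fun _ _ => integrable_mul_conj (memLp_two_norm_vecCN _ _ _) (memLp_two_norm_vecCN _ _ _))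
    (integrable_const _)
    (fun _ _ => integrable_const _) (isCov_stdVecCN.integrable)
    (fun i j ω => ?_) (fun i j => ?_)
  · simp only [etaRBS_apply, star_mul']; ring
  · rw [isCov_stdVecCN.integral_eq]
    by_cases h : i = j
    · subst h
      simp only [RCLike.star_def, Complex.conj_ofReal]
      rw [integral_norm_sq_eval_vecCN hR,
        Real.sq_sqrt (mul_nonneg P.κrBS_nonneg P.pUT_pos.le), mul_comm P.κrBS]
      simp
    · simp [h]

/-- The covariance matrix `p^UT (1 + κ_t^UT) R + Ψ` of the pilot observation. -/
noncomputable def obsCov (P : Params) (R S : Matrix (Fin N) (Fin N) ℂ) :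
    Matrix (Fin N) (Fin N) ℂ :=
  ((P.pUT * (1 + P.κtUT) : ℝ) : ℂ) • R + psi P R S

lemma isCov_pilotObs_chan (hR : R.PosSemidef) :
    IsCov (uplinkLaw P R S) (pilotObs P) chan (P.d • R) := by
  have h := (isCov_fadedPilot_chan (P := P) (S := S) hR).add_left
    ((isCov_noise_chan (P := P) (R := R) (S := S)).add_left isCov_chan_etaRBS.symm)
  simpa [← pilotObs_eq] using h

lemma isCov_pilotObs_pilotObs (hR : R.PosSemidef) (hS : S.PosSemidef) :
    IsCov (uplinkLaw P R S) (pilotObs P) (pilotObs P) (obsCov P R S) := by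
  have h := ((isCov_fadedPilot_fadedPilot (P := P) (S := S) hR).add_right
      ((isCov_noise_fadedPilot (P := P) (R := R) (S := S)).symm.add_right
        isCov_fadedPilot_etaRBS)).add_left
    (((isCov_noise_fadedPilot (P := P) (R := R) (S := S)).add_left
      isCov_fadedPilot_etaRBS.symm).add_right
      (((isCov_noise_noise (P := P) (R := R) hS).add_right isCov_noise_etaRBS).add_left
        (isCov_noise_etaRBS.symm.add_right (isCov_etaRBS_etaRBS hR))))
  simp only [← pilotObs_eq] at h
  convert h using 1
  simp [obsCov, psi]
  abel

lemma isCov_estimationError (hR : R.PosSemidef) (hS : S.PosSemidef)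
    (B : Matrix (Fin N) (Fin N) ℂ) :
    IsCov (uplinkLaw P R S) (fun ω => B *ᵥ pilotObs P ω - chan ω)
      (fun ω => B *ᵥ pilotObs P ω - chan ω)
      (B * obsCov P R S * Bᴴ - B * (P.d • R) - ((P.d • R)ᴴ * Bᴴ - R)) :=
  (((isCov_pilotObs_pilotObs hR hS).mulVec_left B).mulVec_right B |>.sub_right
    ((isCov_pilotObs_chan hR).mulVec_left B)).sub_left
    (((isCov_pilotObs_chan hR).symm.mulVec_right B).sub_right (isCov_chan_chan hR))

lemma psi_posDef (hR : R.PosSemidef) (hS : S.PosDef) : (psi P R S).PosDef := by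
  refine Matrix.PosDef.posSemidef_add (Matrix.PosSemidef.smul ?_ ?_) hS
  · exact Matrix.PosSemidef.diagonal fun i => hR.diag_nonneg
  · exact_mod_cast mul_nonneg P.pUT_pos.le P.κrBS_nonneg

lemma obsCov_posDef (hR : R.PosSemidef) (hS : S.PosDef) : (obsCov P R S).PosDef := by
  refine Matrix.PosDef.posSemidef_add (hR.smul ?_) (psi_posDef hR hS)
  exact_mod_cast mul_nonneg P.pUT_pos.le (add_nonneg zero_le_one P.κtUT_nonneg)

/-- The normal equations of linear estimation. Every later use of A goes through this identity or
through norm bounds, so the inverse is rarely opened. -/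
lemma lmmseMatrix_mul_obsCov (hR : R.PosSemidef) (hS : S.PosDef) :
    lmmseMatrix P R S * obsCov P R S = star P.d • R := by
  have hu : IsUnit (obsCov P R S).det :=
    (Matrix.isUnit_iff_isUnit_det _).1 (obsCov_posDef (P := P) hR hS).isUnit
  change (star P.d • (R * (obsCov P R S)⁻¹)) * obsCov P R S = _
  rw [Matrix.smul_mul, mul_assoc, Matrix.nonsing_inv_mul _ hu, mul_one]

lemma obsCov_mul_lmmseMatrix (hR : R.PosSemidef) (hS : S.PosDef) :
    obsCov P R S * (lmmseMatrix P R S)ᴴ = P.d • R := by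
  have h := congrArg Matrix.conjTranspose (lmmseMatrix_mul_obsCov (P := P) hR hS)
  rwa [Matrix.conjTranspose_mul, (obsCov_posDef (P := P) hR hS).isHermitian.eq,
    Matrix.conjTranspose_smul, star_star, hR.isHermitian.eq] at h

lemma mse_eq (hR : R.PosSemidef) (hS : S.PosDef) (B : Matrix (Fin N) (Fin N) ℂ) :
    mse P R S B = (B * obsCov P R S * Bᴴ - B * (P.d • R) - ((P.d • R)ᴴ * Bᴴ - R)).trace.re := by
  rw [← (isCov_estimationError hR hS.posSemidef B).integral_sum_norm_sq]
  simp_rw [mse, eucNorm_sq]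

/-- Orthogonality principle: at the solution of the normal equations both cross terms equal the
quadratic term, so the four terms collapse to two. -/
lemma estimationError_lmmseMatrix (hR : R.PosSemidef) (hS : S.PosDef) :
    let A := lmmseMatrix P R S
    A * obsCov P R S * Aᴴ - A * (P.d • R) - ((P.d • R)ᴴ * Aᴴ - R) =
      R - A * obsCov P R S * Aᴴ := by
  intro A
  have h1 : A * (P.d • R) = A * obsCov P R S * Aᴴ := by
    rw [← obsCov_mul_lmmseMatrix hR hS, mul_assoc]
  have h2 : (P.d • R)ᴴ * Aᴴ = A * obsCov P R S * Aᴴ := by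
    rw [lmmseMatrix_mul_obsCov hR hS, Matrix.conjTranspose_smul, hR.isHermitian.eq]
  rw [h1, h2]; abel

theorem mse_lmmseMatrix_le (hR : R.PosSemidef) (hS : S.PosDef) (B : Matrix (Fin N) (Fin N) ℂ) :
    mse P R S (lmmseMatrix P R S) ≤ mse P R S B := by
  rw [mse_eq hR hS, mse_eq hR hS, estimationError_lmmseMatrix hR hS, ← sub_nonneg, ← Complex.sub_re,
    ← Matrix.trace_sub]
  set A := lmmseMatrix P R S with hA
  -- Completion of the square: the excess error of B is the quadratic expression of B − A in the
  -- covariance of the observation.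
  have h : B * obsCov P R S * Bᴴ - B * (P.d • R) - ((P.d • R)ᴴ * Bᴴ - R) -
      (R - A * obsCov P R S * Aᴴ) = (B - A) * obsCov P R S * (B - A)ᴴ := by
    have h2 : (P.d • R)ᴴ = A * obsCov P R S := by
      rw [lmmseMatrix_mul_obsCov hR hS, Matrix.conjTranspose_smul, hR.isHermitian.eq]
    rw [h2, ← obsCov_mul_lmmseMatrix (P := P) hR hS, Matrix.conjTranspose_sub]
    noncomm_ring
  rw [h]
  exact (Complex.le_def.1 ((obsCov_posDef (P := P) hR hS).posSemidef.mul_mul_conjTranspose_same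
    (B - A)).trace_nonneg).1

lemma errCov_eq (hR : R.PosSemidef) (hS : S.PosDef) :
    errCov P R S = R - lmmseMatrix P R S * obsCov P R S * (lmmseMatrix P R S)ᴴ := by
  rw [← estimationError_lmmseMatrix hR hS]
  ext i j
  rw [← (isCov_estimationError hR hS.posSemidef _).integral_eq]
  rfl

lemma estPower_eq (hR : R.PosSemidef) (hS : S.PosDef) :
    estPower P R S = (lmmseMatrix P R S * obsCov P R S * (lmmseMatrix P R S)ᴴ).trace.re := by
  rw [estPower, errCov_eq hR hS, sub_sub_cancel]

end Uplink

/-! ### Fluctuations of quadratic forms of the pilot observation -/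

section Fluctuations

open scoped Matrix.Norms.L2Operator

variable {N : ℕ}

/-- Cauchy–Schwarz over n summands costs a factor n² but requires no orthogonality, so the pieces of
an expansion can be bounded one at a time. -/
lemma lintegral_enorm_sq_fin_sum_le {Ω : Type*} [MeasurableSpace Ω] {μ : Measure Ω} {n : ℕ}
    {f : Fin n → Ω → ℂ} (hf : ∀ i, Measurable (f i)) {C : ℝ}
    (h : ∀ i, ∫⁻ x, ‖f i x‖ₑ ^ 2 ∂μ ≤ ENNReal.ofReal C) :
    ∫⁻ x, ‖∑ i, f i x‖ₑ ^ 2 ∂μ ≤ ENNReal.ofReal (n ^ 2 * C) := by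
  have hpt : ∀ x, ‖∑ i, f i x‖ₑ ^ 2 ≤ n * ∑ i, ‖f i x‖ₑ ^ 2 := by
    intro x
    have h1 : ‖∑ i, f i x‖ ^ 2 ≤ n * ∑ i, ‖f i x‖ ^ 2 := by
      refine (pow_le_pow_left₀ (norm_nonneg _) (norm_sum_le _ _) 2).trans ?_
      simpa using sq_sum_le_card_mul_sum_sq (s := Finset.univ) (f := fun i => ‖f i x‖)
    have h2 := ENNReal.ofReal_le_ofReal h1
    rw [ENNReal.ofReal_mul (Nat.cast_nonneg _), ENNReal.ofReal_sum_of_nonneg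
      fun _ _ => by positivity] at h2
    simpa [ENNReal.ofReal_pow] using h2
  refine (lintegral_mono hpt).trans ?_
  rw [lintegral_const_mul' _ _ (by simp), lintegral_finsetSum' _ fun i _ =>
    ((hf i).enorm.pow_const 2).aemeasurable]
  calc (n : ℝ≥0∞) * ∑ i, ∫⁻ x, ‖f i x‖ₑ ^ 2 ∂μ ≤ n * ∑ _i : Fin n, ENNReal.ofReal C :=
        mul_le_mul_right (Finset.sum_le_sum fun i _ => h i) _
    _ = ENNReal.ofReal (n ^ 2 * C) := by
        rw [ENNReal.ofReal_mul (by positivity), ENNReal.ofReal_pow (Nat.cast_nonneg _)]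
        simp [sq, mul_assoc]

lemma lintegral_enorm_const_mul_sq_le {Ω : Type*} [MeasurableSpace Ω] {μ : Measure Ω}
    {f : Ω → ℂ} {C : ℝ} (h : ∫⁻ x, ‖f x‖ₑ ^ 2 ∂μ ≤ ENNReal.ofReal C) (a : ℂ) :
    ∫⁻ x, ‖a * f x‖ₑ ^ 2 ∂μ ≤ ENNReal.ofReal (‖a‖ ^ 2 * C) := by
  simp_rw [enorm_mul, mul_pow]
  rw [lintegral_const_mul' _ _ (by simp), ENNReal.ofReal_mul (by positivity),
    ENNReal.ofReal_pow (norm_nonneg _), ofReal_norm]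
  exact mul_le_mul_right h _

/-- The distortion `c |h_i| ξ_i`. -/
noncomputable def distortion (c : ℝ) (h ξ : Vec N) : Vec N := fun i => ((c * ‖h i‖ : ℝ) : ℂ) * ξ i

/-- The joint law of the channel, the noise and the normalized receiver distortion. -/
noncomputable def chanNoiseLaw (R S : Matrix (Fin N) (Fin N) ℂ) :
    Measure (Vec N × Vec N × Vec N) :=
  (vecCN R).prod ((vecCN S).prod (stdVecCN N))

instance (R S : Matrix (Fin N) (Fin N) ℂ) : IsProbabilityMeasure (chanNoiseLaw R S) := by
  unfold chanNoiseLaw; infer_instance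

variable {R S B : Matrix (Fin N) (Fin N) ℂ}

lemma measurePreserving_chanNoise_chan :
    MeasurePreserving (fun x : Vec N × Vec N × Vec N => x.1) (chanNoiseLaw R S) (vecCN R) :=
  measurePreserving_fst

lemma measurePreserving_chanNoise_noise :
    MeasurePreserving (fun x : Vec N × Vec N × Vec N => x.2.1) (chanNoiseLaw R S) (vecCN S) :=
  measurePreserving_fst.comp measurePreserving_snd

@[fun_prop]
lemma measurable_sesq {Ω : Type*} [MeasurableSpace Ω] {x y : Ω → Vec N}
    (hx : Measurable x) (hy : Measurable y) (B : Matrix (Fin N) (Fin N) ℂ) :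
    Measurable fun ω => star (x ω) ⬝ᵥ B *ᵥ y ω := by
  have hx' := measurable_pi_iff.1 hx
  have hy' := measurable_pi_iff.1 hy
  unfold dotProduct Matrix.mulVec dotProduct
  simp only [Pi.star_apply]
  fun_prop

@[fun_prop]
lemma measurable_distortion {Ω : Type*} [MeasurableSpace Ω] (c : ℝ) {x y : Ω → Vec N}
    (hx : Measurable x) (hy : Measurable y) :
    Measurable fun ω => distortion c (x ω) (y ω) := by
  have hx' := measurable_pi_iff.1 hx
  have hy' := measurable_pi_iff.1 hy
  unfold distortion
  refine measurable_pi_iff.2 fun i => ?_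
  fun_prop

lemma sesq_conj (x y : Vec N) (B : Matrix (Fin N) (Fin N) ℂ) :
    star y ⬝ᵥ Bᴴ *ᵥ x = star (star x ⬝ᵥ B *ᵥ y) := by
  rw [Matrix.star_dotProduct, Matrix.star_mulVec, Matrix.conjTranspose_conjTranspose,
    ← Matrix.dotProduct_mulVec]

lemma enorm_sesq_conj (x y : Vec N) (B : Matrix (Fin N) (Fin N) ℂ) :
    ‖star y ⬝ᵥ Bᴴ *ᵥ x‖ₑ = ‖star x ⬝ᵥ B *ᵥ y‖ₑ := by
  rw [sesq_conj, ← ofReal_norm, norm_star, ofReal_norm]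

variable {ρ b : ℝ}

lemma lintegral_chan_quadForm_le (hR : R.PosSemidef) (hRρ : ‖R‖ ≤ ρ) (hB : ‖B‖ ≤ b) :
    ∫⁻ x, ‖star x.1 ⬝ᵥ B *ᵥ x.1 - (B * R).trace‖ₑ ^ 2 ∂(chanNoiseLaw R S) ≤
      ENNReal.ofReal (quadConst * (b * ρ) ^ 2 * N) := by
  rw [measurePreserving_chanNoise_chan.lintegral_comp
    (f := fun x => ‖star x ⬝ᵥ B *ᵥ x - (B * R).trace‖ₑ ^ 2)
    (((measurable_sesq measurable_id measurable_id B).sub_const _).enorm.pow_const 2)]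
  refine (lintegral_quadForm_vecCN_le hR B).trans (ENNReal.ofReal_le_ofReal ?_)
  rw [mul_assoc, mul_comm _ (N : ℝ)]
  have := quadConst_pos
  gcongr
  exact (norm_nonneg B).trans hB

lemma lintegral_noise_quadForm_le (hS : S.PosSemidef) (hSρ : ‖S‖ ≤ ρ) (hB : ‖B‖ ≤ b) :
    ∫⁻ x, ‖star x.2.1 ⬝ᵥ B *ᵥ x.2.1 - (B * S).trace‖ₑ ^ 2 ∂(chanNoiseLaw R S) ≤
      ENNReal.ofReal (quadConst * (b * ρ) ^ 2 * N) := by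
  rw [measurePreserving_chanNoise_noise.lintegral_comp
    (f := fun x => ‖star x ⬝ᵥ B *ᵥ x - (B * S).trace‖ₑ ^ 2)
    (((measurable_sesq measurable_id measurable_id B).sub_const _).enorm.pow_const 2)]
  refine (lintegral_quadForm_vecCN_le hS B).trans (ENNReal.ofReal_le_ofReal ?_)
  rw [mul_assoc, mul_comm _ (N : ℝ)]
  have := quadConst_pos
  gcongr
  exact (norm_nonneg B).trans hB

lemma lintegral_chanNoise {f : Vec N × Vec N × Vec N → ℝ≥0∞} (hf : Measurable f) :
    ∫⁻ x, f x ∂(chanNoiseLaw R S) =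
      ∫⁻ h, ∫⁻ ν, ∫⁻ ξ, f (h, ν, ξ) ∂(stdVecCN N) ∂(vecCN S) ∂(vecCN R) := by
  unfold chanNoiseLaw
  rw [lintegral_prod _ hf.aemeasurable]
  refine lintegral_congr fun h => ?_
  exact lintegral_prod _ (hf.comp (measurable_const.prodMk measurable_id)).aemeasurable

/-- This order puts ν innermost, as is needed for forms that are linear in ν once h and ξ are fixed.
-/
lemma lintegral_chanNoise' {f : Vec N × Vec N × Vec N → ℝ≥0∞} (hf : Measurable f) :
    ∫⁻ x, f x ∂(chanNoiseLaw R S) =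
      ∫⁻ h, ∫⁻ ξ, ∫⁻ ν, f (h, ν, ξ) ∂(vecCN S) ∂(stdVecCN N) ∂(vecCN R) := by
  unfold chanNoiseLaw
  rw [lintegral_prod _ hf.aemeasurable]
  refine lintegral_congr fun h => ?_
  exact lintegral_prod_symm _ (hf.comp (measurable_const.prodMk measurable_id)).aemeasurable

lemma sum_enorm_sq_eq (x : Vec N) : ∑ i, ‖x i‖ₑ ^ 2 = ENNReal.ofReal (∑ i, ‖x i‖ ^ 2) := by
  rw [ENNReal.ofReal_sum_of_nonneg fun _ _ => by positivity]
  refine Finset.sum_congr rfl fun i _ => ?_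
  rw [ENNReal.ofReal_pow (norm_nonneg _), ofReal_norm]

/-- A sesquilinear form in the noise and an independent vector. -/
lemma lintegral_sesq_noise_le (hS : S.PosSemidef) (hSρ : ‖S‖ ≤ ρ) (hB : ‖B‖ ≤ b)
    {u : Vec N → Vec N → Vec N} (hu : Measurable fun p : Vec N × Vec N => u p.1 p.2) :
    ∫⁻ x, ‖star (u x.1 x.2.2) ⬝ᵥ B *ᵥ x.2.1‖ₑ ^ 2 ∂(chanNoiseLaw R S) ≤
      ENNReal.ofReal (ρ * b ^ 2) *
        ∫⁻ h, ∫⁻ ξ, ∑ i, ‖u h ξ i‖ₑ ^ 2 ∂(stdVecCN N) ∂(vecCN R) := by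
  have hu' : Measurable fun x : Vec N × Vec N × Vec N => u x.1 x.2.2 :=
    hu.comp (g := fun p : Vec N × Vec N => u p.1 p.2)
      (f := fun x : Vec N × Vec N × Vec N => (x.1, x.2.2)) (by fun_prop)
  rw [lintegral_chanNoise' ((measurable_sesq hu' (by fun_prop) B).enorm.pow_const 2),
    ← lintegral_const_mul' _ _ (by simp)]
  refine lintegral_mono fun h => ?_
  rw [← lintegral_const_mul' _ _ (by simp)]
  refine lintegral_mono fun ξ => ?_
  -- With h and ξ fixed, this is a linear form in ν with coefficient vector Bᵀ applied to the
  -- conjugate of u.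
  simp_rw [dotProduct_sqrt_mulVec]
  refine (lintegral_linear_vecCN_le hS _).trans ?_
  rw [sum_enorm_sq_eq, ← ENNReal.ofReal_mul (by
    have := (norm_nonneg S).trans hSρ; positivity), mul_assoc]
  refine ENNReal.ofReal_le_ofReal ?_
  have h1 := sum_norm_sq_transpose_mulVec_le B (star (u h ξ))
  simp only [Pi.star_apply, norm_star] at h1
  have h2 : ‖B‖ ^ 2 ≤ b ^ 2 := pow_le_pow_left₀ (norm_nonneg _) hB 2
  exact mul_le_mul hSρ (h1.trans (mul_le_mul_of_nonneg_right h2 (by positivity))) (by positivity)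
    ((norm_nonneg S).trans hSρ)

lemma trace_re_le (hRρ : ‖R‖ ≤ ρ) : R.trace.re ≤ ρ * N := by
  rw [Matrix.trace, Complex.re_sum]
  refine (Finset.sum_le_sum fun i _ =>
    ((Complex.re_le_norm _).trans (norm_entry_le R i i)).trans hRρ).trans_eq ?_
  simp [mul_comm]

lemma lintegral_sum_enorm_sq_vecCN_le (hR : R.PosSemidef) (hRρ : ‖R‖ ≤ ρ) :
    ∫⁻ h, ∑ i, ‖h i‖ₑ ^ 2 ∂(vecCN R) ≤ ENNReal.ofReal (ρ * N) := by
  rw [(isCov_vecCN hR).lintegral_sum_enorm_sq]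
  exact ENNReal.ofReal_le_ofReal (trace_re_le hRρ)

lemma lintegral_chan_noise_sesq_le (hR : R.PosSemidef) (hS : S.PosSemidef) (hRρ : ‖R‖ ≤ ρ)
    (hSρ : ‖S‖ ≤ ρ) (hB : ‖B‖ ≤ b) :
    ∫⁻ x, ‖star x.1 ⬝ᵥ B *ᵥ x.2.1‖ₑ ^ 2 ∂(chanNoiseLaw R S) ≤
      ENNReal.ofReal ((ρ * b) ^ 2 * N) := by
  refine (lintegral_sesq_noise_le hS hSρ hB (u := fun h _ => h) (by fun_prop)).trans ?_
  simp only [lintegral_const, measure_univ, mul_one]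
  refine (mul_le_mul_right (lintegral_sum_enorm_sq_vecCN_le hR hRρ) _).trans_eq ?_
  have := (norm_nonneg S).trans hSρ
  rw [← ENNReal.ofReal_mul (by positivity)]
  congr 1; ring

lemma lintegral_sum_enorm_sq_distortion (c : ℝ) (h : Vec N) :
    ∫⁻ ξ, ∑ i, ‖distortion c h ξ i‖ₑ ^ 2 ∂(stdVecCN N) =
      ENNReal.ofReal (c ^ 2) * ∑ i, ‖h i‖ₑ ^ 2 := by
  have h1 := (isCov_stdVecCN (N := N)).mulVec_left
    (Matrix.diagonal fun i => ((c * ‖h i‖ : ℝ) : ℂ)) |>.mulVec_right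
      (Matrix.diagonal fun i => ((c * ‖h i‖ : ℝ) : ℂ))
  have h2 := h1.lintegral_sum_enorm_sq
  simp only [Matrix.mulVec_diagonal] at h2
  rw [sum_enorm_sq_eq, ← ENNReal.ofReal_mul (by positivity)]
  refine h2.trans (congrArg _ ?_)
  simp [Matrix.diagonal_conjTranspose, Matrix.trace_diagonal, Finset.mul_sum]
  refine Finset.sum_congr rfl fun i _ => by ring

lemma lintegral_distortion_noise_sesq_le (hR : R.PosSemidef) (hS : S.PosSemidef) (hRρ : ‖R‖ ≤ ρ)
    (hSρ : ‖S‖ ≤ ρ) (hB : ‖B‖ ≤ b) (c : ℝ) :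
    ∫⁻ x, ‖star (distortion c x.1 x.2.2) ⬝ᵥ B *ᵥ x.2.1‖ₑ ^ 2 ∂(chanNoiseLaw R S) ≤
      ENNReal.ofReal (c ^ 2 * (ρ * b) ^ 2 * N) := by
  refine (lintegral_sesq_noise_le hS hSρ hB (u := distortion c) (by fun_prop)).trans ?_
  simp only [lintegral_sum_enorm_sq_distortion]
  rw [lintegral_const_mul' _ _ (by simp)]
  have := (norm_nonneg S).trans hSρ
  refine (mul_le_mul_right (mul_le_mul_right (lintegral_sum_enorm_sq_vecCN_le hR hRρ) _) _).trans_eq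
    ?_
  rw [← ENNReal.ofReal_mul (by positivity), ← ENNReal.ofReal_mul (by positivity)]
  congr 1; ring

lemma lintegral_mulVec_pow_four_le (hR : R.PosSemidef) (hRρ : ‖R‖ ≤ ρ) (hB : ‖B‖ ≤ b)
    (i : Fin N) :
    ∫⁻ h, ‖(B *ᵥ h) i‖ₑ ^ 4 ∂(vecCN R) ≤ ENNReal.ofReal (fourthConst * (ρ * b ^ 2) ^ 2) := by
  refine (lintegral_linear_pow_four_vecCN_le hR (B i)).trans (ENNReal.ofReal_le_ofReal ?_)
  have := fourthConst_pos
  have h1 := (sum_norm_sq_row_le B i).trans (pow_le_pow_left₀ (norm_nonneg _) hB 2)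
  have := (norm_nonneg R).trans hRρ
  gcongr

lemma norm_one_le_one : ‖(1 : Matrix (Fin N) (Fin N) ℂ)‖ ≤ 1 := by
  rw [← Matrix.diagonal_one, Matrix.l2_opNorm_diagonal]
  exact (pi_norm_le_iff_of_nonneg zero_le_one).2 fun i => by simp

lemma ofReal_sum_pow_four (x : Vec N) :
    ENNReal.ofReal (∑ i, ‖x i‖ ^ 4) = ∑ i, ‖x i‖ₑ ^ 4 := by
  rw [ENNReal.ofReal_sum_of_nonneg fun _ _ => by positivity]
  refine Finset.sum_congr rfl fun i _ => ?_
  rw [ENNReal.ofReal_pow (norm_nonneg _), ofReal_norm]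

lemma lintegral_sum_mulVec_pow_four_le (hR : R.PosSemidef) (hRρ : ‖R‖ ≤ ρ) (hB : ‖B‖ ≤ b) :
    ∫⁻ h, ENNReal.ofReal (∑ i, ‖(B *ᵥ h) i‖ ^ 4) ∂(vecCN R) ≤
      ENNReal.ofReal (fourthConst * (ρ * b ^ 2) ^ 2 * N) := by
  have hm := measurable_mulVec B
  have hm' : ∀ i, Measurable fun h : Vec N => (B *ᵥ h) i := fun i => measurable_pi_iff.1 hm i
  simp_rw [ofReal_sum_pow_four]
  rw [lintegral_finsetSum' _ fun i _ => ((hm' i).enorm.pow_const 4).aemeasurable]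
  refine (Finset.sum_le_sum fun i _ => lintegral_mulVec_pow_four_le hR hRρ hB i).trans_eq ?_
  rw [mul_comm _ (N : ℝ), ENNReal.ofReal_mul (Nat.cast_nonneg _)]
  simp

lemma lintegral_sum_chan_pow_four_le (hR : R.PosSemidef) (hRρ : ‖R‖ ≤ ρ) :
    ∫⁻ h, ENNReal.ofReal (∑ i, ‖h i‖ ^ 4) ∂(vecCN R) ≤
      ENNReal.ofReal (fourthConst * ρ ^ 2 * N) := by
  simpa using lintegral_sum_mulVec_pow_four_le hR hRρ norm_one_le_one

lemma sq_mul_sq_le_add_pow_four (x y : ℝ) : x ^ 2 * y ^ 2 ≤ x ^ 4 + y ^ 4 := by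
  nlinarith [sq_nonneg (x ^ 2 - y ^ 2), sq_nonneg (x ^ 2), sq_nonneg (y ^ 2)]

/-- Given h, the form is linear in ξ with squared coefficients c²|h_i|²|(Bh)_i|². As h and Bh are
dependent, the product is split into fourth powers; each entry is a Gaussian linear form with fourth
moment O(1), so the sum is O(N). -/
lemma lintegral_distortion_chan_sesq_le (hR : R.PosSemidef) (hRρ : ‖R‖ ≤ ρ)
    (hB : ‖B‖ ≤ b) (c : ℝ) :
    ∫⁻ x, ‖star (distortion c x.1 x.2.2) ⬝ᵥ B *ᵥ x.1‖ₑ ^ 2 ∂(chanNoiseLaw R S) ≤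
      ENNReal.ofReal (c ^ 2 * (fourthConst * ρ ^ 2 * (1 + b ^ 4)) * N) := by
  rw [lintegral_chanNoise ((measurable_sesq (by fun_prop) (by fun_prop) B).enorm.pow_const 2)]
  have key : ∀ h : Vec N, ∫⁻ ξ, ‖star (distortion c h ξ) ⬝ᵥ B *ᵥ h‖ₑ ^ 2 ∂(stdVecCN N) ≤
      ENNReal.ofReal (c ^ 2) * (ENNReal.ofReal (∑ i, ‖h i‖ ^ 4) +
        ENNReal.ofReal (∑ i, ‖(B *ᵥ h) i‖ ^ 4)) := by
    intro h
    have e : ∀ ξ : Vec N, ‖star (distortion c h ξ) ⬝ᵥ B *ᵥ h‖ₑ =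
        ‖(fun i => ((c * ‖h i‖ : ℝ) : ℂ) * star ((B *ᵥ h) i)) ⬝ᵥ ξ‖ₑ := by
      intro ξ
      rw [← ofReal_norm, ← norm_star, ofReal_norm]
      congr 1
      simp only [dotProduct, distortion, star_sum, star_mul', star_star, Pi.star_apply]
      refine Finset.sum_congr rfl fun i _ => by ring
    simp_rw [e]
    refine (lintegral_linear_stdVecCN_le _).trans ?_
    rw [← ENNReal.ofReal_add (by positivity) (by positivity),
      ← ENNReal.ofReal_mul (by positivity), ← Finset.sum_add_distrib, Finset.mul_sum]
    refine ENNReal.ofReal_le_ofReal (Finset.sum_le_sum fun i _ => ?_)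
    rw [norm_mul, norm_star, Complex.norm_real, mul_pow, Real.norm_eq_abs, sq_abs, mul_pow,
      mul_assoc]
    refine mul_le_mul_of_nonneg_left ?_ (sq_nonneg c)
    exact sq_mul_sq_le_add_pow_four _ _
  refine (lintegral_mono fun h => lintegral_mono fun ν => key h).trans ?_
  simp only [lintegral_const, measure_univ, mul_one]
  rw [lintegral_const_mul' _ _ (by simp), lintegral_add_left (by fun_prop)]
  refine (mul_le_mul_right (add_le_add (lintegral_sum_chan_pow_four_le hR hRρ)
    (lintegral_sum_mulVec_pow_four_le hR hRρ hB)) _).trans_eq ?_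
  have := fourthConst_pos
  rw [← ENNReal.ofReal_add (by positivity) (by positivity), ← ENNReal.ofReal_mul (by positivity)]
  congr 1; ring

/-- The conditional variance, given the channel, of a quadratic form of the distortion. -/
lemma lintegral_distortion_quadForm_cond_le (hR : R.PosSemidef) (hRρ : ‖R‖ ≤ ρ)
    (hB : ‖B‖ ≤ b) (c : ℝ) :
    ∫⁻ x, ‖star (distortion c x.1 x.2.2) ⬝ᵥ B *ᵥ distortion c x.1 x.2.2 -
        (c ^ 2 : ℝ) * (star x.1 ⬝ᵥ Matrix.diagonal (fun i => B i i) *ᵥ x.1)‖ₑ ^ 2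
          ∂(chanNoiseLaw R S) ≤
      ENNReal.ofReal (c ^ 4 * (quadConst * b ^ 2 * (fourthConst * ρ ^ 2)) * N) := by
  rw [lintegral_chanNoise]
  swap
  · exact (((measurable_sesq (by fun_prop) (by fun_prop) B).sub
      ((measurable_sesq (by fun_prop) (by fun_prop) _).const_mul _)).enorm.pow_const 2)
  have hq := quadConst_pos
  have hf := fourthConst_pos
  have key : ∀ h : Vec N, ∫⁻ ξ, ‖star (distortion c h ξ) ⬝ᵥ B *ᵥ distortion c h ξ -
      (c ^ 2 : ℝ) * (star h ⬝ᵥ Matrix.diagonal (fun i => B i i) *ᵥ h)‖ₑ ^ 2 ∂(stdVecCN N) ≤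
      ENNReal.ofReal (c ^ 4 * (quadConst * b ^ 2)) * ENNReal.ofReal (∑ i, ‖h i‖ ^ 4) := by
    intro h
    -- Given h, the distortion form is a quadratic form in ξ with this matrix. Its trace is the
    -- conditional mean; it still depends on h, and the deviation from its own mean is treated
    -- separately.
    set Q : Matrix (Fin N) (Fin N) ℂ :=
      Matrix.of fun i j => ((c * ‖h i‖ : ℝ) : ℂ) * B i j * ((c * ‖h j‖ : ℝ) : ℂ) with hQ
    have e1 : ∀ ξ : Vec N, star (distortion c h ξ) ⬝ᵥ B *ᵥ distortion c h ξ =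
        star ξ ⬝ᵥ Q *ᵥ ξ := by
      intro ξ
      simp only [dotProduct, Matrix.mulVec, distortion, hQ, Matrix.of_apply, Finset.mul_sum,
        Pi.star_apply, star_mul', RCLike.star_def, Complex.conj_ofReal]
      refine Finset.sum_congr rfl fun i _ => Finset.sum_congr rfl fun j _ => by ring
    have e2 : ((c ^ 2 : ℝ) : ℂ) * (star h ⬝ᵥ Matrix.diagonal (fun i => B i i) *ᵥ h) =
        Q.trace := by
      simp only [dotProduct, Matrix.mulVec_diagonal, Matrix.trace, Matrix.diag, hQ,
        Matrix.of_apply, Finset.mul_sum, Pi.star_apply]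
      refine Finset.sum_congr rfl fun i _ => ?_
      have : star (h i) * h i = (‖h i‖ : ℂ) * ‖h i‖ := by
        rw [mul_comm, ← ofReal_norm_sq]; push_cast; ring
      push_cast
      linear_combination (c : ℂ) ^ 2 * B i i * this
    simp_rw [e1, e2]
    refine (lintegral_quadForm_stdVecCN_le Q).trans ?_
    rw [← ENNReal.ofReal_mul (by positivity)]
    refine ENNReal.ofReal_le_ofReal ?_
    -- |h_i|²|h_j|² ≤ (|h_i|⁴ + |h_j|⁴)/2 separates the indices, so that the row and column sums of
    -- |B_ij|², each at most b², can be taken.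
    have e3 : ∀ i j, ‖Q i j‖ ^ 2 ≤
        c ^ 4 * (‖h i‖ ^ 4 * ‖B i j‖ ^ 2 + ‖h j‖ ^ 4 * ‖B i j‖ ^ 2) / 2 := by
      intro i j
      simp only [hQ, Matrix.of_apply, norm_mul, Complex.norm_real, Real.norm_eq_abs, mul_pow,
        sq_abs, abs_norm]
      have : c ^ 4 * ‖B i j‖ ^ 2 * (2 * (‖h i‖ ^ 2 * ‖h j‖ ^ 2)) ≤
          c ^ 4 * ‖B i j‖ ^ 2 * (‖h i‖ ^ 4 + ‖h j‖ ^ 4) := by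
        refine mul_le_mul_of_nonneg_left ?_ (by positivity)
        nlinarith [sq_nonneg (‖h i‖ ^ 2 - ‖h j‖ ^ 2)]
      linarith
    have hb2 : ‖B‖ ^ 2 ≤ b ^ 2 := pow_le_pow_left₀ (norm_nonneg _) hB 2
    have e4 : ∑ i, ∑ j, ‖h i‖ ^ 4 * ‖B i j‖ ^ 2 ≤ b ^ 2 * ∑ i, ‖h i‖ ^ 4 := by
      rw [Finset.mul_sum]
      refine Finset.sum_le_sum fun i _ => ?_
      rw [← Finset.mul_sum, mul_comm]
      exact mul_le_mul_of_nonneg_right ((sum_norm_sq_row_le B i).trans hb2) (by positivity)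
    have e5 : ∑ i, ∑ j, ‖h j‖ ^ 4 * ‖B i j‖ ^ 2 ≤ b ^ 2 * ∑ i, ‖h i‖ ^ 4 := by
      rw [Finset.sum_comm, Finset.mul_sum]
      refine Finset.sum_le_sum fun i _ => ?_
      rw [← Finset.mul_sum, mul_comm]
      exact mul_le_mul_of_nonneg_right ((sum_norm_sq_col_le B i).trans hb2) (by positivity)
    calc quadConst * ∑ i, ∑ j, ‖Q i j‖ ^ 2
        ≤ quadConst * ∑ i, ∑ j,
          c ^ 4 * (‖h i‖ ^ 4 * ‖B i j‖ ^ 2 + ‖h j‖ ^ 4 * ‖B i j‖ ^ 2) / 2 := by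
          gcongr with i _ j _; exact e3 i j
      _ = quadConst * (c ^ 4 / 2 * (∑ i, ∑ j, ‖h i‖ ^ 4 * ‖B i j‖ ^ 2 +
          ∑ i, ∑ j, ‖h j‖ ^ 4 * ‖B i j‖ ^ 2)) := by
          congr 1
          rw [← Finset.sum_add_distrib, Finset.mul_sum]
          refine Finset.sum_congr rfl fun i _ => ?_
          rw [← Finset.sum_add_distrib, Finset.mul_sum]
          refine Finset.sum_congr rfl fun j _ => by ring
      _ ≤ quadConst * (c ^ 4 / 2 * (b ^ 2 * ∑ i, ‖h i‖ ^ 4 + b ^ 2 * ∑ i, ‖h i‖ ^ 4)) := by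
          gcongr
      _ = c ^ 4 * (quadConst * b ^ 2) * ∑ i, ‖h i‖ ^ 4 := by ring
  refine (lintegral_mono fun h => lintegral_mono fun ν => key h).trans ?_
  simp only [lintegral_const, measure_univ, mul_one]
  rw [lintegral_const_mul' _ _ (by simp)]
  refine (mul_le_mul_right (lintegral_sum_chan_pow_four_le hR hRρ) _).trans_eq ?_
  rw [← ENNReal.ofReal_mul (by positivity)]
  congr 1; ring

end Fluctuations

/-! ### Deviations of ĥᴴh and ‖ĥ‖² from their means for a fixed pilot distortion. -/

section Deviations

open scoped Matrix.Norms.L2Operator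

variable {N : ℕ}

/-- The pilot observation when the faded pilot is `e`. -/
noncomputable def pilotAt (c : ℝ) (e : ℂ) (x : Vec N × Vec N × Vec N) : Vec N :=
  e • x.1 + (x.2.1 + distortion c x.1 x.2.2)

@[fun_prop]
lemma measurable_pilotAt (c : ℝ) (e : ℂ) : Measurable (pilotAt (N := N) c e) := by
  unfold pilotAt; fun_prop

/-- A constant that bounds the fluctuations of all the sesquilinear forms. -/
noncomputable def fluctConst (b ρ c : ℝ) : ℝ :=
  quadConst * (b * ρ) ^ 2 * (1 + c ^ 4) + (ρ * b) ^ 2 * (1 + c ^ 2) +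
    c ^ 2 * (fourthConst * ρ ^ 2 * (1 + b ^ 4)) +
    c ^ 4 * (quadConst * b ^ 2 * (fourthConst * ρ ^ 2))

variable {R S B : Matrix (Fin N) (Fin N) ℂ} {ρ b : ℝ}

/-- Each individual variance constant is one of the nonnegative summands of `fluctConst`, so a
single constant serves every piece of the expansions below. -/
lemma le_fluctConst (b ρ c : ℝ) :
    0 ≤ fluctConst b ρ c ∧ quadConst * (b * ρ) ^ 2 ≤ fluctConst b ρ c ∧
    c ^ 4 * (quadConst * (b * ρ) ^ 2) ≤ fluctConst b ρ c ∧
    (ρ * b) ^ 2 ≤ fluctConst b ρ c ∧ c ^ 2 * (ρ * b) ^ 2 ≤ fluctConst b ρ c ∧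
    c ^ 2 * (fourthConst * ρ ^ 2 * (1 + b ^ 4)) ≤ fluctConst b ρ c ∧
    c ^ 4 * (quadConst * b ^ 2 * (fourthConst * ρ ^ 2)) ≤ fluctConst b ρ c := by
  have h1 := quadConst_pos
  have h2 := fourthConst_pos
  have a1 : 0 ≤ quadConst * (b * ρ) ^ 2 := by positivity
  have a2 : 0 ≤ c ^ 4 * (quadConst * (b * ρ) ^ 2) := by positivity
  have a3 : 0 ≤ (ρ * b) ^ 2 := by positivity
  have a4 : 0 ≤ c ^ 2 * (ρ * b) ^ 2 := by positivity
  have a5 : 0 ≤ c ^ 2 * (fourthConst * ρ ^ 2 * (1 + b ^ 4)) := by positivity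
  have a6 : 0 ≤ c ^ 4 * (quadConst * b ^ 2 * (fourthConst * ρ ^ 2)) := by positivity
  have e : fluctConst b ρ c = quadConst * (b * ρ) ^ 2 + c ^ 4 * (quadConst * (b * ρ) ^ 2) +
      (ρ * b) ^ 2 + c ^ 2 * (ρ * b) ^ 2 + c ^ 2 * (fourthConst * ρ ^ 2 * (1 + b ^ 4)) +
      c ^ 4 * (quadConst * b ^ 2 * (fourthConst * ρ ^ 2)) := by
    unfold fluctConst; ring
  rw [e]
  refine ⟨?_, ?_, ?_, ?_, ?_, ?_, ?_⟩ <;> linarith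

lemma lintegral_le_of_le {Ω : Type*} [MeasurableSpace Ω] {μ : Measure Ω} {f : Ω → ℂ} {k K w n : ℝ}
    (h : ∫⁻ x, ‖f x‖ₑ ^ 2 ∂μ ≤ ENNReal.ofReal (k * n)) (hk : k ≤ K) (hK : 0 ≤ K) (hn : 0 ≤ n)
    (hw : 1 ≤ w) : ∫⁻ x, ‖f x‖ₑ ^ 2 ∂μ ≤ ENNReal.ofReal (K * w * n) := by
  refine h.trans (ENNReal.ofReal_le_ofReal (mul_le_mul_of_nonneg_right ?_ hn))
  nlinarith

lemma lintegral_const_mul_le_of_le {Ω : Type*} [MeasurableSpace Ω] {μ : Measure Ω} {f : Ω → ℂ}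
    {k K w n : ℝ} {a : ℂ}
    (h : ∫⁻ x, ‖f x‖ₑ ^ 2 ∂μ ≤ ENNReal.ofReal (k * n)) (hk : k ≤ K) (hK : 0 ≤ K) (hn : 0 ≤ n)
    (hw : ‖a‖ ^ 2 ≤ w) : ∫⁻ x, ‖a * f x‖ₑ ^ 2 ∂μ ≤ ENNReal.ofReal (K * w * n) := by
  refine (lintegral_enorm_const_mul_sq_le h a).trans (ENNReal.ofReal_le_ofReal ?_)
  rw [← mul_assoc, mul_comm K]
  refine mul_le_mul_of_nonneg_right ?_ hn
  exact (mul_le_mul_of_nonneg_left hk (by positivity)).trans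
    (mul_le_mul_of_nonneg_right hw hK)

lemma measurable_chan' : Measurable fun x : Vec N × Vec N × Vec N => x.1 := measurable_fst

lemma measurable_noise' : Measurable fun x : Vec N × Vec N × Vec N => x.2.1 :=
  measurable_fst.comp measurable_snd

lemma measurable_distortion' (c : ℝ) :
    Measurable fun x : Vec N × Vec N × Vec N => distortion c x.1 x.2.2 :=
  measurable_distortion c measurable_fst (measurable_snd.comp measurable_snd)

lemma lintegral_noise_chan_sesq_le (hR : R.PosSemidef) (hS : S.PosSemidef) (hRρ : ‖R‖ ≤ ρ)
    (hSρ : ‖S‖ ≤ ρ) (hB : ‖B‖ ≤ b) :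
    ∫⁻ x, ‖star x.2.1 ⬝ᵥ B *ᵥ x.1‖ₑ ^ 2 ∂(chanNoiseLaw R S) ≤
      ENNReal.ofReal ((ρ * b) ^ 2 * N) := by
  have hB' : ‖Bᴴ‖ ≤ b := by rwa [Matrix.l2_opNorm_conjTranspose]
  have := lintegral_chan_noise_sesq_le hR hS hRρ hSρ hB'
  simpa only [enorm_sesq_conj] using this

/-- The inner product of the estimate and the channel is close to its conditional mean. -/
lemma lintegral_inner_deviation_le (hR : R.PosSemidef) (hS : S.PosSemidef) (hRρ : ‖R‖ ≤ ρ)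
    (hSρ : ‖S‖ ≤ ρ) (hB : ‖B‖ ≤ b) (c : ℝ) (e : ℂ) :
    ∫⁻ x, ‖star (pilotAt c e x) ⬝ᵥ B *ᵥ x.1 - star e * (B * R).trace‖ₑ ^ 2 ∂(chanNoiseLaw R S) ≤
      ENNReal.ofReal (9 * fluctConst b ρ c * (1 + ‖e‖ ^ 2) * N) := by
  obtain ⟨h0, h1, -, h3, -, h5, -⟩ := le_fluctConst b ρ c
  have hn : (0 : ℝ) ≤ N := Nat.cast_nonneg N
  have hw : 1 ≤ 1 + ‖e‖ ^ 2 := by nlinarith [norm_nonneg e]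
  have hw' : ‖star e‖ ^ 2 ≤ 1 + ‖e‖ ^ 2 := by rw [norm_star]; linarith
  -- One piece for each of the summands e h, ν and distortion of the observation: three pieces,
  -- hence the constant 9 = 3².
  have H := lintegral_enorm_sq_fin_sum_le (μ := chanNoiseLaw R S) (f := ![
    fun x => star e * (star x.1 ⬝ᵥ B *ᵥ x.1 - (B * R).trace),
    fun x => star x.2.1 ⬝ᵥ B *ᵥ x.1,
    fun x => star (distortion c x.1 x.2.2) ⬝ᵥ B *ᵥ x.1])
    (C := fluctConst b ρ c * (1 + ‖e‖ ^ 2) * N) ?_ ?_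
  · refine (lintegral_congr fun x => ?_).trans_le (H.trans (ENNReal.ofReal_le_ofReal ?_))
    · simp [Fin.sum_univ_succ, pilotAt, add_dotProduct, smul_dotProduct]
      congr 2; ring
    · push_cast; apply le_of_eq; ring
  · intro i
    fin_cases i
    · exact ((measurable_sesq measurable_chan' measurable_chan' B).sub_const _).const_mul _
    · exact measurable_sesq measurable_noise' measurable_chan' B
    · exact measurable_sesq (measurable_distortion' c) measurable_chan' B
  · intro i
    fin_cases i
    · exact lintegral_const_mul_le_of_le (lintegral_chan_quadForm_le hR hRρ hB) h1 h0 hn hw'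
    · exact lintegral_le_of_le (lintegral_noise_chan_sesq_le hR hS hRρ hSρ hB) h3 h0 hn hw
    · exact lintegral_le_of_le (lintegral_distortion_chan_sesq_le hR hRρ hB c) h5 h0 hn hw

lemma lintegral_chan_distortion_sesq_le (hR : R.PosSemidef) (hRρ : ‖R‖ ≤ ρ)
    (hB : ‖B‖ ≤ b) (c : ℝ) :
    ∫⁻ x, ‖star x.1 ⬝ᵥ B *ᵥ distortion c x.1 x.2.2‖ₑ ^ 2 ∂(chanNoiseLaw R S) ≤
      ENNReal.ofReal (c ^ 2 * (fourthConst * ρ ^ 2 * (1 + b ^ 4)) * N) := by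
  have hB' : ‖Bᴴ‖ ≤ b := by rwa [Matrix.l2_opNorm_conjTranspose]
  have := lintegral_distortion_chan_sesq_le (S := S) hR hRρ hB' c
  simpa only [enorm_sesq_conj] using this

lemma lintegral_noise_distortion_sesq_le (hR : R.PosSemidef) (hS : S.PosSemidef) (hRρ : ‖R‖ ≤ ρ)
    (hSρ : ‖S‖ ≤ ρ) (hB : ‖B‖ ≤ b) (c : ℝ) :
    ∫⁻ x, ‖star x.2.1 ⬝ᵥ B *ᵥ distortion c x.1 x.2.2‖ₑ ^ 2 ∂(chanNoiseLaw R S) ≤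
      ENNReal.ofReal (c ^ 2 * (ρ * b) ^ 2 * N) := by
  have hB' : ‖Bᴴ‖ ≤ b := by rwa [Matrix.l2_opNorm_conjTranspose]
  have := lintegral_distortion_noise_sesq_le hR hS hRρ hSρ hB' c
  simpa only [enorm_sesq_conj] using this

/-- A quadratic form of the pilot observation is close to its conditional mean. -/
lemma lintegral_norm_deviation_le (hR : R.PosSemidef) (hS : S.PosSemidef) (hRρ : ‖R‖ ≤ ρ)
    (hSρ : ‖S‖ ≤ ρ) (hB : ‖B‖ ≤ b) (c : ℝ) (e : ℂ) :
    ∫⁻ x, ‖star (pilotAt c e x) ⬝ᵥ B *ᵥ pilotAt c e x - (star e * e * (B * R).trace +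
        ((B * S).trace + (c ^ 2 : ℝ) * (Matrix.diagonal (fun i => B i i) * R).trace))‖ₑ ^ 2
          ∂(chanNoiseLaw R S) ≤
      ENNReal.ofReal (100 * fluctConst b ρ c * (1 + ‖e‖ ^ 2) ^ 2 * N) := by
  obtain ⟨h0, h1, h2, h3, h4, h5, h6⟩ := le_fluctConst b ρ c
  have hn : (0 : ℝ) ≤ N := Nat.cast_nonneg N
  have hw : 1 ≤ (1 + ‖e‖ ^ 2) ^ 2 := by nlinarith [norm_nonneg e]
  have hw2 : ‖e‖ ^ 2 ≤ (1 + ‖e‖ ^ 2) ^ 2 := by nlinarith [norm_nonneg e]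
  have hw' : ‖star e‖ ^ 2 ≤ (1 + ‖e‖ ^ 2) ^ 2 := by rwa [norm_star]
  have hw4 : ‖star e * e‖ ^ 2 ≤ (1 + ‖e‖ ^ 2) ^ 2 := by
    rw [norm_mul, norm_star]
    nlinarith [norm_nonneg e]
  have hdiag : ‖(Matrix.diagonal fun i => B i i : Matrix (Fin N) (Fin N) ℂ)‖ ≤ b :=
    (norm_diagonal_diag_le B).trans hB
  have m1 := measurable_chan' (N := N)
  have m2 := measurable_noise' (N := N)
  have m3 := measurable_distortion' (N := N) c
  -- The three summands of the observation give nine forms. The distortion form is centred in two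
  -- stages, first given h and then over h, which makes ten pieces and the constant 100 = 10².
  have H := lintegral_enorm_sq_fin_sum_le (μ := chanNoiseLaw R S) (f := ![
    fun x => star e * e * (star x.1 ⬝ᵥ B *ᵥ x.1 - (B * R).trace),
    fun x => star x.2.1 ⬝ᵥ B *ᵥ x.2.1 - (B * S).trace,
    fun x => star (distortion c x.1 x.2.2) ⬝ᵥ B *ᵥ distortion c x.1 x.2.2 -
      (c ^ 2 : ℝ) * (star x.1 ⬝ᵥ Matrix.diagonal (fun i => B i i) *ᵥ x.1),
    fun x => ((c ^ 2 : ℝ) : ℂ) * (star x.1 ⬝ᵥ Matrix.diagonal (fun i => B i i) *ᵥ x.1 -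
      (Matrix.diagonal (fun i => B i i) * R).trace),
    fun x => star e * (star x.1 ⬝ᵥ B *ᵥ x.2.1),
    fun x => e * (star x.2.1 ⬝ᵥ B *ᵥ x.1),
    fun x => star e * (star x.1 ⬝ᵥ B *ᵥ distortion c x.1 x.2.2),
    fun x => e * (star (distortion c x.1 x.2.2) ⬝ᵥ B *ᵥ x.1),
    fun x => star x.2.1 ⬝ᵥ B *ᵥ distortion c x.1 x.2.2,
    fun x => star (distortion c x.1 x.2.2) ⬝ᵥ B *ᵥ x.2.1])
    (C := fluctConst b ρ c * (1 + ‖e‖ ^ 2) ^ 2 * N) ?_ ?_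
  · refine (lintegral_congr fun x => ?_).trans_le (H.trans (ENNReal.ofReal_le_ofReal ?_))
    · congr 2
      simp only [Fin.sum_univ_succ, pilotAt, add_dotProduct, smul_dotProduct, star_add,
        star_smul, Matrix.mulVec_add, Matrix.mulVec_smul, dotProduct_add, dotProduct_smul,
        smul_eq_mul]
      simp
      ring
    · push_cast; apply le_of_eq; ring
  · intro i
    fin_cases i
    · exact ((measurable_sesq m1 m1 B).sub_const _).const_mul _
    · exact (measurable_sesq m2 m2 B).sub_const _
    · exact (measurable_sesq m3 m3 B).sub ((measurable_sesq m1 m1 _).const_mul _)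
    · exact ((measurable_sesq m1 m1 _).sub_const _).const_mul _
    · exact (measurable_sesq m1 m2 B).const_mul _
    · exact (measurable_sesq m2 m1 B).const_mul _
    · exact (measurable_sesq m1 m3 B).const_mul _
    · exact (measurable_sesq m3 m1 B).const_mul _
    · exact measurable_sesq m2 m3 B
    · exact measurable_sesq m3 m2 B
  · intro i
    fin_cases i
    · exact lintegral_const_mul_le_of_le (lintegral_chan_quadForm_le hR hRρ hB) h1 h0 hn hw4
    · exact lintegral_le_of_le (lintegral_noise_quadForm_le hS hSρ hB) h1 h0 hn hw
    · exact lintegral_le_of_le (lintegral_distortion_quadForm_cond_le hR hRρ hB c) h6 h0 hn hw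
    · refine lintegral_le_of_le ((lintegral_enorm_const_mul_sq_le
        (lintegral_chan_quadForm_le hR hRρ hdiag) _).trans_eq ?_) h2 h0 hn hw
      rw [Complex.norm_real, Real.norm_eq_abs, sq_abs]
      congr 1; ring
    · exact lintegral_const_mul_le_of_le (lintegral_chan_noise_sesq_le hR hS hRρ hSρ hB) h3 h0 hn
        hw'
    · exact lintegral_const_mul_le_of_le (lintegral_noise_chan_sesq_le hR hS hRρ hSρ hB) h3 h0 hn
        hw2
    · exact lintegral_const_mul_le_of_le (lintegral_chan_distortion_sesq_le hR hRρ hB c) h5 h0 hn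
        hw'
    · exact lintegral_const_mul_le_of_le (lintegral_distortion_chan_sesq_le hR hRρ hB c) h5 h0 hn
        hw2
    · exact lintegral_le_of_le (lintegral_noise_distortion_sesq_le hR hS hRρ hSρ hB c) h4 h0 hn hw
    · exact lintegral_le_of_le (lintegral_distortion_noise_sesq_le hR hS hRρ hSρ hB c) h4 h0 hn hw

end Deviations

/-! ### Bounds on the estimator and on the power terms, uniform in N. -/

section Bounds

open scoped Matrix.Norms.L2Operator

variable {N : ℕ}

/-- The assumptions on the covariance matrices, for fixed `N` and fixed constants. -/
structure UplinkBounds (P : Params) (ρ c₀ : ℝ) (R S : Matrix (Fin N) (Fin N) ℂ) : Prop where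
  posSemidef : R.PosSemidef
  posDef : S.PosDef
  norm_R : ‖R‖ ≤ ρ
  norm_S : ‖S‖ ≤ ρ
  pos : 0 < c₀
  trace_R : c₀ * N ≤ R.trace.re
  psi_ge : (psi P R S - (c₀ : ℂ) • (1 : Matrix (Fin N) (Fin N) ℂ)).PosSemidef

/-- A matrix that dominates a multiple of the identity is bounded below as an operator. -/
lemma eucNorm_le_of_posSemidef_sub {M : Matrix (Fin N) (Fin N) ℂ} {c : ℝ}
    (h : (M - (c : ℂ) • (1 : Matrix (Fin N) (Fin N) ℂ)).PosSemidef) (x : Vec N) :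
    c * eucNorm x ≤ eucNorm (M *ᵥ x) := by
  have h1 := (Complex.le_def.1 (h.dotProduct_mulVec_nonneg x)).1
  rw [Matrix.sub_mulVec, Matrix.smul_mulVec, Matrix.one_mulVec, dotProduct_sub,
    dotProduct_smul, Complex.sub_re] at h1
  have h2 : star x ⬝ᵥ x = ((eucNorm x ^ 2 : ℝ) : ℂ) := by
    rw [eucNorm_sq, Complex.ofReal_sum]
    simp only [dotProduct, Pi.star_apply, ofReal_norm_sq, mul_comm]
  rw [h2, smul_eq_mul, ← Complex.ofReal_mul, Complex.ofReal_re] at h1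
  have h3 := (Complex.re_le_norm _).trans (norm_sum_mul_conj_le x (M *ᵥ x))
  rcases (eucNorm_nonneg x).eq_or_lt with h0 | h0
  · rw [← h0, mul_zero]; exact eucNorm_nonneg _
  · refine le_of_mul_le_mul_left ?_ h0
    simp only [Complex.zero_re] at h1
    nlinarith

lemma norm_inv_le {M : Matrix (Fin N) (Fin N) ℂ} {c : ℝ} (hc : 0 < c) (hM : IsUnit M.det)
    (h : (M - (c : ℂ) • (1 : Matrix (Fin N) (Fin N) ℂ)).PosSemidef) : ‖M⁻¹‖ ≤ c⁻¹ := by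
  rw [Matrix.cstar_norm_def]
  refine ContinuousLinearMap.opNorm_le_bound _ (by positivity) fun x => ?_
  have h1 := eucNorm_le_of_posSemidef_sub h (M⁻¹ *ᵥ x.ofLp)
  rw [Matrix.mulVec_mulVec, Matrix.mul_nonsing_inv _ hM, Matrix.one_mulVec] at h1
  rw [inv_mul_eq_div, le_div_iff₀ hc, mul_comm]
  exact h1

lemma norm_real_smul (a : ℝ) (M : Matrix (Fin N) (Fin N) ℂ) : ‖(a : ℂ) • M‖ = |a| * ‖M‖ := by
  rw [norm_smul, Complex.norm_real, Real.norm_eq_abs]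

lemma trace_mul_conjTranspose_self (A : Matrix (Fin N) (Fin N) ℂ) :
    (A * Aᴴ).trace.re = ∑ i, ∑ j, ‖A i j‖ ^ 2 := by
  simp only [Matrix.trace, Matrix.diag, Matrix.mul_apply, Matrix.conjTranspose_apply,
    ← ofReal_norm_sq, Complex.re_sum, Complex.ofReal_re]

lemma norm_trace_mul_sq_le (A M : Matrix (Fin N) (Fin N) ℂ) :
    ‖(A * M).trace‖ ^ 2 ≤ (∑ i, ∑ j, ‖A i j‖ ^ 2) * ∑ i, ∑ j, ‖M i j‖ ^ 2 := by
  have h1 : ‖(A * M).trace‖ ≤ ∑ p : Fin N × Fin N, ‖A p.1 p.2‖ * ‖M p.2 p.1‖ := by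
    simp only [Matrix.trace, Matrix.diag, Matrix.mul_apply]
    rw [Fintype.sum_prod_type]
    refine (norm_sum_le _ _).trans (Finset.sum_le_sum fun i _ => (norm_sum_le _ _).trans ?_)
    exact Finset.sum_le_sum fun j _ => (norm_mul _ _).le
  refine (pow_le_pow_left₀ (norm_nonneg _) h1 2).trans ?_
  refine (Finset.sum_mul_sq_le_sq_mul_sq _ _ _).trans_eq ?_
  rw [Fintype.sum_prod_type, Fintype.sum_prod_type, Finset.sum_comm (f := fun i j => ‖M j i‖ ^ 2)]

lemma trace_conj_re_mono {M : Matrix (Fin N) (Fin N) ℂ} {c : ℝ}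
    (h : (M - (c : ℂ) • (1 : Matrix (Fin N) (Fin N) ℂ)).PosSemidef)
    (A : Matrix (Fin N) (Fin N) ℂ) :
    c * ∑ i, ∑ j, ‖A i j‖ ^ 2 ≤ (A * M * Aᴴ).trace.re := by
  have h1 := (Complex.le_def.1 (h.mul_mul_conjTranspose_same A).trace_nonneg).1
  rw [Matrix.mul_sub, Matrix.sub_mul, Matrix.trace_sub, Complex.sub_re, Matrix.mul_smul,
    Matrix.smul_mul, Matrix.mul_one, Matrix.trace_smul, smul_eq_mul, Complex.re_ofReal_mul,
    trace_mul_conjTranspose_self, Complex.zero_re] at h1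
  linarith

lemma norm_conj_le {A M : Matrix (Fin N) (Fin N) ℂ} {a m : ℝ} (hA : ‖A‖ ≤ a) (hM : ‖M‖ ≤ m) :
    ‖A * M * Aᴴ‖ ≤ a ^ 2 * m := by
  have ha := (norm_nonneg A).trans hA
  have hm := (norm_nonneg M).trans hM
  calc ‖A * M * Aᴴ‖ ≤ ‖A‖ * ‖M‖ * ‖A‖ := by
        refine (norm_mul_le _ _).trans ?_
        rw [Matrix.l2_opNorm_conjTranspose]
        exact mul_le_mul_of_nonneg_right (norm_mul_le _ _) (norm_nonneg _)
    _ ≤ a * m * a := by gcongr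
    _ = a ^ 2 * m := by ring

lemma ofReal_trace_re {M : Matrix (Fin N) (Fin N) ℂ} (h : M.PosSemidef) :
    ((M.trace.re : ℝ) : ℂ) = M.trace :=
  Complex.ext rfl (Complex.le_def.1 h.trace_nonneg).2

/-- A bound on the spectral norm of `Ψ`. -/
noncomputable def psiBound (P : Params) (ρ : ℝ) : ℝ := P.pUT * P.κrBS * ρ + ρ

/-- A bound on the spectral norm of the covariance matrix of the pilot observation. -/
noncomputable def obsBound (P : Params) (ρ : ℝ) : ℝ :=
  P.pUT * (1 + P.κtUT) * ρ + psiBound P ρ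

/-- A bound on the spectral norm of the estimator. -/
noncomputable def lmmseBound (P : Params) (ρ c₀ : ℝ) : ℝ := ‖P.d‖ * (ρ * c₀⁻¹)

/-- A lower bound on `tr(A Ψ Aᴴ) / N`. -/
noncomputable def powerLower (P : Params) (ρ c₀ : ℝ) : ℝ :=
  c₀ * (‖P.d‖ * c₀ / obsBound P ρ) ^ 2

/-- An upper bound on `tr(A (p^UT (1 + κ_t^UT) R + Ψ) Aᴴ) / N`. -/
noncomputable def powerUpper (P : Params) (ρ c₀ : ℝ) : ℝ := lmmseBound P ρ c₀ ^ 2 * obsBound P ρ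

/-- `tr(A R Aᴴ)`. -/
noncomputable def estChanPower (P : Params) (R S : Matrix (Fin N) (Fin N) ℂ) : ℝ :=
  (lmmseMatrix P R S * R * (lmmseMatrix P R S)ᴴ).trace.re

/-- `tr(A Ψ Aᴴ)`. -/
noncomputable def estNoisePower (P : Params) (R S : Matrix (Fin N) (Fin N) ℂ) : ℝ :=
  (lmmseMatrix P R S * psi P R S * (lmmseMatrix P R S)ᴴ).trace.re

lemma trace_conj_smul_add (A R Q : Matrix (Fin N) (Fin N) ℂ) (t : ℝ) :
    (A * ((t : ℂ) • R + Q) * Aᴴ).trace.re =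
      t * (A * R * Aᴴ).trace.re + (A * Q * Aᴴ).trace.re := by
  rw [Matrix.mul_add, Matrix.add_mul, Matrix.trace_add, Complex.add_re, Matrix.mul_smul,
    Matrix.smul_mul, Matrix.trace_smul, smul_eq_mul, Complex.re_ofReal_mul]

lemma condPower_eq (P : Params) (R S : Matrix (Fin N) (Fin N) ℂ) (η : ℂ) :
    condPower P R S η = ‖P.d + η‖ ^ 2 * estChanPower P R S + estNoisePower P R S :=
  trace_conj_smul_add _ _ _ _

namespace UplinkBounds

variable {P : Params} {ρ c₀ : ℝ} {R S : Matrix (Fin N) (Fin N) ℂ}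

lemma rho_nonneg (h : UplinkBounds P ρ c₀ R S) : 0 ≤ ρ := (norm_nonneg R).trans h.norm_R

lemma norm_psi (h : UplinkBounds P ρ c₀ R S) : ‖psi P R S‖ ≤ psiBound P ρ := by
  refine (norm_add_le _ _).trans (add_le_add ?_ h.norm_S)
  rw [norm_real_smul, abs_of_nonneg (mul_nonneg P.pUT_pos.le P.κrBS_nonneg)]
  exact mul_le_mul_of_nonneg_left ((norm_diagonal_diag_le R).trans h.norm_R)
    (mul_nonneg P.pUT_pos.le P.κrBS_nonneg)

lemma pilotPower_nonneg (P : Params) : 0 ≤ P.pUT * (1 + P.κtUT) :=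
  mul_nonneg P.pUT_pos.le (add_nonneg zero_le_one P.κtUT_nonneg)

lemma norm_obsCov (h : UplinkBounds P ρ c₀ R S) : ‖obsCov P R S‖ ≤ obsBound P ρ := by
  refine (norm_add_le _ _).trans (add_le_add ?_ h.norm_psi)
  rw [norm_real_smul, abs_of_nonneg (pilotPower_nonneg P)]
  exact mul_le_mul_of_nonneg_left h.norm_R (pilotPower_nonneg P)

lemma obsCov_sub_posSemidef (h : UplinkBounds P ρ c₀ R S) :
    (obsCov P R S - (c₀ : ℂ) • (1 : Matrix (Fin N) (Fin N) ℂ)).PosSemidef := by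
  unfold obsCov
  rw [add_sub_assoc]
  refine (h.posSemidef.smul ?_).add h.psi_ge
  exact_mod_cast pilotPower_nonneg P

lemma norm_lmmseMatrix (h : UplinkBounds P ρ c₀ R S) :
    ‖lmmseMatrix P R S‖ ≤ lmmseBound P ρ c₀ := by
  have hu : IsUnit (obsCov P R S).det :=
    (Matrix.isUnit_iff_isUnit_det _).1 (obsCov_posDef (P := P) h.posSemidef h.posDef).isUnit
  have h1 := norm_inv_le h.pos hu h.obsCov_sub_posSemidef
  change ‖star P.d • (R * (obsCov P R S)⁻¹)‖ ≤ _
  rw [norm_smul, norm_star]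
  refine mul_le_mul_of_nonneg_left ?_ (norm_nonneg _)
  exact (norm_mul_le _ _).trans (mul_le_mul h.norm_R h1 (norm_nonneg _) h.rho_nonneg)

lemma rho_pos (h : UplinkBounds P ρ c₀ R S) (hN : 1 ≤ N) : 0 < ρ := by
  have h1 := h.trace_R.trans (trace_re_le h.norm_R)
  have hN' : (0 : ℝ) < N := by exact_mod_cast hN
  exact h.pos.trans_le (le_of_mul_le_mul_right h1 hN')

lemma obsBound_pos (h : UplinkBounds P ρ c₀ R S) (hN : 1 ≤ N) : 0 < obsBound P ρ := by
  have h1 := h.rho_pos hN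
  have h2 := pilotPower_nonneg P
  have h3 := mul_nonneg P.pUT_pos.le P.κrBS_nonneg
  unfold obsBound psiBound
  positivity

lemma powerLower_pos (h : UplinkBounds P ρ c₀ R S) (hN : 1 ≤ N) : 0 < powerLower P ρ c₀ := by
  have h1 := h.obsBound_pos hN
  have h2 := norm_pos_iff.2 P.d_ne_zero
  have h3 := h.pos
  unfold powerLower
  positivity

/-- As Ψ dominates c₀ I, it suffices that ‖A‖_F² is at least of order N. The normal equations give
|d| |tr R| = |tr(AQ)| ≤ ‖A‖_F ‖Q‖_F with Q = `obsCov`; the left side is at least |d| c₀ N, and ‖Q‖_F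
is at most √N times the spectral bound. All lower bounds on tr(R − C) and on the conditional power
come from here. -/
lemma estNoisePower_ge (h : UplinkBounds P ρ c₀ R S) (hN : 1 ≤ N) :
    powerLower P ρ c₀ * N ≤ estNoisePower P R S := by
  refine le_trans ?_ (trace_conj_re_mono h.psi_ge _)
  unfold powerLower
  rw [mul_assoc]
  refine mul_le_mul_of_nonneg_left ?_ h.pos.le
  have hN' : (0 : ℝ) < N := by exact_mod_cast hN
  have hM := h.obsBound_pos hN
  have h1 := norm_trace_mul_sq_le (lmmseMatrix P R S) (obsCov P R S)
  rw [lmmseMatrix_mul_obsCov h.posSemidef h.posDef, Matrix.trace_smul, norm_smul, norm_star] at h1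
  have h2 : ‖P.d‖ * (c₀ * N) ≤ ‖P.d‖ * ‖R.trace‖ :=
    mul_le_mul_of_nonneg_left (h.trace_R.trans (Complex.re_le_norm _)) (norm_nonneg _)
  have h3 : ∑ i, ∑ j, ‖obsCov P R S i j‖ ^ 2 ≤ N * obsBound P ρ ^ 2 :=
    (sum_norm_sq_entries_le _).trans (mul_le_mul_of_nonneg_left
      (pow_le_pow_left₀ (norm_nonneg _) h.norm_obsCov 2) hN'.le)
  set F := ∑ i, ∑ j, ‖lmmseMatrix P R S i j‖ ^ 2 with hF
  have hF0 : 0 ≤ F := by positivity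
  have h4 : (‖P.d‖ * (c₀ * N)) ^ 2 ≤ F * (N * obsBound P ρ ^ 2) :=
    (pow_le_pow_left₀ (by have := h.pos; positivity) h2 2).trans
      (h1.trans (mul_le_mul_of_nonneg_left h3 hF0))
  rw [div_pow, div_mul_eq_mul_div, div_le_iff₀ (by positivity)]
  refine le_of_mul_le_mul_right ?_ hN'
  nlinarith

lemma estChanPower_nonneg (h : UplinkBounds P ρ c₀ R S) : 0 ≤ estChanPower P R S :=
  (Complex.le_def.1 (h.posSemidef.mul_mul_conjTranspose_same _).trace_nonneg).1

lemma estPower_eq_add (h : UplinkBounds P ρ c₀ R S) :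
    estPower P R S = P.pUT * (1 + P.κtUT) * estChanPower P R S + estNoisePower P R S := by
  rw [estPower_eq h.posSemidef h.posDef]
  exact trace_conj_smul_add _ _ _ _

lemma estPower_ge (h : UplinkBounds P ρ c₀ R S) (hN : 1 ≤ N) :
    powerLower P ρ c₀ * N ≤ estPower P R S := by
  rw [h.estPower_eq_add]
  exact (h.estNoisePower_ge hN).trans
    (le_add_of_nonneg_left (mul_nonneg (pilotPower_nonneg P) h.estChanPower_nonneg))

lemma estPower_le (h : UplinkBounds P ρ c₀ R S) : estPower P R S ≤ powerUpper P ρ c₀ * N := by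
  rw [estPower_eq h.posSemidef h.posDef]
  exact trace_re_le (norm_conj_le h.norm_lmmseMatrix h.norm_obsCov)

lemma condPower_ge (h : UplinkBounds P ρ c₀ R S) (hN : 1 ≤ N) (η : ℂ) :
    powerLower P ρ c₀ * N ≤ condPower P R S η := by
  rw [condPower_eq]
  exact (h.estNoisePower_ge hN).trans
    (le_add_of_nonneg_left (mul_nonneg (by positivity) h.estChanPower_nonneg))

lemma condPower_le (h : UplinkBounds P ρ c₀ R S) (η : ℂ) :
    condPower P R S η ≤
      lmmseBound P ρ c₀ ^ 2 * (ρ + psiBound P ρ) * (1 + ‖P.d + η‖ ^ 2) * N := by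
  rw [condPower_eq]
  have h1 : estChanPower P R S ≤ _ := trace_re_le (norm_conj_le h.norm_lmmseMatrix h.norm_R)
  have h2 : estNoisePower P R S ≤ _ := trace_re_le (norm_conj_le h.norm_lmmseMatrix h.norm_psi)
  have h3 := mul_le_mul_of_nonneg_left h1 (sq_nonneg ‖P.d + η‖)
  have h4 : 0 ≤ lmmseBound P ρ c₀ ^ 2 * ρ * N := by have := h.rho_nonneg; positivity
  have h5 : 0 ≤ lmmseBound P ρ c₀ ^ 2 * psiBound P ρ * N := by
    have := (norm_nonneg _).trans h.norm_psi; positivity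
  have h6 := mul_nonneg (sq_nonneg ‖P.d + η‖) h5
  linarith

lemma condPower_pos (h : UplinkBounds P ρ c₀ R S) (hN : 1 ≤ N) (η : ℂ) :
    0 < condPower P R S η := by
  have hN' : (0 : ℝ) < N := by exact_mod_cast hN
  exact (mul_pos (h.powerLower_pos hN) hN').trans_le (h.condPower_ge hN η)

lemma estPower_pos (h : UplinkBounds P ρ c₀ R S) (hN : 1 ≤ N) : 0 < estPower P R S := by
  have hN' : (0 : ℝ) < N := by exact_mod_cast hN
  exact (mul_pos (h.powerLower_pos hN) hN').trans_le (h.estPower_ge hN)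

/-- The conditional mean of the inner product of the estimate and the channel. -/
lemma star_mul_trace (h : UplinkBounds P ρ c₀ R S) (η : ℂ) :
    star (P.d + η) * ((lmmseMatrix P R S)ᴴ * R).trace =
      star (1 + P.d⁻¹ * η) * (estPower P R S : ℂ) := by
  have h1 : star P.d * ((lmmseMatrix P R S)ᴴ * R).trace = (estPower P R S : ℂ) := by
    rw [estPower_eq h.posSemidef h.posDef, ofReal_trace_re
      ((obsCov_posDef (P := P) h.posSemidef h.posDef).posSemidef.mul_mul_conjTranspose_same _),
      Matrix.trace_mul_comm (lmmseMatrix P R S * obsCov P R S),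
      lmmseMatrix_mul_obsCov h.posSemidef h.posDef, Matrix.mul_smul, Matrix.trace_smul,
      smul_eq_mul]
  have h2 : P.d + η = P.d * (1 + P.d⁻¹ * η) := by
    rw [mul_add, mul_inv_cancel_left₀ P.d_ne_zero, mul_one]
  rw [h2, star_mul', ← h1]; ring

/-- The conditional mean of the squared norm of the estimate. -/
lemma trace_gram (h : UplinkBounds P ρ c₀ R S) (η : ℂ) :
    let B := (lmmseMatrix P R S)ᴴ * lmmseMatrix P R S
    star (P.d + η) * (P.d + η) * (B * R).trace + ((B * S).trace +
      (Real.sqrt (P.κrBS * P.pUT) ^ 2 : ℝ) *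
        (Matrix.diagonal (fun i => B i i) * R).trace) = (condPower P R S η : ℂ) := by
  intro B
  have hpsd : (((‖P.d + η‖ ^ 2 : ℝ) : ℂ) • R + psi P R S).PosSemidef := by
    refine (h.posSemidef.smul ?_).add (psi_posDef h.posSemidef h.posDef).posSemidef
    exact_mod_cast sq_nonneg ‖P.d + η‖
  have h1 : ∀ M, (lmmseMatrix P R S * M * (lmmseMatrix P R S)ᴴ).trace = (B * M).trace := by
    intro M
    rw [Matrix.trace_mul_comm, ← mul_assoc]
  -- Taking the diagonal part is self-adjoint for the trace pairing, so it moves from B to R; in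
  -- this way the mean of the distortion form becomes the R_diag term of Ψ.
  have h2 : (Matrix.diagonal (fun i => B i i) * R).trace =
      (B * Matrix.diagonal fun i => R i i).trace := by
    simp [Matrix.trace, Matrix.diagonal_mul, Matrix.mul_diagonal]
  rw [condPower, ofReal_trace_re (hpsd.mul_mul_conjTranspose_same _), h1, psi,
    Real.sq_sqrt (mul_nonneg P.κrBS_nonneg P.pUT_pos.le), h2, mul_comm (star _), ← ofReal_norm_sq]
  simp only [Matrix.mul_add, Matrix.trace_add, Matrix.mul_smul, Matrix.trace_smul, smul_eq_mul]
  push_cast; ring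

end UplinkBounds

end Bounds

/-! ### Approximation of the effective channel for a fixed pilot distortion. -/

section Conditional

open scoped Matrix.Norms.L2Operator

variable {N : ℕ}

/-- Encodes hᵀv = ĥᴴh/‖ĥ‖ without a quotient. At y = 0 division by zero gives `mrt 0 = 0`, and the
identity survives. -/
lemma dotProduct_mrt_mul (h y : Vec N) : h ⬝ᵥ mrt y * (eucNorm y : ℂ) = star y ⬝ᵥ h := by
  by_cases hy : eucNorm y = 0
  · have h0 : y = 0 := by
      have : WithLp.toLp 2 y = 0 := norm_eq_zero.1 hy
      simpa using this
    rw [hy, h0]; simp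
  · simp only [dotProduct, mrt, Finset.sum_mul, Pi.star_apply]
    refine Finset.sum_congr rfl fun i _ => ?_
    have : (eucNorm y : ℂ) ≠ 0 := by exact_mod_cast hy
    field_simp

/-- Cauchy–Schwarz. This bound stands in for a lower bound on ‖ĥ‖, which is not available pointwise.
-/
lemma norm_dotProduct_mrt_le (h y : Vec N) : ‖h ⬝ᵥ mrt y‖ ≤ eucNorm h := by
  rcases (eucNorm_nonneg y).eq_or_lt with hy | hy
  · have : h ⬝ᵥ mrt y = 0 := by simp [dotProduct, mrt, ← hy]
    rw [this, norm_zero]; exact eucNorm_nonneg _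
  · have h1 := congrArg norm (dotProduct_mrt_mul h y)
    rw [norm_mul, Complex.norm_real, Real.norm_of_nonneg hy.le] at h1
    have h2 := norm_sum_mul_conj_le y h
    rw [← h1, mul_comm] at h2
    exact le_of_mul_le_mul_left h2 hy

lemma sum_norm_sq_mrt_le (y : Vec N) : ∑ i, ‖mrt y i‖ ^ 2 ≤ 1 := by
  simp only [mrt, norm_div, norm_star, Complex.norm_real, div_pow, Real.norm_eq_abs, sq_abs]
  rw [← Finset.sum_div, ← eucNorm_sq]
  exact div_self_le_one _

lemma eucNorm_pow_four_le (h : Vec N) : eucNorm h ^ 4 ≤ N * ∑ i, ‖h i‖ ^ 4 := by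
  have := sq_sum_le_card_mul_sum_sq (s := Finset.univ) (f := fun i => ‖h i‖ ^ 2)
  rw [← eucNorm_sq] at this
  simpa [← pow_mul] using this

/-- Stability of the normalized inner product, first order. -/
lemma norm_sub_div_sqrt_le {V X x : ℂ} {Y G H : ℝ} (hV : V * (Y : ℂ) = X) (hH : ‖V‖ ≤ H)
    (hY : 0 ≤ Y) (hG : 0 < G) :
    ‖V - x / (Real.sqrt G : ℂ)‖ ≤ ‖X - x‖ / Real.sqrt G + H * |Y ^ 2 - G| / G := by
  have hs : 0 < Real.sqrt G := Real.sqrt_pos.2 hG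
  have hs' : (Real.sqrt G : ℂ) ≠ 0 := by exact_mod_cast hs.ne'
  -- Only the fixed G occurs in denominators; a small Y is harmless because V itself is bounded by
  -- H. The second term is then handled by √G |√G − Y| ≤ |Y² − G|.
  have e : V - x / (Real.sqrt G : ℂ) =
      (X - x) / (Real.sqrt G : ℂ) + V * ((Real.sqrt G - Y : ℝ) : ℂ) / (Real.sqrt G : ℂ) := by
    rw [← hV]; field_simp; push_cast; ring
  rw [e]
  refine (norm_add_le _ _).trans (add_le_add ?_ ?_)
  · rw [norm_div, Complex.norm_real, Real.norm_of_nonneg hs.le]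
  · rw [norm_div, norm_mul, Complex.norm_real, Complex.norm_real, Real.norm_of_nonneg hs.le,
      Real.norm_eq_abs, div_le_div_iff₀ hs hG]
    have h1 : |Y ^ 2 - G| = |Real.sqrt G - Y| * (Real.sqrt G + Y) := by
      rw [← abs_of_nonneg (by positivity : 0 ≤ Real.sqrt G + Y), ← abs_mul, abs_sub_comm]
      congr 1
      nlinarith [Real.mul_self_sqrt hG.le]
    have h2 : |Real.sqrt G - Y| * Real.sqrt G ≤ |Y ^ 2 - G| := by
      rw [h1]
      exact mul_le_mul_of_nonneg_left (by linarith) (abs_nonneg _)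
    have h3 : ‖V‖ * (|Real.sqrt G - Y| * Real.sqrt G) ≤ H * |Y ^ 2 - G| :=
      mul_le_mul hH h2 (by positivity) ((norm_nonneg V).trans hH)
    calc ‖V‖ * |Real.sqrt G - Y| * G
        = ‖V‖ * (|Real.sqrt G - Y| * Real.sqrt G) * Real.sqrt G := by
          linear_combination -(‖V‖ * |Real.sqrt G - Y|) * Real.mul_self_sqrt hG.le
      _ ≤ H * |Y ^ 2 - G| * Real.sqrt G := mul_le_mul_of_nonneg_right h3 hs.le

/-- Stability of the normalized inner product, second order. -/
lemma abs_norm_sq_sub_le {V X x : ℂ} {Y G H : ℝ} (hV : V * (Y : ℂ) = X) (hH : ‖V‖ ≤ H)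
    (hG : 0 < G) :
    |‖V‖ ^ 2 - ‖x‖ ^ 2 / G| ≤
      H ^ 2 * |Y ^ 2 - G| / G + (‖X - x‖ ^ 2 + 2 * ‖x‖ * ‖X - x‖) / G := by
  have hX : ‖X‖ ^ 2 = ‖V‖ ^ 2 * Y ^ 2 := by
    rw [← hV, norm_mul, Complex.norm_real, Real.norm_eq_abs, mul_pow, sq_abs]
  have e : ‖V‖ ^ 2 - ‖x‖ ^ 2 / G =
      -(‖V‖ ^ 2 * (Y ^ 2 - G)) / G + (‖X‖ ^ 2 - ‖x‖ ^ 2) / G := by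
    rw [hX]; field_simp; ring
  rw [e]
  refine (abs_add_le _ _).trans (add_le_add ?_ ?_)
  · rw [abs_div, abs_neg, abs_mul, abs_of_pos hG, abs_of_nonneg (sq_nonneg ‖V‖)]
    have : ‖V‖ ^ 2 ≤ H ^ 2 := pow_le_pow_left₀ (norm_nonneg _) hH 2
    gcongr
  · rw [abs_div, abs_of_pos hG]
    gcongr
    have h1 := abs_norm_sub_norm_le X x
    have h2 : |‖X‖ ^ 2 - ‖x‖ ^ 2| = |‖X‖ - ‖x‖| * (‖X‖ + ‖x‖) := by
      rw [sq_sub_sq, abs_mul, abs_of_nonneg (by positivity : 0 ≤ ‖X‖ + ‖x‖), mul_comm]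
    have h3 : ‖X‖ ≤ ‖X - x‖ + ‖x‖ := by simpa using norm_add_le (X - x) x
    rw [h2]
    calc |‖X‖ - ‖x‖| * (‖X‖ + ‖x‖) ≤ ‖X - x‖ * (‖X - x‖ + ‖x‖ + ‖x‖) := by gcongr
      _ = _ := by ring

lemma integral_sq_le_of_lintegral {Ω : Type*} [MeasurableSpace Ω] {μ : Measure Ω} {f : Ω → ℂ}
    (hf : Measurable f) {C : ℝ} (hC : 0 ≤ C) (h : ∫⁻ x, ‖f x‖ₑ ^ 2 ∂μ ≤ ENNReal.ofReal C) :
    Integrable (fun x => ‖f x‖ ^ 2) μ ∧ ∫ x, ‖f x‖ ^ 2 ∂μ ≤ C := by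
  have e : ∀ x, ENNReal.ofReal (‖f x‖ ^ 2) = ‖f x‖ₑ ^ 2 := fun x => by
    rw [ENNReal.ofReal_pow (norm_nonneg _), ofReal_norm]
  refine ⟨⟨(hf.norm.pow_const 2).aestronglyMeasurable, ?_⟩, ?_⟩
  · rw [hasFiniteIntegral_iff_ofReal (ae_of_all _ fun _ => by positivity)]
    simp_rw [e]
    exact h.trans_lt ENNReal.ofReal_lt_top
  · rw [integral_eq_lintegral_of_nonneg_ae (ae_of_all _ fun _ => by positivity)
      (hf.norm.pow_const 2).aestronglyMeasurable]
    simp_rw [e]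
    exact ENNReal.toReal_le_of_le_ofReal hC h

lemma lintegral_enorm_le_of_le {Ω E : Type*} [MeasurableSpace Ω] [NormedAddCommGroup E]
    {μ : Measure Ω} {f : Ω → E} {F : Ω → ℝ} {C : ℝ} (hF : Integrable F μ) (hC : ∫ x, F x ∂μ ≤ C)
    (h : ∀ x, ‖f x‖ ≤ F x) : ∫⁻ x, ‖f x‖ₑ ∂μ ≤ ENNReal.ofReal C := by
  refine le_trans (lintegral_mono fun x => ?_) (le_trans (le_of_eq
    (ofReal_integral_eq_lintegral_ofReal hF (ae_of_all _ fun x =>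
      (norm_nonneg _).trans (h x))).symm) (ENNReal.ofReal_le_ofReal hC))
  rw [← ofReal_norm]
  exact ENNReal.ofReal_le_ofReal (h x)

variable {P : Params} {ρ c₀ : ℝ} {R S : Matrix (Fin N) (Fin N) ℂ}

/-- The square root of the distortion power at the base station. -/
noncomputable def distCoeff (P : Params) : ℝ := Real.sqrt (P.κrBS * P.pUT)

/-- The effective channel when the faded pilot is `e`. -/
noncomputable def effAt (P : Params) (R S : Matrix (Fin N) (Fin N) ℂ) (e : ℂ)
    (x : Vec N × Vec N × Vec N) : ℂ :=
  x.1 ⬝ᵥ mrt (lmmseMatrix P R S *ᵥ pilotAt (distCoeff P) e x)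

/-- The deviation of the inner product of the estimate and the channel. -/
noncomputable def innerDev (P : Params) (R S : Matrix (Fin N) (Fin N) ℂ) (η : ℂ)
    (x : Vec N × Vec N × Vec N) : ℂ :=
  star (pilotAt (distCoeff P) (P.d + η) x) ⬝ᵥ (lmmseMatrix P R S)ᴴ *ᵥ x.1 -
    star (1 + P.d⁻¹ * η) * (estPower P R S : ℂ)

/-- The deviation of the squared norm of the estimate. -/
noncomputable def normDev (P : Params) (R S : Matrix (Fin N) (Fin N) ℂ) (η : ℂ)
    (x : Vec N × Vec N × Vec N) : ℂ :=
  star (pilotAt (distCoeff P) (P.d + η) x) ⬝ᵥ ((lmmseMatrix P R S)ᴴ * lmmseMatrix P R S) *ᵥ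
    pilotAt (distCoeff P) (P.d + η) x - (condPower P R S η : ℂ)

/-- The limit of the effective channel. -/
noncomputable def effLim (P : Params) (R S : Matrix (Fin N) (Fin N) ℂ) (η : ℂ) : ℂ :=
  star (1 + P.d⁻¹ * η) * (estPower P R S : ℂ) / (Real.sqrt (condPower P R S η) : ℂ)

lemma measurable_innerDev (η : ℂ) : Measurable (innerDev P R S η) := by
  unfold innerDev
  exact (measurable_sesq (measurable_pilotAt _ _) measurable_fst _).sub_const _

lemma measurable_normDev (η : ℂ) : Measurable (normDev P R S η) := by
  unfold normDev
  exact (measurable_sesq (measurable_pilotAt _ _) (measurable_pilotAt _ _) _).sub_const _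

lemma star_mulVec_dotProduct (A : Matrix (Fin N) (Fin N) ℂ) (z y : Vec N) :
    star (A *ᵥ z) ⬝ᵥ y = star z ⬝ᵥ Aᴴ *ᵥ y := by
  rw [Matrix.star_mulVec, ← Matrix.dotProduct_mulVec]

lemma star_dotProduct_self (x : Vec N) : star x ⬝ᵥ x = ((eucNorm x ^ 2 : ℝ) : ℂ) := by
  rw [eucNorm_sq, Complex.ofReal_sum]
  simp only [dotProduct, Pi.star_apply, ofReal_norm_sq, mul_comm]

lemma innerDev_eq (η : ℂ) (x : Vec N × Vec N × Vec N) :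
    innerDev P R S η x = star (lmmseMatrix P R S *ᵥ pilotAt (distCoeff P) (P.d + η) x) ⬝ᵥ x.1 -
      star (1 + P.d⁻¹ * η) * (estPower P R S : ℂ) := by
  rw [innerDev, star_mulVec_dotProduct]

lemma norm_normDev (η : ℂ) (x : Vec N × Vec N × Vec N) :
    ‖normDev P R S η x‖ = |eucNorm (lmmseMatrix P R S *ᵥ pilotAt (distCoeff P) (P.d + η) x) ^ 2 -
      condPower P R S η| := by
  rw [normDev, ← Matrix.mulVec_mulVec, ← star_mulVec_dotProduct, star_dotProduct_self,
    ← Complex.ofReal_sub, Complex.norm_real, Real.norm_eq_abs]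

/-- The constant in the second moment of `innerDev`. -/
noncomputable def innerConst (P : Params) (ρ c₀ : ℝ) : ℝ :=
  9 * fluctConst (lmmseBound P ρ c₀) ρ (distCoeff P)

/-- The constant in the second moment of `normDev`. -/
noncomputable def normConst (P : Params) (ρ c₀ : ℝ) : ℝ :=
  100 * fluctConst (lmmseBound P ρ c₀ ^ 2) ρ (distCoeff P)

lemma innerConst_nonneg : 0 ≤ innerConst P ρ c₀ := by
  have := (le_fluctConst (lmmseBound P ρ c₀) ρ (distCoeff P)).1
  unfold innerConst; positivity

lemma normConst_nonneg : 0 ≤ normConst P ρ c₀ := by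
  have := (le_fluctConst (lmmseBound P ρ c₀ ^ 2) ρ (distCoeff P)).1
  unfold normConst; positivity

lemma integral_innerDev_sq_le (h : UplinkBounds P ρ c₀ R S) (η : ℂ) :
    Integrable (fun x => ‖innerDev P R S η x‖ ^ 2) (chanNoiseLaw R S) ∧
    ∫ x, ‖innerDev P R S η x‖ ^ 2 ∂(chanNoiseLaw R S) ≤
      innerConst P ρ c₀ * (1 + ‖P.d + η‖ ^ 2) * N := by
  refine integral_sq_le_of_lintegral (measurable_innerDev η)
    (by have := innerConst_nonneg (P := P) (ρ := ρ) (c₀ := c₀); positivity) ?_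
  have hB : ‖(lmmseMatrix P R S)ᴴ‖ ≤ lmmseBound P ρ c₀ := by
    rw [Matrix.l2_opNorm_conjTranspose]; exact h.norm_lmmseMatrix
  have := lintegral_inner_deviation_le h.posSemidef h.posDef.posSemidef h.norm_R h.norm_S hB
    (distCoeff P) (P.d + η)
  rw [h.star_mul_trace] at this
  exact this

lemma integral_normDev_sq_le (h : UplinkBounds P ρ c₀ R S) (η : ℂ) :
    Integrable (fun x => ‖normDev P R S η x‖ ^ 2) (chanNoiseLaw R S) ∧
    ∫ x, ‖normDev P R S η x‖ ^ 2 ∂(chanNoiseLaw R S) ≤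
      normConst P ρ c₀ * (1 + ‖P.d + η‖ ^ 2) ^ 2 * N := by
  refine integral_sq_le_of_lintegral (measurable_normDev η)
    (by have := normConst_nonneg (P := P) (ρ := ρ) (c₀ := c₀); positivity) ?_
  have hB : ‖(lmmseMatrix P R S)ᴴ * lmmseMatrix P R S‖ ≤ lmmseBound P ρ c₀ ^ 2 := by
    rw [Matrix.l2_opNorm_conjTranspose_mul_self, ← sq]
    exact pow_le_pow_left₀ (norm_nonneg _) h.norm_lmmseMatrix 2
  have := lintegral_norm_deviation_le h.posSemidef h.posDef.posSemidef h.norm_R h.norm_S hB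
    (distCoeff P) (P.d + η)
  rw [distCoeff, h.trace_gram] at this
  exact this

lemma integral_eucNorm_sq_le (h : UplinkBounds P ρ c₀ R S) :
    Integrable (fun x : Vec N => eucNorm x ^ 2) (vecCN R) ∧
    ∫ x, eucNorm x ^ 2 ∂(vecCN R) ≤ ρ * N := by
  have hc := isCov_vecCN h.posSemidef
  simp_rw [eucNorm_sq]
  refine ⟨integrable_finsetSum _ fun i _ => hc.integrable_norm_sq i, ?_⟩
  rw [hc.integral_sum_norm_sq]
  exact trace_re_le h.norm_R

lemma integral_sum_pow_four_le (h : UplinkBounds P ρ c₀ R S) :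
    Integrable (fun x : Vec N => ∑ i, ‖x i‖ ^ 4) (vecCN R) ∧
    ∫ x, ∑ i, ‖x i‖ ^ 4 ∂(vecCN R) ≤ fourthConst * ρ ^ 2 * N := by
  have hi : Integrable (fun x : Vec N => ∑ i, ‖x i‖ ^ 4) (vecCN R) :=
    integrable_finsetSum _ fun i _ => (memLp_eval_vecCN R i 4).integrable_norm_pow (by norm_num)
  refine ⟨hi, ?_⟩
  have h1 := lintegral_sum_chan_pow_four_le h.posSemidef h.norm_R
  rw [← ofReal_integral_eq_lintegral_ofReal hi (ae_of_all _ fun _ => by positivity)] at h1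
  have := fourthConst_pos
  exact (ENNReal.ofReal_le_ofReal_iff (by positivity)).1 h1

/-- The constant in the first-order approximation of the effective channel. -/
noncomputable def effConst (P : Params) (ρ c₀ : ℝ) : ℝ :=
  (1 + innerConst P ρ c₀ / powerLower P ρ c₀) / 2 +
    (ρ + normConst P ρ c₀) / (2 * powerLower P ρ c₀)

/-- Both deviations have size √N. That of ĥᴴh is divided by √G, at least of order √N; that of ‖ĥ‖²
is multiplied by ‖h‖, of order √N, and divided by G, at least of order N. The result is O(1) in N,
and the dependence on η is collected in a polynomial weight. -/
lemma lintegral_effAt_sub_le (h : UplinkBounds P ρ c₀ R S) (hN : 1 ≤ N) (η : ℂ) :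
    ∫⁻ x, ‖effAt P R S (P.d + η) x - effLim P R S η‖ₑ ∂(chanNoiseLaw R S) ≤
      ENNReal.ofReal (effConst P ρ c₀ * (1 + ‖P.d + η‖ ^ 2) ^ 2) := by
  have hn : (0 : ℝ) < N := by exact_mod_cast hN
  obtain ⟨i1, b1⟩ := integral_innerDev_sq_le h η
  obtain ⟨i2, b2⟩ := integral_normDev_sq_le h η
  obtain ⟨i3, b3⟩ := integral_eucNorm_sq_le h
  have i3' := (measurePreserving_chanNoise_chan (R := R) (S := S)).integrable_comp_of_integrable i3
  have b3' : ∫ x, eucNorm x.1 ^ 2 ∂(chanNoiseLaw R S) ≤ ρ * N := by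
    refine le_of_eq_of_le ?_ b3
    rw [← (measurePreserving_chanNoise_chan (R := R) (S := S)).map_eq, integral_map
      measurable_fst.aemeasurable]
    rw [(measurePreserving_chanNoise_chan (R := R) (S := S)).map_eq]
    exact i3.1
  set g := powerLower P ρ c₀ with hg
  have hg0 : 0 < g := h.powerLower_pos hN
  have ha := innerConst_nonneg (P := P) (ρ := ρ) (c₀ := c₀)
  have ha' := normConst_nonneg (P := P) (ρ := ρ) (c₀ := c₀)
  set w := 1 + ‖P.d + η‖ ^ 2 with hw
  have hw1 : 1 ≤ w := by rw [hw]; nlinarith [norm_nonneg (P.d + η)]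
  have hG := h.condPower_ge hN η
  have hG0 := h.condPower_pos hN η
  have hgn : 0 < g * N := by positivity
  -- A majorant that uses second moments only: t ≤ (1 + t²)/2 for the first error and ab ≤ (a² +
  -- b²)/2 for the second.
  refine lintegral_enorm_le_of_le (F := fun x => 2⁻¹ * (1 + ‖innerDev P R S η x‖ ^ 2 / (g * N)) +
    (eucNorm x.1 ^ 2 + ‖normDev P R S η x‖ ^ 2) * (2 * (g * N))⁻¹) ?_ ?_ fun x => ?_
  · exact (((integrable_const _).add (i1.div_const _)).const_mul _).add ((i3'.add i2).mul_const _)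
  · have e : ∫ x, (2⁻¹ * (1 + ‖innerDev P R S η x‖ ^ 2 / (g * N)) +
        (eucNorm x.1 ^ 2 + ‖normDev P R S η x‖ ^ 2) * (2 * (g * N))⁻¹) ∂(chanNoiseLaw R S) =
        2⁻¹ * (1 + (∫ x, ‖innerDev P R S η x‖ ^ 2 ∂(chanNoiseLaw R S)) / (g * N)) +
        (∫ x, eucNorm x.1 ^ 2 ∂(chanNoiseLaw R S) +
          ∫ x, ‖normDev P R S η x‖ ^ 2 ∂(chanNoiseLaw R S)) * (2 * (g * N))⁻¹ := by
      have j1 := i1.div_const (g * N)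
      have j2 := ((integrable_const (1 : ℝ)).add j1).const_mul 2⁻¹
      have j3 := (i3'.add i2).mul_const (2 * (g * N))⁻¹
      refine (integral_add j2 j3).trans (congrArg₂ _ ?_ ?_)
      · rw [integral_const_mul]
        refine congrArg _ ((integral_add (integrable_const _) j1).trans (congrArg₂ _ ?_ ?_))
        · simp
        · exact integral_div _ _
      · rw [integral_mul_const]
        exact congrArg (· * _) (integral_add i3' i2)
    rw [e]
    calc _ ≤ 2⁻¹ * (1 + innerConst P ρ c₀ * w * N / (g * N)) +
          (ρ * N + normConst P ρ c₀ * w ^ 2 * N) * (2 * (g * N))⁻¹ := by gcongr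
      _ = 2⁻¹ * (1 + innerConst P ρ c₀ * w / g) + (ρ + normConst P ρ c₀ * w ^ 2) / (2 * g) := by
          field_simp
      _ ≤ 2⁻¹ * (w ^ 2 + innerConst P ρ c₀ * w ^ 2 / g) +
          (ρ * w ^ 2 + normConst P ρ c₀ * w ^ 2) / (2 * g) := by
          have hww : 1 ≤ w ^ 2 := by nlinarith
          have hw2 : w ≤ w ^ 2 := by nlinarith
          have hr : ρ ≤ ρ * w ^ 2 := by nlinarith [h.rho_nonneg]
          gcongr
      _ = effConst P ρ c₀ * w ^ 2 := by unfold effConst; rw [← hg]; ring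
  · have h1 := norm_sub_div_sqrt_le (x := star (1 + P.d⁻¹ * η) * (estPower P R S : ℂ))
      (dotProduct_mrt_mul x.1 (lmmseMatrix P R S *ᵥ pilotAt (distCoeff P) (P.d + η) x))
      (norm_dotProduct_mrt_le _ _) (eucNorm_nonneg _) hG0
    rw [← norm_normDev, ← innerDev_eq] at h1
    refine h1.trans (add_le_add ?_ ?_)
    · have h2 : Real.sqrt (g * N) ≤ Real.sqrt (condPower P R S η) := Real.sqrt_le_sqrt hG
      have h3 : 0 < Real.sqrt (g * N) := Real.sqrt_pos.2 hgn
      refine (div_le_div_of_nonneg_left (norm_nonneg _) h3 h2).trans ?_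
      have h4 : ‖innerDev P R S η x‖ ^ 2 / (g * N) =
          (‖innerDev P R S η x‖ / Real.sqrt (g * N)) ^ 2 := by
        rw [div_pow, Real.sq_sqrt hgn.le]
      rw [h4]
      nlinarith [sq_nonneg (‖innerDev P R S η x‖ / Real.sqrt (g * N) - 1)]
    · refine (div_le_div_of_nonneg_left (mul_nonneg (eucNorm_nonneg _) (norm_nonneg _))
        hgn hG).trans ?_
      rw [mul_inv, ← mul_assoc, div_eq_mul_inv]
      refine mul_le_mul_of_nonneg_right ?_ (by positivity)
      nlinarith [sq_nonneg (eucNorm x.1 - ‖normDev P R S η x‖)]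

lemma two_mul_le_add_div {s δ : ℝ} (hs : 0 < s) : 2 * δ ≤ s + δ ^ 2 / s := by
  have h1 : s + δ ^ 2 / s - 2 * δ = (s - δ) ^ 2 / s := by field_simp; ring
  have h2 : 0 ≤ (s - δ) ^ 2 / s := by positivity
  linarith

/-- Young's inequality, weighted for the use s = √N, n = N, Q = ∑ |h_i|⁴: as Q and δ² have mean
O(N), both terms on the right have mean O(√N). -/
lemma sq_mul_div_le {H δ Q s n g : ℝ} (hs : 0 < s) (hss : s * s = n) (hg : 0 < g)
    (hH : H ^ 4 ≤ n * Q) : H ^ 2 * δ / (g * n) ≤ (Q * (s / n) + δ ^ 2 / s) / (2 * g) := by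
  have hn : 0 < n := hss ▸ mul_pos hs hs
  rw [div_le_div_iff₀ (by positivity) (by positivity)]
  have h5 : 2 * (H ^ 2 * δ) ≤ Q * s + δ ^ 2 * s := by
    have h6 : H ^ 4 ≤ s * s * Q := by rwa [hss]
    have h7 : 2 * (H ^ 2 * δ) * s ≤ (Q * s + δ ^ 2 * s) * s := by
      nlinarith [sq_nonneg (H ^ 2 - δ * s)]
    exact le_of_mul_le_mul_right h7 hs
  calc H ^ 2 * δ * (2 * g) = 2 * (H ^ 2 * δ) * g := by ring
    _ ≤ (Q * s + δ ^ 2 * s) * g := mul_le_mul_of_nonneg_right h5 hg.le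
    _ = (Q * (s / n) + δ ^ 2 / s) * (g * n) := by rw [← hss]; field_simp

/-- The constant in the second-order approximation of the effective channel. -/
noncomputable def effSqConst (P : Params) (ρ c₀ : ℝ) : ℝ :=
  (fourthConst * ρ ^ 2 + normConst P ρ c₀) / (2 * powerLower P ρ c₀) +
    innerConst P ρ c₀ / powerLower P ρ c₀ +
    powerUpper P ρ c₀ / (‖P.d‖ * powerLower P ρ c₀) * (1 + innerConst P ρ c₀)

lemma norm_one_add_le (P : Params) (η : ℂ) :
    ‖1 + P.d⁻¹ * η‖ ≤ (1 + ‖P.d + η‖ ^ 2) / ‖P.d‖ := by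
  have hd := norm_pos_iff.2 P.d_ne_zero
  have h2 : 1 + P.d⁻¹ * η = P.d⁻¹ * (P.d + η) := by
    rw [mul_add, inv_mul_cancel₀ P.d_ne_zero]
  rw [h2, norm_mul, norm_inv, inv_mul_eq_div]
  gcongr
  nlinarith [sq_nonneg (‖P.d + η‖ - 1)]

/-- For fixed η, hᵀv has size √N and a first-order error O(1), so the squares can be expected to
agree up to O(√N). An L¹ bound on the difference does not imply this, so second-order stability and
fourth moments of h are used instead. -/
lemma lintegral_norm_effAt_sq_sub_le (h : UplinkBounds P ρ c₀ R S) (hN : 1 ≤ N) (η : ℂ) :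
    ∫⁻ x, ‖(‖effAt P R S (P.d + η) x‖ ^ 2 - ‖effLim P R S η‖ ^ 2 : ℝ)‖ₑ ∂(chanNoiseLaw R S) ≤
      ENNReal.ofReal (effSqConst P ρ c₀ * (1 + ‖P.d + η‖ ^ 2) ^ 2 * Real.sqrt N) := by
  have hn : (0 : ℝ) < N := by exact_mod_cast hN
  have hn1 : (1 : ℝ) ≤ N := by exact_mod_cast hN
  obtain ⟨i1, b1⟩ := integral_innerDev_sq_le h η
  obtain ⟨i2, b2⟩ := integral_normDev_sq_le h η
  obtain ⟨i3, b3⟩ := integral_sum_pow_four_le h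
  have i3' := (measurePreserving_chanNoise_chan (R := R) (S := S)).integrable_comp_of_integrable i3
  have b3' : ∫ x, ∑ i, ‖x.1 i‖ ^ 4 ∂(chanNoiseLaw R S) ≤ fourthConst * ρ ^ 2 * N := by
    refine le_of_eq_of_le ?_ b3
    rw [← (measurePreserving_chanNoise_chan (R := R) (S := S)).map_eq, integral_map
      measurable_fst.aemeasurable]
    rw [(measurePreserving_chanNoise_chan (R := R) (S := S)).map_eq]
    exact i3.1
  set g := powerLower P ρ c₀ with hg
  have hg0 : 0 < g := h.powerLower_pos hN
  have ha := innerConst_nonneg (P := P) (ρ := ρ) (c₀ := c₀)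
  have ha' := normConst_nonneg (P := P) (ρ := ρ) (c₀ := c₀)
  set w := 1 + ‖P.d + η‖ ^ 2 with hw
  have hw1 : 1 ≤ w := by rw [hw]; nlinarith [norm_nonneg (P.d + η)]
  have hG := h.condPower_ge hN η
  have hG0 := h.condPower_pos hN η
  have hgn : 0 < g * N := by positivity
  set s := Real.sqrt N with hs
  have hs0 : 0 < s := Real.sqrt_pos.2 hn
  have hss : s * s = N := Real.mul_self_sqrt hn.le
  have hs1 : 1 ≤ s := by rw [hs]; exact Real.one_le_sqrt.2 hn1
  have hd := norm_pos_iff.2 P.d_ne_zero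
  have hT := h.estPower_le
  have hT0 := h.estPower_pos hN
  set U := powerUpper P ρ c₀ with hU
  have hU0 : 0 < U := by
    have := hT0.trans_le hT
    exact pos_of_mul_pos_left this hn.le
  have hx : ‖star (1 + P.d⁻¹ * η) * (estPower P R S : ℂ)‖ ≤ w / ‖P.d‖ * (U * N) := by
    rw [norm_mul, norm_star, Complex.norm_real, Real.norm_of_nonneg hT0.le]
    have := norm_one_add_le P η
    gcongr
  set D := w * U / (‖P.d‖ * g) with hD
  have hD0 : 0 < D := by positivity
  -- Each product of a deviation with a term of known size is split with weight s = √N, which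
  -- balances the two halves. D bounds |x|/G, where x is the limit of ĥᴴh.
  refine lintegral_enorm_le_of_le (F := fun x =>
    ((∑ i, ‖x.1 i‖ ^ 4) * (s / N) + ‖normDev P R S η x‖ ^ 2 / s) / (2 * g) +
    (‖innerDev P R S η x‖ ^ 2 / (g * N) + D * (s + ‖innerDev P R S η x‖ ^ 2 / s))) ?_ ?_ fun x => ?_
  · exact (((i3'.mul_const _).add (i2.div_const _)).div_const _).add
      ((i1.div_const _).add (((integrable_const _).add (i1.div_const _)).const_mul _))
  · have e : ∫ x, (((∑ i, ‖x.1 i‖ ^ 4) * (s / N) + ‖normDev P R S η x‖ ^ 2 / s) / (2 * g) +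
        (‖innerDev P R S η x‖ ^ 2 / (g * N) + D * (s + ‖innerDev P R S η x‖ ^ 2 / s)))
          ∂(chanNoiseLaw R S) =
        ((∫ x, ∑ i, ‖x.1 i‖ ^ 4 ∂(chanNoiseLaw R S)) * (s / N) +
          (∫ x, ‖normDev P R S η x‖ ^ 2 ∂(chanNoiseLaw R S)) / s) / (2 * g) +
        ((∫ x, ‖innerDev P R S η x‖ ^ 2 ∂(chanNoiseLaw R S)) / (g * N) +
          D * (s + (∫ x, ‖innerDev P R S η x‖ ^ 2 ∂(chanNoiseLaw R S)) / s)) := by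
      have j1 := i3'.mul_const (s / N)
      have j2 := i2.div_const s
      have j3 := i1.div_const (g * N)
      have j4 := i1.div_const s
      have j5 := ((integrable_const s).add j4).const_mul D
      have j6 := (j1.add j2).div_const (2 * g)
      refine (integral_add j6 (j3.add j5)).trans (congrArg₂ _ ?_ ?_)
      · rw [integral_div]
        refine congrArg (· / _) ((integral_add j1 j2).trans (congrArg₂ _ ?_ ?_))
        · exact integral_mul_const _ _
        · exact integral_div _ _
      · refine (integral_add j3 j5).trans (congrArg₂ _ (integral_div _ _) ?_)
        rw [integral_const_mul]
        refine congrArg _ ((integral_add (integrable_const s) j4).trans (congrArg₂ _ ?_ ?_))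
        · simp
        · exact integral_div _ _
    rw [e]
    calc _ ≤ (fourthConst * ρ ^ 2 * N * (s / N) + normConst P ρ c₀ * w ^ 2 * N / s) / (2 * g) +
        (innerConst P ρ c₀ * w * N / (g * N) + D * (s + innerConst P ρ c₀ * w * N / s)) := by
          gcongr
      _ = (fourthConst * ρ ^ 2 * s + normConst P ρ c₀ * w ^ 2 * s) / (2 * g) +
        (innerConst P ρ c₀ * w / g + D * (s + innerConst P ρ c₀ * w * s)) := by
          rw [← hss]; field_simp
      _ ≤ (fourthConst * ρ ^ 2 * w ^ 2 * s + normConst P ρ c₀ * w ^ 2 * s) / (2 * g) +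
        (innerConst P ρ c₀ * (w ^ 2 * s) / g + D * (w * s + innerConst P ρ c₀ * w * s)) := by
          have hww : 1 ≤ w ^ 2 := by nlinarith
          have hw2 : w ≤ w ^ 2 * s := by
            calc w ≤ w ^ 2 := by nlinarith
              _ ≤ w ^ 2 * s := le_mul_of_one_le_right (by positivity) hs1
          have hr : fourthConst * ρ ^ 2 ≤ fourthConst * ρ ^ 2 * w ^ 2 :=
            le_mul_of_one_le_right (by have := fourthConst_pos; positivity) hww
          have hsw : s ≤ w * s := le_mul_of_one_le_left hs0.le hw1
          gcongr
      _ = effSqConst P ρ c₀ * w ^ 2 * s := by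
          unfold effSqConst; rw [← hg, ← hU, hD]; field_simp; ring
  · have h1 := abs_norm_sq_sub_le (x := star (1 + P.d⁻¹ * η) * (estPower P R S : ℂ))
      (dotProduct_mrt_mul x.1 (lmmseMatrix P R S *ᵥ pilotAt (distCoeff P) (P.d + η) x))
      (norm_dotProduct_mrt_le _ _) hG0
    rw [← norm_normDev, ← innerDev_eq] at h1
    have hlim : ‖effLim P R S η‖ ^ 2 =
        ‖star (1 + P.d⁻¹ * η) * (estPower P R S : ℂ)‖ ^ 2 / condPower P R S η := by
      rw [effLim, norm_div, Complex.norm_real, Real.norm_of_nonneg (Real.sqrt_nonneg _), div_pow,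
        Real.sq_sqrt hG0.le]
    rw [Real.norm_eq_abs, hlim]
    refine h1.trans (add_le_add ?_ ?_)
    · refine (div_le_div_of_nonneg_left (mul_nonneg (sq_nonneg _) (norm_nonneg _))
        hgn hG).trans ?_
      exact sq_mul_div_le hs0 hss hg0 (eucNorm_pow_four_le x.1)
    · refine (div_le_div_of_nonneg_left (by positivity) hgn hG).trans ?_
      rw [add_div]
      refine add_le_add le_rfl ?_
      calc 2 * ‖star (1 + P.d⁻¹ * η) * (estPower P R S : ℂ)‖ * ‖innerDev P R S η x‖ / (g * N)
          ≤ 2 * (w / ‖P.d‖ * (U * N)) * ‖innerDev P R S η x‖ / (g * N) := by gcongr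
        _ = D * (2 * ‖innerDev P R S η x‖) := by rw [hD]; field_simp
        _ ≤ D * (s + ‖innerDev P R S η x‖ ^ 2 / s) :=
            mul_le_mul_of_nonneg_left (two_mul_le_add_div hs0) hD0.le

end Conditional

/-! ### Averaging over the pilot distortion: moments of the effective channel. -/

section Moments

open scoped Matrix.Norms.L2Operator

variable {N : ℕ} {P : Params} {ρ c₀ : ℝ} {R S : Matrix (Fin N) (Fin N) ℂ}

/-- Tonelli with η outermost, so that the bounds for fixed η can be integrated. -/
lemma lintegral_uplink {F : Uplink N → ℝ≥0∞} (hF : Measurable F) :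
    ∫⁻ ω, F ω ∂(uplinkLaw P R S) = ∫⁻ η, ∫⁻ x, F (x.1, η, x.2.1, x.2.2) ∂(chanNoiseLaw R S)
      ∂(scalarCN (P.κtUT * P.pUT)) := by
  unfold uplinkLaw chanNoiseLaw
  rw [lintegral_prod _ hF.aemeasurable]
  have h1 : ∀ h : Vec N, ∫⁻ y, F (h, y) ∂((scalarCN (P.κtUT * P.pUT)).prod
      ((vecCN S).prod (stdVecCN N))) =
      ∫⁻ η, ∫⁻ y, F (h, η, y) ∂((vecCN S).prod (stdVecCN N)) ∂(scalarCN (P.κtUT * P.pUT)) :=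
    fun h => lintegral_prod _ (hF.comp (measurable_const.prodMk measurable_id)).aemeasurable
  simp_rw [h1]
  have hm : Measurable fun p : (Vec N × ℂ) × (Vec N × Vec N) => F (p.1.1, p.1.2, p.2) :=
    hF.comp ((measurable_fst.comp measurable_fst).prodMk
      ((measurable_snd.comp measurable_fst).prodMk measurable_snd))
  rw [lintegral_lintegral_swap (hm.lintegral_prod_right').aemeasurable]
  refine lintegral_congr fun η => ?_
  exact (lintegral_prod (fun x : Vec N × Vec N × Vec N => F (x.1, η, x.2.1, x.2.2))
    (hF.comp (measurable_fst.prodMk (measurable_const.prodMk measurable_snd))).aemeasurable).symm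

lemma integral_comp_measurePreserving {Ω Ω' E : Type*} [MeasurableSpace Ω] [MeasurableSpace Ω']
    [NormedAddCommGroup E] [NormedSpace ℝ E] {μ : Measure Ω} {ν : Measure Ω'} {f : Ω → Ω'}
    (hf : MeasurePreserving f μ ν) {g : Ω' → E} (hg : AEStronglyMeasurable g ν) :
    ∫ x, g (f x) ∂μ = ∫ y, g y ∂ν := by
  rw [← hf.map_eq] at hg ⊢
  exact (integral_map hf.measurable.aemeasurable hg).symm

lemma measurePreserving_chan :
    MeasurePreserving (fun ω : Uplink N => chan ω) (uplinkLaw P R S) (vecCN R) :=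
  measurePreserving_fst

lemma measurePreserving_etaUT :
    MeasurePreserving (fun ω : Uplink N => ω.2.1) (uplinkLaw P R S)
      (scalarCN (P.κtUT * P.pUT)) :=
  measurePreserving_fst.comp measurePreserving_snd

lemma measurable_eucNorm : Measurable (eucNorm (N := N)) := by
  have : (eucNorm (N := N)) = fun x => Real.sqrt (∑ i, ‖x i‖ ^ 2) := by
    ext x; rw [← eucNorm_sq, Real.sqrt_sq (eucNorm_nonneg x)]
  rw [this]; fun_prop

lemma measurable_mrt : Measurable (mrt (N := N)) := by
  refine measurable_pi_iff.2 fun i => ?_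
  have h1 : Measurable fun x : Vec N => star (x i) :=
    continuous_star.measurable.comp (measurable_pi_apply i)
  have h2 : Measurable fun x : Vec N => (eucNorm x : ℂ) :=
    Complex.measurable_ofReal.comp measurable_eucNorm
  exact h1.div h2

lemma pilotObs_eq_pilotAt (ω : Uplink N) :
    pilotObs P ω = pilotAt (distCoeff P) (P.d + ω.2.1) (ω.1, ω.2.2.1, ω.2.2.2) := by
  ext i
  simp [pilotObs, pilotAt, etaRBS_apply, distortion, distCoeff]
  ring

lemma measurable_pilotObs : Measurable (pilotObs (N := N) P) := by
  refine measurable_pi_iff.2 fun i => ?_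
  unfold pilotObs etaRBS
  fun_prop

lemma measurable_chanEst : Measurable (chanEst P R S) :=
  (measurable_mulVec _).comp measurable_pilotObs

lemma measurable_dotProduct {Ω : Type*} [MeasurableSpace Ω] {x y : Ω → Vec N} (hx : Measurable x)
    (hy : Measurable y) : Measurable fun ω => x ω ⬝ᵥ y ω := by
  have hx' := measurable_pi_iff.1 hx
  have hy' := measurable_pi_iff.1 hy
  unfold dotProduct
  fun_prop

lemma measurable_effChan {v : Vec N → Vec N} (hv : Measurable v) :
    Measurable (effChan P R S v) :=
  measurable_dotProduct measurable_fst (hv.comp measurable_chanEst)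

lemma effChan_eq_effAt (ω : Uplink N) :
    effChan P R S mrt ω = effAt P R S (P.d + ω.2.1) (ω.1, ω.2.2.1, ω.2.2.2) := by
  rw [effChan, effAt, chanEst, pilotObs_eq_pilotAt]; rfl

lemma norm_effChan_le (ω : Uplink N) : ‖effChan P R S mrt ω‖ ≤ eucNorm (chan ω) :=
  norm_dotProduct_mrt_le _ _

lemma integrable_eucNorm_chan_sq (hR : R.PosSemidef) :
    Integrable (fun ω : Uplink N => eucNorm (chan ω) ^ 2) (uplinkLaw P R S) := by
  simp_rw [eucNorm_sq]
  exact integrable_finsetSum _ fun i _ => (isCov_chan_chan hR).integrable_norm_sq i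

lemma memLp_effChan (hR : R.PosSemidef) :
    MemLp (effChan P R S mrt) 2 (uplinkLaw P R S) := by
  rw [memLp_two_iff_integrable_sq_norm (measurable_effChan measurable_mrt).aestronglyMeasurable]
  refine (integrable_eucNorm_chan_sq hR).mono'
    ((measurable_effChan measurable_mrt).norm.pow_const 2).aestronglyMeasurable
    (ae_of_all _ fun ω => ?_)
  rw [Real.norm_of_nonneg (by positivity)]
  exact pow_le_pow_left₀ (norm_nonneg _) (norm_effChan_le ω) 2

lemma measurable_condPower : Measurable (condPower P R S) := by
  have : condPower P R S = fun η => ‖P.d + η‖ ^ 2 * estChanPower P R S + estNoisePower P R S :=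
    funext fun η => condPower_eq P R S η
  rw [this]; fun_prop

lemma measurable_gain : Measurable (gain P R S) := by
  unfold gain
  exact ((measurable_const.add (measurable_const.mul measurable_id)).mul_const _).div
    (Complex.measurable_ofReal.comp (measurable_condPower.sqrt))

/-- The conjugate comes from v = ĥ*/‖ĥ‖ and disappears in the moduli that enter the bound; the
factor √T is what division by T removes. -/
lemma effLim_eq (h : UplinkBounds P ρ c₀ R S) (hN : 1 ≤ N) (η : ℂ) :
    effLim P R S η = ((Real.sqrt (estPower P R S) : ℝ) : ℂ) * star (gain P R S η) := by
  have hT := h.estPower_pos hN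
  have e : ((Real.sqrt (estPower P R S) : ℝ) : ℂ) * (Real.sqrt (estPower P R S) : ℝ) =
      (estPower P R S : ℂ) := by exact_mod_cast Real.mul_self_sqrt hT.le
  unfold effLim gain
  rw [star_div₀, star_mul', RCLike.star_def, Complex.conj_ofReal,
    Complex.conj_ofReal, ← e]
  ring

lemma norm_gain_sq (h : UplinkBounds P ρ c₀ R S) (hN : 1 ≤ N) (η : ℂ) :
    ‖gain P R S η‖ ^ 2 = ‖1 + P.d⁻¹ * η‖ ^ 2 * estPower P R S / condPower P R S η := by
  rw [gain, norm_div, norm_mul, Complex.norm_real, Complex.norm_real,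
    Real.norm_of_nonneg (Real.sqrt_nonneg _), Real.norm_of_nonneg (Real.sqrt_nonneg _), div_pow,
    mul_pow, Real.sq_sqrt (h.estPower_pos hN).le, Real.sq_sqrt (h.condPower_pos hN η).le]

lemma norm_effLim_sq (h : UplinkBounds P ρ c₀ R S) (hN : 1 ≤ N) (η : ℂ) :
    ‖effLim P R S η‖ ^ 2 = estPower P R S * ‖gain P R S η‖ ^ 2 := by
  rw [effLim_eq h hN, norm_mul, norm_star, Complex.norm_real,
    Real.norm_of_nonneg (Real.sqrt_nonneg _), mul_pow, Real.sq_sqrt (h.estPower_pos hN).le]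

lemma integrable_pilot_pow (P : Params) :
    Integrable (fun η : ℂ => (1 + ‖P.d + η‖ ^ 2) ^ 2) (scalarCN (P.κtUT * P.pUT)) := by
  have hm : MemLp (fun η : ℂ => P.d + η) ((4 : ℕ) : ℝ≥0∞) (scalarCN (P.κtUT * P.pUT)) :=
    (memLp_const P.d).add (memLp_id_scalarCN _ 4)
  have h4 := hm.integrable_norm_pow (by norm_num)
  have h2 := (memLp_two_iff_integrable_sq_norm (memLp_two_pilot P).1).1 (memLp_two_pilot P)
  have := ((integrable_const (1 : ℝ)).add (h2.const_mul 2)).add h4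
  refine this.congr (ae_of_all _ fun η => ?_)
  simp only [Pi.add_apply]
  ring

/-- The mean of `(1 + |d + η_t^UT|²)²`. -/
noncomputable def pilotMoment (P : Params) : ℝ :=
  ∫ η, (1 + ‖P.d + η‖ ^ 2) ^ 2 ∂(scalarCN (P.κtUT * P.pUT))

lemma pilotMoment_nonneg (P : Params) : 0 ≤ pilotMoment P :=
  integral_nonneg fun _ => by positivity

lemma norm_gain_sq_le (h : UplinkBounds P ρ c₀ R S) (hN : 1 ≤ N) (η : ℂ) :
    ‖gain P R S η‖ ^ 2 ≤ powerUpper P ρ c₀ / (powerLower P ρ c₀ * ‖P.d‖ ^ 2) *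
      (1 + ‖P.d + η‖ ^ 2) ^ 2 := by
  have hn : (0 : ℝ) < N := by exact_mod_cast hN
  have hg := h.powerLower_pos hN
  have hd := norm_pos_iff.2 P.d_ne_zero
  have hT := h.estPower_pos hN
  rw [norm_gain_sq h hN]
  calc ‖1 + P.d⁻¹ * η‖ ^ 2 * estPower P R S / condPower P R S η
      ≤ ((1 + ‖P.d + η‖ ^ 2) / ‖P.d‖) ^ 2 * (powerUpper P ρ c₀ * N) /
        (powerLower P ρ c₀ * N) := by
        have hU : 0 ≤ powerUpper P ρ c₀ * N := hT.le.trans h.estPower_le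
        gcongr
        · exact norm_one_add_le P η
        · exact h.estPower_le
        · exact h.condPower_ge hN η
    _ = _ := by field_simp

lemma memLp_gain (h : UplinkBounds P ρ c₀ R S) (hN : 1 ≤ N) :
    MemLp (gain P R S) 2 (scalarCN (P.κtUT * P.pUT)) := by
  rw [memLp_two_iff_integrable_sq_norm measurable_gain.aestronglyMeasurable]
  refine ((integrable_pilot_pow P).const_mul
    (powerUpper P ρ c₀ / (powerLower P ρ c₀ * ‖P.d‖ ^ 2))).mono'
    (measurable_gain.norm.pow_const 2).aestronglyMeasurable (ae_of_all _ fun η => ?_)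
  rw [Real.norm_of_nonneg (by positivity)]
  exact norm_gain_sq_le h hN η

lemma integrable_gain (h : UplinkBounds P ρ c₀ R S) (hN : 1 ≤ N) :
    Integrable (gain P R S) (scalarCN (P.κtUT * P.pUT)) :=
  (memLp_gain h hN).integrable one_le_two

lemma integrable_norm_gain_sq (h : UplinkBounds P ρ c₀ R S) (hN : 1 ≤ N) :
    Integrable (fun η => ‖gain P R S η‖ ^ 2) (scalarCN (P.κtUT * P.pUT)) :=
  (memLp_two_iff_integrable_sq_norm measurable_gain.aestronglyMeasurable).1 (memLp_gain h hN)

lemma meanSqGain_eq (h : UplinkBounds P ρ c₀ R S) (hN : 1 ≤ N) :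
    meanSqGain P R S = ∫ η, ‖gain P R S η‖ ^ 2 ∂(scalarCN (P.κtUT * P.pUT)) := by
  simp_rw [norm_gain_sq h hN]; rfl

lemma measurable_effLim (h : UplinkBounds P ρ c₀ R S) (hN : 1 ≤ N) :
    Measurable (effLim P R S) := by
  have : effLim P R S = fun η => ((Real.sqrt (estPower P R S) : ℝ) : ℂ) * star (gain P R S η) :=
    funext fun η => effLim_eq h hN η
  rw [this]
  exact (continuous_star.measurable.comp measurable_gain).const_mul _

lemma norm_integral_effLim (h : UplinkBounds P ρ c₀ R S) (hN : 1 ≤ N) :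
    ‖∫ ω : Uplink N, effLim P R S ω.2.1 ∂(uplinkLaw P R S)‖ =
      Real.sqrt (estPower P R S) * Real.sqrt (sqMeanGain P R S) := by
  have e : ∫ ω : Uplink N, effLim P R S ω.2.1 ∂(uplinkLaw P R S) =
      ∫ η, effLim P R S η ∂(scalarCN (P.κtUT * P.pUT)) :=
    integral_comp_measurePreserving measurePreserving_etaUT
      (measurable_effLim h hN).aestronglyMeasurable
  rw [e]
  simp_rw [effLim_eq h hN, RCLike.star_def]
  rw [integral_const_mul, integral_conj, norm_mul, RCLike.norm_conj, Complex.norm_real,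
    Real.norm_of_nonneg (Real.sqrt_nonneg _), sqMeanGain, Real.sqrt_sq (norm_nonneg _)]

lemma integrable_effLim (h : UplinkBounds P ρ c₀ R S) (hN : 1 ≤ N) :
    Integrable (fun ω : Uplink N => effLim P R S ω.2.1) (uplinkLaw P R S) := by
  refine measurePreserving_etaUT.integrable_comp_of_integrable (g := effLim P R S) ?_
  have : effLim P R S = fun η => ((Real.sqrt (estPower P R S) : ℝ) : ℂ) * star (gain P R S η) :=
    funext fun η => effLim_eq h hN η
  rw [this]
  exact ((memLp_gain h hN).star.integrable one_le_two).const_mul _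

lemma integral_norm_effLim_sq (h : UplinkBounds P ρ c₀ R S) (hN : 1 ≤ N) :
    Integrable (fun ω : Uplink N => ‖effLim P R S ω.2.1‖ ^ 2) (uplinkLaw P R S) ∧
    ∫ ω : Uplink N, ‖effLim P R S ω.2.1‖ ^ 2 ∂(uplinkLaw P R S) =
      estPower P R S * meanSqGain P R S := by
  simp_rw [norm_effLim_sq h hN]
  refine ⟨(measurePreserving_etaUT.integrable_comp_of_integrable
    (integrable_norm_gain_sq h hN)).const_mul _, ?_⟩
  rw [integral_const_mul, meanSqGain_eq h hN]
  exact congrArg _ (integral_comp_measurePreserving measurePreserving_etaUT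
    (measurable_gain.norm.pow_const 2).aestronglyMeasurable)

lemma effConst_nonneg (h : UplinkBounds P ρ c₀ R S) (hN : 1 ≤ N) : 0 ≤ effConst P ρ c₀ := by
  have hg := h.powerLower_pos hN
  have ha := innerConst_nonneg (P := P) (ρ := ρ) (c₀ := c₀)
  have ha' := normConst_nonneg (P := P) (ρ := ρ) (c₀ := c₀)
  have := h.rho_nonneg
  unfold effConst; positivity

lemma effSqConst_nonneg (h : UplinkBounds P ρ c₀ R S) (hN : 1 ≤ N) :
    0 ≤ effSqConst P ρ c₀ := by
  have hg := h.powerLower_pos hN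
  have ha := innerConst_nonneg (P := P) (ρ := ρ) (c₀ := c₀)
  have ha' := normConst_nonneg (P := P) (ρ := ρ) (c₀ := c₀)
  have hM := h.obsBound_pos hN
  have hf := fourthConst_pos
  unfold effSqConst powerUpper; positivity

lemma integral_norm_le_of_lintegral {Ω E : Type*} [MeasurableSpace Ω] [NormedAddCommGroup E]
    {μ : Measure Ω} {f : Ω → E} (hf : AEStronglyMeasurable f μ) {C : ℝ} (hC : 0 ≤ C)
    (h : ∫⁻ x, ‖f x‖ₑ ∂μ ≤ ENNReal.ofReal C) : ∫ x, ‖f x‖ ∂μ ≤ C := by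
  rw [integral_norm_eq_lintegral_enorm hf]
  exact ENNReal.toReal_le_of_le_ofReal hC h

lemma norm_integral_effChan_sub_le (h : UplinkBounds P ρ c₀ R S) (hN : 1 ≤ N) :
    ‖∫ ω, effChan P R S mrt ω ∂(uplinkLaw P R S) -
      ∫ ω : Uplink N, effLim P R S ω.2.1 ∂(uplinkLaw P R S)‖ ≤
        effConst P ρ c₀ * pilotMoment P := by
  have hk := mul_nonneg (effConst_nonneg h hN) (pilotMoment_nonneg P)
  have hm : Measurable fun ω : Uplink N => effChan P R S mrt ω - effLim P R S ω.2.1 :=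
    (measurable_effChan measurable_mrt).sub
      ((measurable_effLim h hN).comp (measurable_fst.comp measurable_snd))
  rw [← integral_sub ((memLp_effChan h.posSemidef).integrable one_le_two) (integrable_effLim h hN)]
  refine (norm_integral_le_integral_norm _).trans
    (integral_norm_le_of_lintegral hm.aestronglyMeasurable hk ?_)
  rw [lintegral_uplink hm.enorm]
  simp only [effChan_eq_effAt]
  refine (lintegral_mono fun η => lintegral_effAt_sub_le h hN η).trans_eq ?_
  rw [← ofReal_integral_eq_lintegral_ofReal ((integrable_pilot_pow P).const_mul _)
    (ae_of_all _ fun η => mul_nonneg (effConst_nonneg h hN) (by positivity)), integral_const_mul]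
  rfl

lemma integrable_norm_effChan_sq (hR : R.PosSemidef) :
    Integrable (fun ω => ‖effChan P R S mrt ω‖ ^ 2) (uplinkLaw P R S) :=
  (memLp_two_iff_integrable_sq_norm (measurable_effChan measurable_mrt).aestronglyMeasurable).1
    (memLp_effChan hR)

lemma abs_integral_norm_effChan_sq_sub_le (h : UplinkBounds P ρ c₀ R S) (hN : 1 ≤ N) :
    |∫ ω, ‖effChan P R S mrt ω‖ ^ 2 ∂(uplinkLaw P R S) - estPower P R S * meanSqGain P R S| ≤
        effSqConst P ρ c₀ * pilotMoment P * Real.sqrt N := by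
  have hk := mul_nonneg (mul_nonneg (effSqConst_nonneg h hN) (pilotMoment_nonneg P))
    (Real.sqrt_nonneg N)
  have hm : Measurable fun ω : Uplink N =>
      ‖effChan P R S mrt ω‖ ^ 2 - ‖effLim P R S ω.2.1‖ ^ 2 :=
    ((measurable_effChan measurable_mrt).norm.pow_const 2).sub
      (((measurable_effLim h hN).comp (measurable_fst.comp measurable_snd)).norm.pow_const 2)
  obtain ⟨i1, e1⟩ := integral_norm_effLim_sq h hN
  rw [← e1, ← integral_sub (integrable_norm_effChan_sq h.posSemidef) i1, ← Real.norm_eq_abs]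
  refine (norm_integral_le_integral_norm _).trans
    (integral_norm_le_of_lintegral hm.aestronglyMeasurable hk ?_)
  rw [lintegral_uplink hm.enorm]
  simp only [effChan_eq_effAt]
  refine (lintegral_mono fun η => lintegral_norm_effAt_sq_sub_le h hN η).trans_eq ?_
  rw [← ofReal_integral_eq_lintegral_ofReal (((integrable_pilot_pow P).const_mul _).mul_const _)
    (ae_of_all _ fun η => mul_nonneg (mul_nonneg (effSqConst_nonneg h hN) (by positivity))
      (Real.sqrt_nonneg _)), integral_mul_const, integral_const_mul]
  rfl

/-- From ‖h‖ ≤ √N + ‖h‖²/√N. It controls the sum of moduli when the difference of two squared means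
is factored. -/
lemma norm_integral_effChan_le (h : UplinkBounds P ρ c₀ R S) :
    ‖∫ ω, effChan P R S mrt ω ∂(uplinkLaw P R S)‖ ≤ (1 + ρ) * Real.sqrt N := by
  rcases Nat.eq_zero_or_pos N with rfl | hN
  · simp [effChan]
  have hn : (0 : ℝ) < N := by exact_mod_cast hN
  have hs : 0 < Real.sqrt N := Real.sqrt_pos.2 hn
  have hss : Real.sqrt N * Real.sqrt N = N := Real.mul_self_sqrt hn.le
  obtain ⟨i3, b3⟩ := integral_eucNorm_sq_le h
  have i3' : Integrable (fun ω : Uplink N => eucNorm (chan ω) ^ 2) (uplinkLaw P R S) :=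
    measurePreserving_chan.integrable_comp_of_integrable i3
  have b3' : ∫ ω, eucNorm (chan ω) ^ 2 ∂(uplinkLaw P R S) ≤ ρ * N :=
     (integral_comp_measurePreserving measurePreserving_chan i3.1).trans_le b3
  have hi : Integrable (fun ω : Uplink N => Real.sqrt N + eucNorm (chan ω) ^ 2 / Real.sqrt N)
    (uplinkLaw P R S) := (integrable_const _).add (i3'.div_const _)
  refine (norm_integral_le_of_norm_le hi (ae_of_all _ fun ω => ?_)).trans ?_
  · have := two_mul_le_add_div (δ := eucNorm (chan ω)) hs
    have h2 := norm_effChan_le (P := P) (R := R) (S := S) ω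
    have h3 := eucNorm_nonneg (chan ω)
    linarith
  · rw [integral_add (integrable_const _) (i3'.div_const _)]
    have e : ∫ ω, eucNorm (chan ω) ^ 2 / Real.sqrt N ∂(uplinkLaw P R S) =
      (∫ ω, eucNorm (chan ω) ^ 2 ∂(uplinkLaw P R S)) / Real.sqrt N := integral_div _ _
    simp only [e, integral_const, probReal_univ, one_smul]
    have : (∫ ω, eucNorm (chan ω) ^ 2 ∂(uplinkLaw P R S)) / Real.sqrt N ≤ ρ * Real.sqrt N := by
      rw [div_le_iff₀ hs, mul_assoc, hss]; exact b3'
    linarith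

/-- The constant in the approximation of the squared mean of the effective channel. -/
noncomputable def sqMeanConst (P : Params) (ρ c₀ : ℝ) : ℝ :=
  effConst P ρ c₀ * pilotMoment P * (2 * (1 + ρ) + effConst P ρ c₀ * pilotMoment P) /
    powerLower P ρ c₀

lemma abs_sqMean_sub_le (h : UplinkBounds P ρ c₀ R S) (hN : 1 ≤ N) :
    |‖∫ ω, effChan P R S mrt ω ∂(uplinkLaw P R S)‖ ^ 2 / estPower P R S - sqMeanGain P R S| ≤
      sqMeanConst P ρ c₀ * (1 / Real.sqrt N) := by
  have hn1 : (1 : ℝ) ≤ N := by exact_mod_cast hN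
  have hs1 : 1 ≤ Real.sqrt N := Real.one_le_sqrt.2 hn1
  have hss : Real.sqrt N * Real.sqrt N = N := Real.mul_self_sqrt (by linarith)
  have hg := h.powerLower_pos hN
  have hT := h.estPower_pos hN
  have hTg := h.estPower_ge hN
  set k := effConst P ρ c₀ * pilotMoment P with hk
  have hk0 : 0 ≤ k := mul_nonneg (effConst_nonneg h hN) (pilotMoment_nonneg P)
  have h1 := norm_integral_effChan_sub_le h hN
  have h2 := norm_integral_effLim h hN
  have h3 := norm_integral_effChan_le h
  set E := ∫ ω, effChan P R S mrt ω ∂(uplinkLaw P R S)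
  set L := ∫ ω : Uplink N, effLim P R S ω.2.1 ∂(uplinkLaw P R S)
  have hm0 : 0 ≤ sqMeanGain P R S := sq_nonneg _
  have hL : ‖L‖ ^ 2 = estPower P R S * sqMeanGain P R S := by
    rw [h2, mul_pow, Real.sq_sqrt hT.le, Real.sq_sqrt hm0]
  have h4 := (abs_norm_sub_norm_le E L).trans h1
  have h5 : ‖L‖ ≤ ‖E‖ + k := by linarith [(abs_le.1 h4).1]
  -- The difference of squares factors into an O(1) difference and an O(√N) sum; the O(1) constant k
  -- is absorbed into √N since N ≥ 1.
  have h6 : |‖E‖ ^ 2 - ‖L‖ ^ 2| ≤ k * ((2 * (1 + ρ) + k) * Real.sqrt N) := by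
    rw [sq_sub_sq, abs_mul, abs_of_nonneg (by positivity : 0 ≤ ‖E‖ + ‖L‖), mul_comm]
    refine mul_le_mul h4 ?_ (by positivity) hk0
    have : k ≤ k * Real.sqrt N := le_mul_of_one_le_right hk0 hs1
    linarith
  have e : ‖E‖ ^ 2 / estPower P R S - sqMeanGain P R S =
      (‖E‖ ^ 2 - ‖L‖ ^ 2) / estPower P R S := by
    rw [hL]; field_simp
  rw [e, abs_div, abs_of_pos hT]
  calc |‖E‖ ^ 2 - ‖L‖ ^ 2| / estPower P R S
      ≤ k * ((2 * (1 + ρ) + k) * Real.sqrt N) / (powerLower P ρ c₀ * N) := by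
        have := h.rho_nonneg
        gcongr
    _ = sqMeanConst P ρ c₀ * (1 / Real.sqrt N) := by
        rw [sqMeanConst, ← hk]
        generalize Real.sqrt N = s at hs1 hss
        have : s ≠ 0 := by positivity
        rw [← hss]
        field_simp

/-- The constant in the approximation of the mean squared effective channel. -/
noncomputable def meanSqConst (P : Params) (ρ c₀ : ℝ) : ℝ :=
  effSqConst P ρ c₀ * pilotMoment P / powerLower P ρ c₀

lemma abs_meanSq_sub_le (h : UplinkBounds P ρ c₀ R S) (hN : 1 ≤ N) :
    |(∫ ω, ‖effChan P R S mrt ω‖ ^ 2 ∂(uplinkLaw P R S)) / estPower P R S - meanSqGain P R S| ≤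
      meanSqConst P ρ c₀ * (1 / Real.sqrt N) := by
  have hn1 : (1 : ℝ) ≤ N := by exact_mod_cast hN
  have hs1 : 1 ≤ Real.sqrt N := Real.one_le_sqrt.2 hn1
  have hss : Real.sqrt N * Real.sqrt N = N := Real.mul_self_sqrt (by linarith)
  have hg := h.powerLower_pos hN
  have hT := h.estPower_pos hN
  have hTg := h.estPower_ge hN
  have h1 := abs_integral_norm_effChan_sq_sub_le h hN
  set E := ∫ ω, ‖effChan P R S mrt ω‖ ^ 2 ∂(uplinkLaw P R S)
  have e : E / estPower P R S - meanSqGain P R S =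
      (E - estPower P R S * meanSqGain P R S) / estPower P R S := by
    field_simp
  rw [e, abs_div, abs_of_pos hT]
  calc |E - estPower P R S * meanSqGain P R S| / estPower P R S
      ≤ effSqConst P ρ c₀ * pilotMoment P * Real.sqrt N / (powerLower P ρ c₀ * N) := by
        have := mul_nonneg (effSqConst_nonneg h hN) (pilotMoment_nonneg P)
        gcongr
    _ = meanSqConst P ρ c₀ * (1 / Real.sqrt N) := by
        rw [meanSqConst]
        generalize Real.sqrt N = s at hs1 hss
        have : s ≠ 0 := by positivity
        rw [← hss]
        field_simp

/-- The distortion term of the lower bound. -/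
noncomputable def txDistortion (P : Params) (R S : Matrix (Fin N) (Fin N) ℂ)
    (v : Vec N → Vec N) : ℝ :=
  ∑ i, ∫ ω, ‖chan ω i‖ ^ 2 * ‖v (chanEst P R S ω) i‖ ^ 2 ∂(uplinkLaw P R S)

lemma txDistortion_nonneg (v : Vec N → Vec N) : 0 ≤ txDistortion P R S v :=
  Finset.sum_nonneg fun i _ => integral_nonneg fun ω => by positivity

/-- The constant in the bound on the distortion term. -/
noncomputable def txConst (P : Params) (ρ c₀ : ℝ) : ℝ :=
  (1 + fourthConst * ρ ^ 2) / powerLower P ρ c₀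

lemma integrable_txDistortion (hR : R.PosSemidef) {v : Vec N → Vec N} (hv : Measurable v)
    (hv1 : ∀ x i, ‖v x i‖ ^ 2 ≤ 1) (i : Fin N) :
    Integrable (fun ω => ‖chan ω i‖ ^ 2 * ‖v (chanEst P R S ω) i‖ ^ 2) (uplinkLaw P R S) := by
  refine ((isCov_chan_chan hR).integrable_norm_sq i).mono' ?_ (ae_of_all _ fun ω => ?_)
  · have h1 : Measurable fun ω : Uplink N => v (chanEst P R S ω) i :=
      measurable_pi_iff.1 (hv.comp measurable_chanEst) i
    have h2 : Measurable fun ω : Uplink N => chan ω i := measurable_pi_iff.1 measurable_fst i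
    exact ((h2.norm.pow_const 2).mul (h1.norm.pow_const 2)).aestronglyMeasurable
  · rw [Real.norm_of_nonneg (by positivity)]
    exact mul_le_of_le_one_right (by positivity) (hv1 _ _)

lemma norm_mrt_apply_sq_le (x : Vec N) (i : Fin N) : ‖mrt x i‖ ^ 2 ≤ 1 :=
  (Finset.single_le_sum (f := fun i => ‖mrt x i‖ ^ 2) (fun _ _ => by positivity)
    (Finset.mem_univ i)).trans (sum_norm_sq_mrt_le x)

/-- Since |v_i|² ≤ 1, one has |h_i|²|v_i|² ≤ √N |v_i|² + |h_i|⁴/√N. Summed with ∑ |v_i|² ≤ 1 and E ∑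
|h_i|⁴ = O(N), this is O(√N), of lower order than tr(R − C). No independence of h and v is needed.
-/
lemma txDistortion_mrt_le (h : UplinkBounds P ρ c₀ R S) (hN : 1 ≤ N) :
    txDistortion P R S mrt / estPower P R S ≤ txConst P ρ c₀ * (1 / Real.sqrt N) := by
  have hn1 : (1 : ℝ) ≤ N := by exact_mod_cast hN
  have hs1 : 1 ≤ Real.sqrt N := Real.one_le_sqrt.2 hn1
  have hs0 : 0 < Real.sqrt N := by linarith
  have hss : Real.sqrt N * Real.sqrt N = N := Real.mul_self_sqrt (by linarith)
  have hg := h.powerLower_pos hN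
  have hTg := h.estPower_ge hN
  have hf := fourthConst_pos
  obtain ⟨i3, b3⟩ := integral_sum_pow_four_le h
  have i3' : Integrable (fun ω : Uplink N => ∑ i, ‖chan ω i‖ ^ 4) (uplinkLaw P R S) :=
    measurePreserving_chan.integrable_comp_of_integrable i3
  have b3' : ∫ ω, ∑ i, ‖chan ω i‖ ^ 4 ∂(uplinkLaw P R S) ≤ fourthConst * ρ ^ 2 * N :=
    (integral_comp_measurePreserving measurePreserving_chan i3.1).trans_le b3
  have key : txDistortion P R S mrt ≤ (1 + fourthConst * ρ ^ 2) * Real.sqrt N := by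
    unfold txDistortion
    rw [← integral_finsetSum _ fun i _ => integrable_txDistortion h.posSemidef measurable_mrt
      norm_mrt_apply_sq_le i]
    have hi : Integrable (fun ω : Uplink N => Real.sqrt N + (∑ i, ‖chan ω i‖ ^ 4) / Real.sqrt N)
      (uplinkLaw P R S) := (integrable_const _).add (i3'.div_const _)
    refine (integral_mono (integrable_finsetSum _ fun i _ => integrable_txDistortion h.posSemidef
      measurable_mrt norm_mrt_apply_sq_le i) hi fun ω => ?_).trans ?_
    · have h1 : ∀ i, ‖chan ω i‖ ^ 2 * ‖mrt (chanEst P R S ω) i‖ ^ 2 ≤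
          Real.sqrt N * ‖mrt (chanEst P R S ω) i‖ ^ 2 + ‖chan ω i‖ ^ 4 / Real.sqrt N := by
        intro i
        have a1 := two_mul_le_add_div (δ := ‖chan ω i‖ ^ 2) hs0
        have a2 := norm_mrt_apply_sq_le (chanEst P R S ω) i
        have a3 : 0 ≤ ‖mrt (chanEst P R S ω) i‖ ^ 2 := by positivity
        rw [← pow_mul] at a1
        have a4 : 0 ≤ ‖chan ω i‖ ^ 4 / Real.sqrt N := by positivity
        have a5 : 0 ≤ ‖chan ω i‖ ^ 2 := by positivity
        norm_num at a1
        nlinarith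
      refine (Finset.sum_le_sum fun i _ => h1 i).trans ?_
      rw [Finset.sum_add_distrib, ← Finset.mul_sum, ← Finset.sum_div]
      refine add_le_add ?_ le_rfl
      exact mul_le_of_le_one_right hs0.le (sum_norm_sq_mrt_le _)
    · rw [integral_add (integrable_const _) (i3'.div_const _)]
      have e : ∫ ω, (∑ i, ‖chan ω i‖ ^ 4) / Real.sqrt N ∂(uplinkLaw P R S) =
        (∫ ω, ∑ i, ‖chan ω i‖ ^ 4 ∂(uplinkLaw P R S)) / Real.sqrt N := integral_div _ _
      simp only [e, integral_const, probReal_univ, one_smul]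
      have : (∫ ω, ∑ i, ‖chan ω i‖ ^ 4 ∂(uplinkLaw P R S)) / Real.sqrt N ≤
          fourthConst * ρ ^ 2 * Real.sqrt N := by
        rw [div_le_iff₀ hs0, mul_assoc _ (Real.sqrt N), hss]; exact b3'
      linarith
  calc txDistortion P R S mrt / estPower P R S
      ≤ (1 + fourthConst * ρ ^ 2) * Real.sqrt N / (powerLower P ρ c₀ * N) := by gcongr
    _ = txConst P ρ c₀ * (1 / Real.sqrt N) := by
        rw [txConst]
        generalize Real.sqrt N = s at hs0 hss
        rw [← hss]
        field_simp

end Moments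

/-! ### Lower bounds on the mean and on the variance of the gain. -/

lemma measurePreserving_mul_stdCN {u : ℂ} (hu : ‖u‖ = 1) :
    MeasurePreserving (fun z : ℂ => u * z) stdCN stdCN := by
  have h : MeasurePreserving (ContinuousLinearMap.rotation (E := ℝ) (-u.arg))
      ((gaussianReal 0 (1 / 2)).prod (gaussianReal 0 (1 / 2)))
      ((gaussianReal 0 (1 / 2)).prod (gaussianReal 0 (1 / 2))) :=
    ⟨ContinuousLinearMap.measurable _, IsGaussian.map_rotation_eq_self (by simp) _⟩
  refine MeasurePreserving.of_semiconj measurePreserving_complexMk h ?_ (by fun_prop)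
  intro x
  have h1 := Complex.norm_mul_cos_arg u
  have h2 := Complex.norm_mul_sin_arg u
  rw [hu, one_mul] at h1 h2
  rw [ContinuousLinearMap.rotation_apply]
  simp [Complex.ext_iff, h1, h2]
  constructor <;> ring

section GainBounds

open scoped Matrix.Norms.L2Operator

variable {N : ℕ} {P : Params} {ρ c₀ : ℝ} {R S : Matrix (Fin N) (Fin N) ℂ}

/-- The standardized distortion `√κ_t^UT z`, with the law of `d⁻¹ η_t^UT`. -/
noncomputable def relDist (P : Params) (z : ℂ) : ℂ := ((Real.sqrt P.κtUT : ℝ) : ℂ) * z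

/-- Rotation invariance absorbs the phase of d, so η/d becomes a real multiple of a standard
variable, and conjugation and reflection act on it directly. -/
lemma measurePreserving_relDist (P : Params) :
    MeasurePreserving (fun z => P.d * relDist P z) stdCN (scalarCN (P.κtUT * P.pUT)) := by
  have hd := norm_pos_iff.2 P.d_ne_zero
  have hu : ‖P.d / (‖P.d‖ : ℂ)‖ = 1 := by
    rw [norm_div, Complex.norm_real, norm_norm, div_self hd.ne']
  have h0 : MeasurePreserving (fun z : ℂ => ((Real.sqrt (P.κtUT * P.pUT) : ℝ) : ℂ) * z) stdCN
    (scalarCN (P.κtUT * P.pUT)) := ⟨by fun_prop, rfl⟩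
  convert h0.comp (measurePreserving_mul_stdCN hu) using 1
  ext z
  have hd' : (‖P.d‖ : ℂ) ≠ 0 := by exact_mod_cast hd.ne'
  simp only [Function.comp_apply, relDist, Params.pUT]
  rw [Real.sqrt_mul P.κtUT_nonneg, Real.sqrt_sq hd.le, Complex.ofReal_mul]
  field_simp

/-- The ratio `√tr(R - C) / √tr(A (|d + d ζ|² R + Ψ) Aᴴ)`. -/
noncomputable def ampl (P : Params) (R S : Matrix (Fin N) (Fin N) ℂ) (ζ : ℂ) : ℝ :=
  Real.sqrt (estPower P R S) / Real.sqrt (condPower P R S (P.d * ζ))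

lemma gain_mul (ζ : ℂ) : gain P R S (P.d * ζ) = (1 + ζ) * (ampl P R S ζ : ℂ) := by
  rw [gain, ampl, ← mul_assoc, inv_mul_cancel₀ P.d_ne_zero, one_mul, Complex.ofReal_div,
    mul_div_assoc]

lemma gain_re (ζ : ℂ) : (gain P R S (P.d * ζ)).re = (1 + ζ.re) * ampl P R S ζ := by
  rw [gain_mul, Complex.re_mul_ofReal]; simp

lemma gain_im (ζ : ℂ) : (gain P R S (P.d * ζ)).im = ζ.im * ampl P R S ζ := by
  rw [gain_mul, Complex.im_mul_ofReal]; simp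

lemma ampl_nonneg (ζ : ℂ) : 0 ≤ ampl P R S ζ := by unfold ampl; positivity

lemma norm_d_add_sq (P : Params) (ζ : ℂ) :
    ‖P.d + P.d * ζ‖ ^ 2 = P.pUT * ((1 + ζ.re) ^ 2 + ζ.im ^ 2) := by
  have : P.d + P.d * ζ = P.d * (1 + ζ) := by ring
  rw [this, norm_mul, mul_pow, Params.pUT, Complex.sq_norm (1 + ζ), Complex.normSq_apply]
  simp
  left; ring

lemma condPower_mul (ζ : ℂ) : condPower P R S (P.d * ζ) =
    P.pUT * ((1 + ζ.re) ^ 2 + ζ.im ^ 2) * estChanPower P R S + estNoisePower P R S := by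
  rw [condPower_eq, norm_d_add_sq]

/-- A lower bound on the squared amplitude for `|ζ| ≤ 1`. -/
noncomputable def amplLower (P : Params) (ρ c₀ : ℝ) : ℝ :=
  powerLower P ρ c₀ / (lmmseBound P ρ c₀ ^ 2 * (ρ + psiBound P ρ) * (1 + 4 * P.pUT))

lemma amplDen_pos (h : UplinkBounds P ρ c₀ R S) (hN : 1 ≤ N) :
    0 < lmmseBound P ρ c₀ ^ 2 * (ρ + psiBound P ρ) * (1 + 4 * P.pUT) := by
  have h1 := h.rho_pos hN
  have h2 := P.pUT_pos
  have h3 := norm_pos_iff.2 P.d_ne_zero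
  have h4 := h.pos
  have h5 := P.κrBS_nonneg
  unfold lmmseBound psiBound
  positivity

lemma amplLower_pos (h : UplinkBounds P ρ c₀ R S) (hN : 1 ≤ N) : 0 < amplLower P ρ c₀ :=
  div_pos (h.powerLower_pos hN) (amplDen_pos h hN)

/-- For |ζ| ≤ 1 one has |d + dζ|² ≤ 4 p^UT, so the conditional power is at most of order N, while
tr(R − C) is at least of order N. -/
lemma sqrt_amplLower_le (h : UplinkBounds P ρ c₀ R S) (hN : 1 ≤ N) {ζ : ℂ} (hζ : ‖ζ‖ ≤ 1) :
    Real.sqrt (amplLower P ρ c₀) ≤ ampl P R S ζ := by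
  have hn : (0 : ℝ) < N := by exact_mod_cast hN
  unfold ampl
  rw [← Real.sqrt_div (h.estPower_pos hN).le]
  refine Real.sqrt_le_sqrt ?_
  rw [amplLower, div_le_div_iff₀ (amplDen_pos h hN) (h.condPower_pos hN _)]
  have h1 : ‖P.d + P.d * ζ‖ ^ 2 ≤ 4 * P.pUT := by
    have h2 : ‖P.d + P.d * ζ‖ ≤ 2 * ‖P.d‖ := by
      refine (norm_add_le _ _).trans ?_
      rw [norm_mul]
      nlinarith [norm_nonneg P.d]
    rw [Params.pUT]
    nlinarith [norm_nonneg (P.d + P.d * ζ)]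
  have h3 : 0 ≤ lmmseBound P ρ c₀ ^ 2 * (ρ + psiBound P ρ) := by
    have := (norm_nonneg _).trans h.norm_psi
    have := h.rho_nonneg
    positivity
  have h4 : condPower P R S (P.d * ζ) ≤
      lmmseBound P ρ c₀ ^ 2 * (ρ + psiBound P ρ) * (1 + 4 * P.pUT) * N := by
    refine (h.condPower_le _).trans ?_
    gcongr
  calc powerLower P ρ c₀ * condPower P R S (P.d * ζ)
      ≤ powerLower P ρ c₀ *
        (lmmseBound P ρ c₀ ^ 2 * (ρ + psiBound P ρ) * (1 + 4 * P.pUT) * N) :=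
        mul_le_mul_of_nonneg_left h4 (h.powerLower_pos hN).le
    _ = powerLower P ρ c₀ * N *
        (lmmseBound P ρ c₀ ^ 2 * (ρ + psiBound P ρ) * (1 + 4 * P.pUT)) := by ring
    _ ≤ _ := mul_le_mul_of_nonneg_right (h.estPower_ge hN) (amplDen_pos h hN).le

/-- After squaring and cross-multiplying, the terms x²y²a cancel and only x² ≤ y² is needed. -/
lemma div_sqrt_mono {a b s x y : ℝ} (ha : 0 ≤ a) (hb : 0 < b) (hs : 0 ≤ s) (hx : 0 ≤ x)
    (hxy : x ≤ y) :
    x / Real.sqrt ((x ^ 2 + s) * a + b) ≤ y / Real.sqrt ((y ^ 2 + s) * a + b) := by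
  have hy := hx.trans hxy
  rw [div_le_div_iff₀ (Real.sqrt_pos.2 (by positivity)) (Real.sqrt_pos.2 (by positivity))]
  rw [← pow_le_pow_iff_left₀ (by positivity) (by positivity) two_ne_zero, mul_pow, mul_pow,
    Real.sq_sqrt (by positivity), Real.sq_sqrt (by positivity)]
  have h1 : x ^ 2 ≤ y ^ 2 := by gcongr
  have h2 : 0 ≤ s * a := by positivity
  nlinarith [mul_le_mul_of_nonneg_right h1 h2, mul_le_mul_of_nonneg_right h1 hb.le]

/-- The reflection of the complex plane in the imaginary axis. -/
noncomputable def reflectRe (z : ℂ) : ℂ := -star z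

lemma measurePreserving_reflectRe : MeasurePreserving reflectRe stdCN stdCN :=
  measurePreserving_neg_stdCN.comp measurePreserving_conj_stdCN

lemma relDist_reflectRe_re (z : ℂ) : (relDist P (reflectRe z)).re = -(relDist P z).re := by
  simp [relDist, reflectRe]

lemma relDist_reflectRe_im (z : ℂ) : (relDist P (reflectRe z)).im = (relDist P z).im := by
  simp [relDist, reflectRe]

/-- By symmetry let x = Re ζ ≥ 0. If x ≤ 1, both real parts are nonnegative. If x > 1, the reflected
point contributes negatively, with numerator x − 1 against x + 1; as t/√((t² + y²)a + b) increases
in t ≥ 0, the positive term dominates. -/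
lemma gain_re_add_reflect_nonneg (h : UplinkBounds P ρ c₀ R S) (hN : 1 ≤ N) {ζ ζ' : ℂ}
    (hre : ζ'.re = -ζ.re) (him : ζ'.im = ζ.im) :
    0 ≤ (gain P R S (P.d * ζ)).re + (gain P R S (P.d * ζ')).re := by
  have hn : (0 : ℝ) < N := by exact_mod_cast hN
  have ha : 0 ≤ P.pUT * estChanPower P R S := mul_nonneg P.pUT_pos.le h.estChanPower_nonneg
  have hb : 0 < estNoisePower P R S :=
    (mul_pos (h.powerLower_pos hN) hn).trans_le (h.estNoisePower_ge hN)
  have key : ∀ {ξ ξ' : ℂ}, ξ'.re = -ξ.re → ξ'.im = ξ.im → 0 ≤ ξ.re →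
      0 ≤ (gain P R S (P.d * ξ)).re + (gain P R S (P.d * ξ')).re := by
    intro ξ ξ' hre him h0
    rw [gain_re, gain_re, hre]
    rcases le_or_gt ξ.re 1 with h1 | h1
    · exact add_nonneg (mul_nonneg (by linarith) (ampl_nonneg _))
        (mul_nonneg (by linarith) (ampl_nonneg _))
    · have hm := div_sqrt_mono (s := ξ.im ^ 2) ha hb (sq_nonneg _) (x := ξ.re - 1)
        (y := 1 + ξ.re) (by linarith) (by linarith)
      have e1 : ((1 + ξ.re) ^ 2 + ξ.im ^ 2) * (P.pUT * estChanPower P R S) +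
          estNoisePower P R S = condPower P R S (P.d * ξ) := by rw [condPower_mul]; ring
      have e2 : ((ξ.re - 1) ^ 2 + ξ.im ^ 2) * (P.pUT * estChanPower P R S) +
          estNoisePower P R S = condPower P R S (P.d * ξ') := by
        rw [condPower_mul, hre, him]; ring
      rw [e1, e2] at hm
      have hm' := mul_le_mul_of_nonneg_left hm (Real.sqrt_nonneg (estPower P R S))
      unfold ampl
      have e3 : (1 + ξ.re) * (Real.sqrt (estPower P R S) / Real.sqrt (condPower P R S (P.d * ξ)))
        + (1 + -ξ.re) * (Real.sqrt (estPower P R S) / Real.sqrt (condPower P R S (P.d * ξ'))) =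
        Real.sqrt (estPower P R S) * ((1 + ξ.re) / Real.sqrt (condPower P R S (P.d * ξ))) -
        Real.sqrt (estPower P R S) * ((ξ.re - 1) / Real.sqrt (condPower P R S (P.d * ξ'))) := by
        ring
      rw [e3]
      linarith
  rcases le_total 0 ζ.re with h0 | h0
  · exact key hre him h0
  · rw [add_comm]
    exact key (by rw [hre, neg_neg]) him.symm (by rw [hre]; linarith)

/-- The set of small standardized distortions. -/
def smallDist (P : Params) : Set ℂ := {z | ‖relDist P z‖ < 1 / 2}

lemma continuous_relDist (P : Params) : Continuous (relDist P) :=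
  continuous_const.mul continuous_id

lemma isOpen_smallDist (P : Params) : IsOpen (smallDist P) :=
  isOpen_lt (continuous_relDist P).norm continuous_const

lemma stdCN_smallDist_pos (P : Params) : 0 < stdCN.real (smallDist P) :=
  ENNReal.toReal_pos (stdCN_pos_of_isOpen (isOpen_smallDist P) ⟨0, by simp [smallDist, relDist]⟩).ne'
    (measure_ne_top _ _)

lemma integrable_gain_relDist (h : UplinkBounds P ρ c₀ R S) (hN : 1 ≤ N) :
    Integrable (fun z => gain P R S (P.d * relDist P z)) stdCN :=
  (measurePreserving_relDist P).integrable_comp_of_integrable (integrable_gain h hN)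

lemma integral_gain_eq :
    ∫ η, gain P R S η ∂(scalarCN (P.κtUT * P.pUT)) =
      ∫ z, gain P R S (P.d * relDist P z) ∂stdCN :=
  (integral_comp_measurePreserving (measurePreserving_relDist P)
    measurable_gain.aestronglyMeasurable).symm

lemma re_integral_gain (h : UplinkBounds P ρ c₀ R S) (hN : 1 ≤ N) :
    (∫ η, gain P R S η ∂(scalarCN (P.κtUT * P.pUT))).re =
      ∫ z, (gain P R S (P.d * relDist P z)).re ∂stdCN := by
  rw [integral_gain_eq]
  exact (integral_re (integrable_gain_relDist h hN)).symm

/-- The lower bound on the mean of the real part of the gain. -/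
noncomputable def meanGainLower (P : Params) (ρ c₀ : ℝ) : ℝ :=
  stdCN.real (smallDist P) * (1 / 2 * Real.sqrt (amplLower P ρ c₀))

lemma meanGainLower_pos (h : UplinkBounds P ρ c₀ R S) (hN : 1 ≤ N) :
    0 < meanGainLower P ρ c₀ := by
  have := Real.sqrt_pos.2 (amplLower_pos h hN)
  have := stdCN_smallDist_pos P
  unfold meanGainLower; positivity

/-- The real part of the gain can be negative, but its sum with its reflection is nonnegative
everywhere. On `smallDist`, where Re(1 + ζ) ≥ 1/2, each of the two is at least half of √`amplLower`.
-/
lemma meanGainLower_le (h : UplinkBounds P ρ c₀ R S) (hN : 1 ≤ N) :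
    meanGainLower P ρ c₀ ≤ (∫ η, gain P R S η ∂(scalarCN (P.κtUT * P.pUT))).re := by
  rw [re_integral_gain h hN]
  set F : ℂ → ℝ := fun z => (gain P R S (P.d * relDist P z)).re with hF
  have hFi : Integrable F stdCN := (integrable_gain_relDist h hN).re
  have hFi' : Integrable (fun z => F (reflectRe z)) stdCN :=
    measurePreserving_reflectRe.integrable_comp_of_integrable hFi
  have hsym : ∫ z, F (reflectRe z) ∂stdCN = ∫ z, F z ∂stdCN :=
    integral_comp_measurePreserving measurePreserving_reflectRe hFi.1
  have h2 : ∫ z, (F z + F (reflectRe z)) ∂stdCN = 2 * ∫ z, F z ∂stdCN := by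
    rw [integral_add hFi hFi', hsym]; ring
  have h3 : ∫ z, (smallDist P).indicator (fun _ => Real.sqrt (amplLower P ρ c₀)) z ∂stdCN =
      2 * meanGainLower P ρ c₀ := by
    rw [integral_indicator_const _ (isOpen_smallDist P).measurableSet, meanGainLower, smul_eq_mul]
    ring
  have h4 : ∀ z, z ∈ smallDist P → 1 / 2 * Real.sqrt (amplLower P ρ c₀) ≤ F z := by
    intro z hz
    have hz' : ‖relDist P z‖ < 1 / 2 := hz
    have hre := (abs_le.1 (Complex.abs_re_le_norm (relDist P z))).1
    change _ ≤ (gain P R S (P.d * relDist P z)).re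
    rw [gain_re]
    exact mul_le_mul (by linarith) (sqrt_amplLower_le h hN (by linarith)) (Real.sqrt_nonneg _)
      (by linarith)
  have h5 : 2 * meanGainLower P ρ c₀ ≤ 2 * ∫ z, F z ∂stdCN := by
    rw [← h2, ← h3]
    refine integral_mono ((integrable_const _).indicator (isOpen_smallDist P).measurableSet)
      (hFi.add hFi') fun z => ?_
    by_cases hz : z ∈ smallDist P
    · rw [Set.indicator_of_mem hz]
      have hz' : reflectRe z ∈ smallDist P := by
        have : ‖relDist P (reflectRe z)‖ = ‖relDist P z‖ := by simp [relDist, reflectRe]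
        change ‖relDist P (reflectRe z)‖ < 1 / 2
        rw [this]; exact hz
      have a := h4 z hz
      have b := h4 _ hz'
      linarith
    · rw [Set.indicator_of_notMem hz]
      exact gain_re_add_reflect_nonneg h hN (relDist_reflectRe_re z) (relDist_reflectRe_im z)
  linarith

lemma sqMeanGain_ge (h : UplinkBounds P ρ c₀ R S) (hN : 1 ≤ N) :
    meanGainLower P ρ c₀ ^ 2 ≤ sqMeanGain P R S :=
  pow_le_pow_left₀ (meanGainLower_pos h hN).le
    ((meanGainLower_le h hN).trans (Complex.re_le_norm _)) 2

/-- Conjugating ζ preserves the amplitude and changes the sign of the imaginary part. -/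
lemma im_integral_gain (h : UplinkBounds P ρ c₀ R S) (hN : 1 ≤ N) :
    (∫ η, gain P R S η ∂(scalarCN (P.κtUT * P.pUT))).im = 0 := by
  rw [integral_gain_eq]
  refine (integral_im (integrable_gain_relDist h hN)).symm.trans ?_
  set F : ℂ → ℝ := fun z => (gain P R S (P.d * relDist P z)).im with hF
  have hFi : Integrable F stdCN := (integrable_gain_relDist h hN).im
  have hsym : ∫ z, F (star z) ∂stdCN = ∫ z, F z ∂stdCN :=
    integral_comp_measurePreserving measurePreserving_conj_stdCN hFi.1
  have h1 : ∀ z, F (star z) = -F z := by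
    intro z
    have e1 : (relDist P (star z)).re = (relDist P z).re := by simp [relDist]
    have e2 : (relDist P (star z)).im = -(relDist P z).im := by simp [relDist]
    rw [hF]
    simp only [gain_im, ampl, condPower_mul, e1, e2, neg_sq]
    ring
  simp_rw [h1] at hsym
  rw [integral_neg] at hsym
  change ∫ z, F z ∂stdCN = 0
  linarith

lemma integral_sq_le_sq_integral {Ω : Type*} [MeasurableSpace Ω] {μ : Measure Ω}
    [IsProbabilityMeasure μ] {f : Ω → ℝ} (hf : MemLp f 2 μ) :
    (∫ x, f x ∂μ) ^ 2 ≤ ∫ x, f x ^ 2 ∂μ := by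
  have h := variance_eq_sub hf
  have h0 := variance_nonneg f μ
  rw [h] at h0
  simpa using h0

/-- As the gain has a real mean, the difference is the variance of its real part plus the second
moment of its imaginary part; the variance is dropped. -/
lemma meanSqGain_sub_ge (h : UplinkBounds P ρ c₀ R S) (hN : 1 ≤ N) :
    ∫ z, (gain P R S (P.d * relDist P z)).im ^ 2 ∂stdCN ≤ meanSqGain P R S - sqMeanGain P R S := by
  have hm : MemLp (fun z => gain P R S (P.d * relDist P z)) 2 stdCN :=
    (memLp_gain h hN).comp_measurePreserving (measurePreserving_relDist P)
  have hre : MemLp (fun z => (gain P R S (P.d * relDist P z)).re) 2 stdCN := hm.re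
  have him : MemLp (fun z => (gain P R S (P.d * relDist P z)).im) 2 stdCN := hm.im
  have h1 : meanSqGain P R S = ∫ z, (gain P R S (P.d * relDist P z)).re ^ 2 ∂stdCN +
      ∫ z, (gain P R S (P.d * relDist P z)).im ^ 2 ∂stdCN := by
    rw [meanSqGain_eq h hN, ← integral_comp_measurePreserving (measurePreserving_relDist P)
      (measurable_gain.norm.pow_const 2).aestronglyMeasurable,
      ← integral_add hre.integrable_sq him.integrable_sq]
    refine integral_congr_ae (ae_of_all _ fun z => ?_)
    simp only [Complex.sq_norm, Complex.normSq_apply]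
    ring
  have h2 : sqMeanGain P R S = (∫ z, (gain P R S (P.d * relDist P z)).re ∂stdCN) ^ 2 := by
    rw [sqMeanGain, Complex.sq_norm, Complex.normSq_apply, im_integral_gain h hN,
      re_integral_gain h hN]
    ring
  have h3 := integral_sq_le_sq_integral hre
  linarith

lemma sqMeanGain_le_meanSqGain (h : UplinkBounds P ρ c₀ R S) (hN : 1 ≤ N) :
    sqMeanGain P R S ≤ meanSqGain P R S := by
  have h1 := meanSqGain_sub_ge h hN
  have h2 : 0 ≤ ∫ z, (gain P R S (P.d * relDist P z)).im ^ 2 ∂stdCN :=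
    integral_nonneg fun _ => sq_nonneg _
  linarith

/-- A set of distortions with non-negligible imaginary part. -/
def skewDist (P : Params) : Set ℂ := {z | ‖relDist P z‖ < 1} ∩ {z | 1 / 4 < (relDist P z).im}

lemma isOpen_skewDist (P : Params) : IsOpen (skewDist P) :=
  (isOpen_lt (continuous_relDist P).norm continuous_const).inter
    (isOpen_lt continuous_const (Complex.continuous_im.comp (continuous_relDist P)))

lemma stdCN_skewDist_pos (hκ : 0 < P.κtUT) : 0 < stdCN.real (skewDist P) := by
  refine ENNReal.toReal_pos (stdCN_pos_of_isOpen (isOpen_skewDist P) ?_).ne' (measure_ne_top _ _)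
  have hs := Real.sqrt_pos.2 hκ
  have hs' : ((Real.sqrt P.κtUT : ℝ) : ℂ) ≠ 0 := by exact_mod_cast hs.ne'
  -- Chosen so that the relative distortion equals i/2, of norm below 1 and imaginary part above
  -- 1/4; κ_t^UT > 0 allows the division.
  refine ⟨((1 / 2 : ℝ) : ℂ) * Complex.I / ((Real.sqrt P.κtUT : ℝ) : ℂ), ?_⟩
  have e : relDist P (((1 / 2 : ℝ) : ℂ) * Complex.I / ((Real.sqrt P.κtUT : ℝ) : ℂ)) =
      ((1 / 2 : ℝ) : ℂ) * Complex.I := by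
    rw [relDist]; field_simp
  refine ⟨?_, ?_⟩
  · change ‖_‖ < _
    rw [e, norm_mul, Complex.norm_real, Complex.norm_I]; norm_num
  · change _ < Complex.im _
    rw [e, Complex.im_ofReal_mul, Complex.I_im]; norm_num

/-- The lower bound on the variance of the gain. -/
noncomputable def varGainLower (P : Params) (ρ c₀ : ℝ) : ℝ :=
  stdCN.real (skewDist P) * (1 / 16 * amplLower P ρ c₀)

lemma varGainLower_pos (h : UplinkBounds P ρ c₀ R S) (hN : 1 ≤ N) (hκ : 0 < P.κtUT) :
    0 < varGainLower P ρ c₀ := by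
  have := amplLower_pos h hN
  have := stdCN_skewDist_pos hκ
  unfold varGainLower; positivity

lemma varGainLower_le (h : UplinkBounds P ρ c₀ R S) (hN : 1 ≤ N) :
    varGainLower P ρ c₀ ≤ meanSqGain P R S - sqMeanGain P R S := by
  refine le_trans ?_ (meanSqGain_sub_ge h hN)
  have hm : MemLp (fun z => gain P R S (P.d * relDist P z)) 2 stdCN :=
    (memLp_gain h hN).comp_measurePreserving (measurePreserving_relDist P)
  have him : MemLp (fun z => (gain P R S (P.d * relDist P z)).im) 2 stdCN := hm.im
  have e : varGainLower P ρ c₀ =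
      ∫ z, (skewDist P).indicator (fun _ => 1 / 16 * amplLower P ρ c₀) z ∂stdCN := by
    rw [integral_indicator_const _ (isOpen_skewDist P).measurableSet, varGainLower, smul_eq_mul]
  rw [e]
  refine integral_mono ((integrable_const _).indicator (isOpen_skewDist P).measurableSet)
    him.integrable_sq fun z => ?_
  by_cases hz : z ∈ skewDist P
  · rw [Set.indicator_of_mem hz]
    have h1 : ‖relDist P z‖ < 1 := hz.1
    have h2 : 1 / 4 < (relDist P z).im := hz.2
    have h3 := sqrt_amplLower_le h hN h1.le
    have h4 := Real.sq_sqrt (amplLower_pos h hN).le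
    have h5 : 1 / 4 * Real.sqrt (amplLower P ρ c₀) ≤ (gain P R S (P.d * relDist P z)).im := by
      rw [gain_im]
      exact mul_le_mul h2.le h3 (Real.sqrt_nonneg _) (by linarith)
    calc 1 / 16 * amplLower P ρ c₀ = (1 / 4 * Real.sqrt (amplLower P ρ c₀)) ^ 2 := by
          rw [mul_pow, h4]; norm_num
      _ ≤ _ := pow_le_pow_left₀ (by positivity) h5 2
  · rw [Set.indicator_of_notMem hz]
    exact sq_nonneg _

end GainBounds

/-! ### A lower bound on mutual information through linear estimation. -/

/-- The Donsker-Varadhan lower bound on the Kullback-Leibler divergence. -/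
lemma ofReal_integral_le_klDiv {Ω : Type*} [MeasurableSpace Ω] {μ ν : Measure Ω}
    [IsProbabilityMeasure μ] [IsProbabilityMeasure ν] {φ : Ω → ℝ} (hφ : Integrable φ μ)
    (hexp : Integrable (fun x => Real.exp (φ x)) ν) (h1 : ∫ x, Real.exp (φ x) ∂ν = 1) :
    ENNReal.ofReal (∫ x, φ x ∂μ) ≤ InformationTheory.klDiv μ ν := by
  by_cases h : InformationTheory.klDiv μ ν = ∞
  · rw [h]; exact le_top
  obtain ⟨hac, hint⟩ := InformationTheory.klDiv_ne_top_iff.1 h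
  have hp : IsProbabilityMeasure (ν.tilted φ) := isProbabilityMeasure_tilted hexp
  -- Gibbs' inequality for μ against ν tilted by φ. The normalizing constant is 1, so tilting
  -- changes the mean log-likelihood ratio by exactly ∫ φ dμ.
  have h2 := InformationTheory.integral_llr_add_sub_measure_univ_nonneg
    (hac.trans (absolutelyContinuous_tilted hexp)) (integrable_llr_tilted_right hac hφ hint hexp)
  rw [integral_llr_tilted_right hac hφ hexp hint, h1] at h2
  simp only [Real.log_one, probReal_univ, add_zero, add_sub_cancel_right] at h2
  refine ENNReal.ofReal_le_of_le_toReal ?_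
  rw [InformationTheory.toReal_klDiv_of_measure_eq hac (by simp)]
  linarith

/-- The density of N(0, 1/2) is proportional to exp(−x²), which cancels exp(x²); what remains is √c
times the density of N(m, c/2). -/
lemma lintegral_exp_gaussianReal {c : ℝ} (hc : 0 < c) (m : ℝ) :
    ∫⁻ x, ENNReal.ofReal (Real.exp (x ^ 2 - (x - m) ^ 2 / c)) ∂(gaussianReal 0 (1 / 2)) =
      ENNReal.ofReal (Real.sqrt c) := by
  obtain ⟨w, hw⟩ : ∃ w : NNReal, (w : ℝ) = c / 2 := ⟨⟨c / 2, by positivity⟩, rfl⟩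
  have hv : w ≠ 0 := by
    rintro rfl
    rw [NNReal.coe_zero] at hw
    linarith
  rw [gaussianReal_of_var_ne_zero 0 (by norm_num : (1 / 2 : NNReal) ≠ 0),
    lintegral_withDensity_eq_lintegral_mul _ (measurable_gaussianPDF _ _) (by fun_prop)]
  have e : ∀ x, (gaussianPDF 0 (1 / 2) * fun x => ENNReal.ofReal
      (Real.exp (x ^ 2 - (x - m) ^ 2 / c))) x =
      ENNReal.ofReal (Real.sqrt c) * gaussianPDF m w x := by
    intro x
    simp only [Pi.mul_apply, gaussianPDF, gaussianPDFReal]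
    rw [← ENNReal.ofReal_mul (by positivity), ← ENNReal.ofReal_mul (by positivity)]
    congr 1
    have e1 : (2 * Real.pi * ((1 / 2 : NNReal) : ℝ)) = Real.pi := by push_cast; ring
    have e2 : 2 * Real.pi * (w : ℝ) = Real.pi * c := by rw [hw]; ring
    rw [e1, e2, Real.sqrt_mul Real.pi_pos.le, mul_assoc, ← Real.exp_add]
    have hs := Real.sqrt_pos.2 hc
    have hp := Real.sqrt_pos.2 Real.pi_pos
    rw [mul_inv, ← mul_assoc, mul_comm (Real.sqrt c), mul_assoc (Real.sqrt Real.pi)⁻¹,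
      inv_mul_cancel₀ hs.ne', mul_one]
    congr 2
    rw [hw]
    push_cast
    field_simp
    ring
  rw [lintegral_congr e, lintegral_const_mul _ (measurable_gaussianPDF _ _),
    lintegral_gaussianPDF_eq_one m hv, mul_one]

lemma lintegral_exp_stdCN {c : ℝ} (hc : 0 < c) (m : ℂ) :
    ∫⁻ z, ENNReal.ofReal (Real.exp (‖z‖ ^ 2 - ‖z - m‖ ^ 2 / c)) ∂stdCN = ENNReal.ofReal c := by
  rw [← measurePreserving_complexMk.lintegral_comp (by fun_prop)]
  have e : ∀ x : ℝ × ℝ, ENNReal.ofReal (Real.exp (‖(⟨x.1, x.2⟩ : ℂ)‖ ^ 2 -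
      ‖(⟨x.1, x.2⟩ : ℂ) - m‖ ^ 2 / c)) =
      ENNReal.ofReal (Real.exp (x.1 ^ 2 - (x.1 - m.re) ^ 2 / c)) *
      ENNReal.ofReal (Real.exp (x.2 ^ 2 - (x.2 - m.im) ^ 2 / c)) := by
    intro x
    rw [← ENNReal.ofReal_mul (by positivity), ← Real.exp_add]
    congr 2
    simp only [Complex.sq_norm, Complex.normSq_apply, Complex.sub_re, Complex.sub_im]
    ring
  have hm : ∀ b : ℝ, AEMeasurable
      (fun x : ℝ => ENNReal.ofReal (Real.exp (x ^ 2 - (x - b) ^ 2 / c))) (gaussianReal 0 (1 / 2)) :=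
    fun b => by fun_prop
  rw [lintegral_congr e, lintegral_prod_mul (hm _) (hm _),
    lintegral_exp_gaussianReal hc, lintegral_exp_gaussianReal hc,
    ← ENNReal.ofReal_mul (Real.sqrt_nonneg _), Real.mul_self_sqrt hc.le]

/-- The integrand times p/v is the ratio of the densities of CN(m, v) and CN(0, p), so this is the
normalization of a Gaussian density. -/
lemma lintegral_exp_scalarCN {p v : ℝ} (hp : 0 < p) (hv : 0 < v) (m : ℂ) :
    ∫⁻ s, ENNReal.ofReal (Real.exp (‖s‖ ^ 2 / p - ‖s - m‖ ^ 2 / v)) ∂(scalarCN p) =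
      ENNReal.ofReal (v / p) := by
  have hs := Real.sqrt_pos.2 hp
  have hs' : ((Real.sqrt p : ℝ) : ℂ) ≠ 0 := by exact_mod_cast hs.ne'
  have hss := Real.sq_sqrt hp.le
  unfold scalarCN
  rw [lintegral_map (by fun_prop) (by fun_prop),
    ← lintegral_exp_stdCN (div_pos hv hp) (m / ((Real.sqrt p : ℝ) : ℂ))]
  refine lintegral_congr fun z => ?_
  have e1 : ((Real.sqrt p : ℝ) : ℂ) * z - m =
      ((Real.sqrt p : ℝ) : ℂ) * (z - m / ((Real.sqrt p : ℝ) : ℂ)) := by field_simp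
  rw [e1, norm_mul, norm_mul, Complex.norm_real, Real.norm_of_nonneg hs.le, mul_pow, mul_pow, hss]
  congr 3 <;> field_simp

lemma integral_norm_sub_mul_sq {Ω : Type*} [MeasurableSpace Ω] {μ : Measure Ω} {s y : Ω → ℂ}
    (hs : MemLp s 2 μ) (hy : MemLp y 2 μ) (a : ℂ) :
    Integrable (fun ω => ‖s ω - a * y ω‖ ^ 2) μ ∧
    ∫ ω, ‖s ω - a * y ω‖ ^ 2 ∂μ =
      ∫ ω, ‖s ω‖ ^ 2 ∂μ - 2 * (star a * ∫ ω, s ω * star (y ω) ∂μ).re +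
        ‖a‖ ^ 2 * ∫ ω, ‖y ω‖ ^ 2 ∂μ := by
  have is : Integrable (fun ω => ‖s ω‖ ^ 2) μ := (memLp_two_iff_integrable_sq_norm hs.1).1 hs
  have iy : Integrable (fun ω => ‖y ω‖ ^ 2) μ := (memLp_two_iff_integrable_sq_norm hy.1).1 hy
  have isy : Integrable (fun ω => star a * (s ω * star (y ω))) μ :=
    (integrable_mul_conj hs hy).const_mul _
  have ire : Integrable (fun ω => 2 * (star a * (s ω * star (y ω))).re) μ := isy.re.const_mul 2
  have e : (fun ω => ‖s ω - a * y ω‖ ^ 2) = fun ω =>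
      ‖s ω‖ ^ 2 - 2 * (star a * (s ω * star (y ω))).re + ‖a‖ ^ 2 * ‖y ω‖ ^ 2 := by
    ext ω
    simp only [Complex.sq_norm, Complex.normSq_apply, RCLike.star_def, Complex.mul_re,
      Complex.mul_im, Complex.sub_re, Complex.sub_im, Complex.conj_re, Complex.conj_im]
    ring
  have e2 : ∫ ω, (star a * (s ω * star (y ω))).re ∂μ =
      (star a * ∫ ω, s ω * star (y ω) ∂μ).re := by
    rw [← integral_const_mul]
    exact integral_re isy
  rw [e]
  refine ⟨(is.sub ire).add (iy.const_mul _), ?_⟩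
  refine (integral_add (is.sub ire) (iy.const_mul _)).trans ?_
  rw [integral_const_mul]
  congr 1
  refine (integral_sub is ire).trans ?_
  rw [integral_const_mul, e2]

lemma integral_norm_sq_scalarCN {p : ℝ} (hp : 0 ≤ p) : ∫ z, ‖z‖ ^ 2 ∂(scalarCN p) = p := by
  have h3 := integral_mul_conj_scalarCN hp
  simp_rw [RCLike.star_def, RCLike.mul_conj] at h3
  have h4 : ∫ z, (((‖z‖ ^ 2 : ℝ)) : ℂ) ∂(scalarCN p) = p := by simpa using h3
  rw [integral_complex_ofReal] at h4
  exact_mod_cast h4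

/-- A lower bound on the mutual information of a Gaussian variable and a second variable through the
linear estimate of the former from the latter. -/
lemma ofReal_log_le_mutualInfo {Ω U : Type*} [MeasurableSpace Ω] [MeasurableSpace U]
    {μ : Measure Ω} [IsProbabilityMeasure μ] {s y : Ω → ℂ} {u : Ω → U} (hs : Measurable s)
    (hy : Measurable y) (hu : Measurable u) {p : ℝ} (hp : 0 < p) (hsp : μ.map s = scalarCN p)
    (hy2 : MemLp y 2 μ) (he : 0 < ∫ ω, ‖y ω‖ ^ 2 ∂μ)
    (hc : ‖∫ ω, s ω * star (y ω) ∂μ‖ ^ 2 < p * ∫ ω, ‖y ω‖ ^ 2 ∂μ) :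
    ENNReal.ofReal (Real.log (1 + ‖∫ ω, s ω * star (y ω) ∂μ‖ ^ 2 /
      (p * ∫ ω, ‖y ω‖ ^ 2 ∂μ - ‖∫ ω, s ω * star (y ω) ∂μ‖ ^ 2))) ≤
      mutualInfo μ s (fun ω => (y ω, u ω)) := by
  set e := ∫ ω, ‖y ω‖ ^ 2 ∂μ with he_def
  set c := ∫ ω, s ω * star (y ω) ∂μ with hc_def
  -- a y is the linear minimum mean square error estimate of s from y, and v is its error variance,
  -- positive because `hc` is strict Cauchy–Schwarz.
  set a : ℂ := c / e with ha
  set v : ℝ := p - ‖c‖ ^ 2 / e with hv_def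
  have hv : 0 < v := by rw [hv_def, sub_pos, div_lt_iff₀ he]; exact hc
  have hsP : MeasurePreserving s μ (scalarCN p) := ⟨hs, hsp⟩
  have hs2 : MemLp s 2 μ := by
    have h2 := memLp_id_scalarCN p 2
    exact h2.comp_measurePreserving hsP
  have hps : ∫ ω, ‖s ω‖ ^ 2 ∂μ = p := by
    rw [← integral_norm_sq_scalarCN hp.le]
    exact integral_comp_measurePreserving hsP (g := fun z : ℂ => ‖z‖ ^ 2) (by fun_prop)
  obtain ⟨i1, e1⟩ := integral_norm_sub_mul_sq hs2 hy2 a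
  rw [hps, ← hc_def, ← he_def] at e1
  have e2 : ∫ ω, ‖s ω - a * y ω‖ ^ 2 ∂μ = v := by
    have he' : (e : ℂ) ≠ 0 := by exact_mod_cast he.ne'
    have h3 : star a * c = ((‖c‖ ^ 2 / e : ℝ) : ℂ) := by
      rw [ha, star_div₀, RCLike.star_def, Complex.conj_ofReal, div_mul_eq_mul_div,
        RCLike.conj_mul]
      push_cast
      rfl
    have h4 : ‖a‖ ^ 2 = ‖c‖ ^ 2 / e ^ 2 := by
      rw [ha, norm_div, div_pow, Complex.norm_real, Real.norm_of_nonneg he.le]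
    rw [e1, h3, h4, Complex.ofReal_re, hv_def]
    field_simp
    ring
  -- The log-ratio of the densities of CN(ay, v) and CN(0, p) at s. For each fixed (y, u) its
  -- exponential has integral 1 over s; its mean under the joint law is log(p/v), because both
  -- quadratic terms have mean 1. It does not involve u.
  set φ : ℂ × (ℂ × U) → ℝ := fun x =>
    Real.log (p / v) + (‖x.1‖ ^ 2 / p - ‖x.1 - a * x.2.1‖ ^ 2 / v) with hφ
  have hφm : Measurable φ := by rw [hφ]; fun_prop
  have hj : Measurable fun ω => (s ω, (y ω, u ω)) := hs.prodMk (hy.prodMk hu)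
  have hjP : MeasurePreserving (fun ω => (s ω, (y ω, u ω))) μ
      (μ.map fun ω => (s ω, (y ω, u ω))) := ⟨hj, rfl⟩
  have is : Integrable (fun ω => ‖s ω‖ ^ 2) μ := (memLp_two_iff_integrable_sq_norm hs2.1).1 hs2
  have i2 : Integrable (fun ω => φ (s ω, (y ω, u ω))) μ :=
    (integrable_const _).add ((is.div_const p).sub (i1.div_const v))
  have e3 : ∫ ω, φ (s ω, (y ω, u ω)) ∂μ = Real.log (p / v) := by
    have h5 : ∫ ω, φ (s ω, (y ω, u ω)) ∂μ = ∫ _, Real.log (p / v) ∂μ +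
        ∫ ω, (‖s ω‖ ^ 2 / p - ‖s ω - a * y ω‖ ^ 2 / v) ∂μ :=
      integral_add (integrable_const _) ((is.div_const p).sub (i1.div_const v))
    rw [h5, integral_sub (is.div_const p) (i1.div_const v), integral_div, integral_div, hps, e2,
      div_self hp.ne', div_self hv.ne']
    simp
  have hprob : IsProbabilityMeasure (μ.map fun ω => (s ω, (y ω, u ω))) :=
    Measure.isProbabilityMeasure_map hj.aemeasurable
  have hprob2 : IsProbabilityMeasure (μ.map fun ω => (y ω, u ω)) :=
    Measure.isProbabilityMeasure_map (hy.prodMk hu).aemeasurable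
  have hlin : ∫⁻ x, ENNReal.ofReal (Real.exp (φ x))
      ∂((μ.map s).prod (μ.map fun ω => (y ω, u ω))) = 1 := by
    rw [hsp, lintegral_prod_symm _ (by fun_prop)]
    have h6 : ∀ w : ℂ × U, ∫⁻ x, ENNReal.ofReal (Real.exp (φ (x, w))) ∂(scalarCN p) = 1 := by
      intro w
      have h7 : ∀ x, ENNReal.ofReal (Real.exp (φ (x, w))) = ENNReal.ofReal (p / v) *
          ENNReal.ofReal (Real.exp (‖x‖ ^ 2 / p - ‖x - a * w.1‖ ^ 2 / v)) := by
        intro x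
        rw [hφ, Real.exp_add, Real.exp_log (div_pos hp hv),
          ENNReal.ofReal_mul (div_pos hp hv).le]
      rw [lintegral_congr h7, lintegral_const_mul _ (by fun_prop),
        lintegral_exp_scalarCN hp hv, ← ENNReal.ofReal_mul (div_pos hp hv).le]
      have : p / v * (v / p) = 1 := by field_simp
      rw [this, ENNReal.ofReal_one]
    simp [h6]
  have hexp : Integrable (fun x => Real.exp (φ x))
      ((μ.map s).prod (μ.map fun ω => (y ω, u ω))) := by
    refine ⟨by fun_prop, ?_⟩
    rw [hasFiniteIntegral_iff_ofReal (ae_of_all _ fun x => (Real.exp_pos _).le), hlin]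
    exact ENNReal.one_lt_top
  have hone : ∫ x, Real.exp (φ x) ∂((μ.map s).prod (μ.map fun ω => (y ω, u ω))) = 1 := by
    rw [integral_eq_lintegral_of_nonneg_ae (ae_of_all _ fun x => (Real.exp_pos _).le) hexp.1, hlin]
    rfl
  have hprob3 : IsProbabilityMeasure (μ.map s) := by rw [hsp]; infer_instance
  have hφi : Integrable φ (μ.map fun ω => (s ω, (y ω, u ω))) :=
    (integrable_map_measure hφm.aestronglyMeasurable hj.aemeasurable).2 i2
  have key := ofReal_integral_le_klDiv hφi hexp hone
  rw [integral_map hj.aemeasurable hφm.aestronglyMeasurable, e3] at key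
  have h8 : 1 + ‖c‖ ^ 2 / (p * e - ‖c‖ ^ 2) = p / v := by
    have h9 : v * e = p * e - ‖c‖ ^ 2 := by rw [hv_def]; field_simp
    rw [← h9]
    have h10 : ‖c‖ ^ 2 = p * e - v * e := by linarith
    rw [h10]
    field_simp
    ring
  rw [h8]
  exact key

/-! ### Second moments of random combinations of uncorrelated sources. -/

section BilinearSums

variable {ι Ω Ω' : Type*} [Fintype ι] [MeasurableSpace Ω] [MeasurableSpace Ω'] {μ : Measure Ω}
  {ν : Measure Ω'} {X : ι → Ω → ℂ} {Z : ι → Ω' → ℂ}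

lemma memLp_two_mul_prod [SFinite ν] {f : Ω → ℂ} {g : Ω' → ℂ} (hf : MemLp f 2 μ) (hg : MemLp g 2 ν) :
    MemLp (fun q : Ω × Ω' => f q.1 * g q.2) 2 (μ.prod ν) := by
  have hm : AEStronglyMeasurable (fun q : Ω × Ω' => f q.1 * g q.2) (μ.prod ν) :=
    hf.1.comp_fst.mul hg.1.comp_snd
  rw [memLp_two_iff_integrable_sq_norm hm]
  simp_rw [norm_mul, mul_pow]
  exact ((memLp_two_iff_integrable_sq_norm hf.1).1 hf).mul_prod
    ((memLp_two_iff_integrable_sq_norm hg.1).1 hg)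

lemma memLp_two_bilinear [SFinite ν] (hX : ∀ k, MemLp (X k) 2 μ) (hZ : ∀ k, MemLp (Z k) 2 ν) :
    MemLp (fun q : Ω × Ω' => ∑ k, X k q.1 * Z k q.2) 2 (μ.prod ν) :=
  memLp_finsetSum _ fun k _ => memLp_two_mul_prod (hX k) (hZ k)

/-- Independence of the two factors splits each term, and orthogonality of the Z_k leaves only k =
l. The coefficients X_k may depend on one another in any way. -/
lemma integral_mul_conj_bilinear [IsProbabilityMeasure μ] [IsProbabilityMeasure ν]
    (hX : ∀ k, MemLp (X k) 2 μ) (hZ : ∀ k, MemLp (Z k) 2 ν)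
    (h0 : ∀ k l, k ≠ l → ∫ x, Z k x * star (Z l x) ∂ν = 0) {f : Ω → ℂ} (hf : MemLp f 2 μ) (l : ι) :
    ∫ q : Ω × Ω', f q.1 * Z l q.2 * star (∑ k, X k q.1 * Z k q.2) ∂(μ.prod ν) =
      (∫ x, f x * star (X l x) ∂μ) * ∫ x, ((‖Z l x‖ ^ 2 : ℝ) : ℂ) ∂ν := by
  have hfl : MemLp (fun q : Ω × Ω' => f q.1 * Z l q.2) 2 (μ.prod ν) :=
    memLp_two_mul_prod hf (hZ l)
  simp_rw [star_sum, Finset.mul_sum]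
  rw [integral_finsetSum _ fun k _ =>
    integrable_mul_conj hfl (memLp_two_mul_prod (hX k) (hZ k))]
  have e : ∀ k, ∫ q : Ω × Ω', f q.1 * Z l q.2 * star (X k q.1 * Z k q.2) ∂(μ.prod ν) =
      (∫ x, f x * star (X k x) ∂μ) * ∫ x, Z l x * star (Z k x) ∂ν := by
    intro k
    rw [← integral_prod_mul]
    refine integral_congr_ae (ae_of_all _ fun q => ?_)
    simp only [star_mul']
    ring
  simp_rw [e]
  rw [Finset.sum_eq_single l]
  · simp_rw [ofReal_norm_sq]
  · intro k _ hk
    rw [h0 l k hk.symm, mul_zero]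
  · simp

lemma integral_norm_sq_bilinear [IsProbabilityMeasure μ] [IsProbabilityMeasure ν]
    (hX : ∀ k, MemLp (X k) 2 μ) (hZ : ∀ k, MemLp (Z k) 2 ν)
    (h0 : ∀ k l, k ≠ l → ∫ x, Z k x * star (Z l x) ∂ν = 0) :
    ∫ q : Ω × Ω', ‖∑ k, X k q.1 * Z k q.2‖ ^ 2 ∂(μ.prod ν) =
      ∑ k, (∫ x, ‖X k x‖ ^ 2 ∂μ) * ∫ x, ‖Z k x‖ ^ 2 ∂ν := by
  have h : ((∫ q : Ω × Ω', ‖∑ k, X k q.1 * Z k q.2‖ ^ 2 ∂(μ.prod ν) : ℝ) : ℂ) =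
      ((∑ k, (∫ x, ‖X k x‖ ^ 2 ∂μ) * ∫ x, ‖Z k x‖ ^ 2 ∂ν : ℝ) : ℂ) := by
    rw [← integral_complex_ofReal]
    simp_rw [ofReal_norm_sq]
    have e : ∀ q : Ω × Ω', (∑ k, X k q.1 * Z k q.2) * star (∑ k, X k q.1 * Z k q.2) =
        ∑ l, X l q.1 * Z l q.2 * star (∑ k, X k q.1 * Z k q.2) := fun q => Finset.sum_mul _ _ _
    simp_rw [e]
    rw [integral_finsetSum _ fun l _ =>
      integrable_mul_conj (memLp_two_mul_prod (hX l) (hZ l)) (memLp_two_bilinear hX hZ)]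
    push_cast
    refine Finset.sum_congr rfl fun l _ => ?_
    rw [integral_mul_conj_bilinear hX hZ h0 (hX l) l, ← integral_complex_ofReal,
      ← integral_complex_ofReal]
    simp_rw [← ofReal_norm_sq]
  exact_mod_cast h

end BilinearSums

/-! ### Second moments of the received downlink signal. -/

section Received

variable {N : ℕ}

/-- The law of the data signal and the downlink noises. -/
noncomputable def signalLaw (p : ℝ) (N : ℕ) : Measure (ℂ × DownNoise N) :=
  (scalarCN p).prod (downNoiseLaw N)

instance (p : ℝ) (N : ℕ) : IsProbabilityMeasure (signalLaw p N) := by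
  unfold signalLaw; infer_instance

instance (p : ℝ) (N : ℕ) : SFinite (signalLaw p N) := inferInstance

/-- The scalar sources of randomness of the downlink. -/
def source (N : ℕ) : Fin 3 ⊕ Fin N → ℂ × DownNoise N → ℂ :=
  Sum.elim ![fun q => q.1, fun q => q.2.2.1, fun q => q.2.2.2] (fun i q => q.2.1 i)

lemma measurePreserving_signal (p : ℝ) :
    MeasurePreserving (fun q : ℂ × DownNoise N => q.1) (signalLaw p N) (scalarCN p) :=
  measurePreserving_fst

lemma measurePreserving_downNoise (p : ℝ) :
    MeasurePreserving (fun q : ℂ × DownNoise N => q.2) (signalLaw p N) (downNoiseLaw N) :=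
  measurePreserving_snd

lemma measurePreserving_txNoise (p : ℝ) :
    MeasurePreserving (fun q : ℂ × DownNoise N => q.2.1) (signalLaw p N) (stdVecCN N) :=
  (measurePreserving_fst (μ := stdVecCN N) (ν := stdCN.prod stdCN)).comp
    (measurePreserving_downNoise p)

lemma measurePreserving_rxNoise (p : ℝ) :
    MeasurePreserving (fun q : ℂ × DownNoise N => q.2.2.1) (signalLaw p N) stdCN :=
  ((measurePreserving_fst (μ := stdCN) (ν := stdCN)).comp
    (measurePreserving_snd (μ := stdVecCN N) (ν := stdCN.prod stdCN))).comp
    (measurePreserving_downNoise p)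

lemma measurePreserving_thermalNoise (p : ℝ) :
    MeasurePreserving (fun q : ℂ × DownNoise N => q.2.2.2) (signalLaw p N) stdCN :=
  ((measurePreserving_snd (μ := stdCN) (ν := stdCN)).comp
    (measurePreserving_snd (μ := stdVecCN N) (ν := stdCN.prod stdCN))).comp
    (measurePreserving_downNoise p)

lemma measurePreserving_txNoise_eval (p : ℝ) (i : Fin N) :
    MeasurePreserving (fun q : ℂ × DownNoise N => q.2.1 i) (signalLaw p N) stdCN :=
  (measurePreserving_eval_stdVecCN i).comp (measurePreserving_txNoise p)

/-- The second moments of the sources. -/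
def sourceVar (p : ℝ) (N : ℕ) : Fin 3 ⊕ Fin N → ℝ := Sum.elim ![p, 1, 1] (fun _ => 1)

lemma measurePreserving_source (p : ℝ) (k : Fin 3 ⊕ Fin N) :
    MeasurePreserving (source N k) (signalLaw p N) (if k = Sum.inl 0 then scalarCN p else stdCN) := by
  rcases k with k | i
  · fin_cases k
    · exact measurePreserving_signal p
    · exact measurePreserving_rxNoise p
    · exact measurePreserving_thermalNoise p
  · exact measurePreserving_txNoise_eval p i

lemma memLp_source (p : ℝ) (k : Fin 3 ⊕ Fin N) : MemLp (source N k) 2 (signalLaw p N) := by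
  have h := measurePreserving_source (N := N) p k
  split_ifs at h with hk
  · have h2 : MemLp (fun z : ℂ => z) 2 (scalarCN p) := by exact_mod_cast memLp_id_scalarCN p 2
    exact h2.comp_measurePreserving h
  · have h2 : MemLp (fun z : ℂ => z) 2 stdCN := by exact_mod_cast memLp_id_stdCN 2
    exact h2.comp_measurePreserving h

lemma integral_norm_sq_source {p : ℝ} (hp : 0 ≤ p) (k : Fin 3 ⊕ Fin N) :
    ∫ q, ‖source N k q‖ ^ 2 ∂(signalLaw p N) = sourceVar p N k := by
  have h := measurePreserving_source (N := N) p k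
  have h2 := integral_comp_measurePreserving h (g := fun z : ℂ => ‖z‖ ^ 2) (by fun_prop)
  rw [h2]
  split_ifs with hk
  · rw [hk, integral_norm_sq_scalarCN hp]; rfl
  · rw [integral_norm_sq_stdCN]
    rcases k with k | i
    · fin_cases k
      · exact absurd rfl hk
      · rfl
      · rfl
    · rfl

/-- Reverses the sign of one of the first three sources. -/
noncomputable def flipSource (a : Fin 3) (q : ℂ × DownNoise N) : ℂ × DownNoise N :=
  (if a = 0 then -q.1 else q.1, q.2.1, if a = 1 then -q.2.2.1 else q.2.2.1,
    if a = 2 then -q.2.2.2 else q.2.2.2)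

lemma measurePreserving_neg_scalarCN (p : ℝ) :
    MeasurePreserving (fun z : ℂ => -z) (scalarCN p) (scalarCN p) := by
  have h : MeasurePreserving (fun z : ℂ => ((Real.sqrt p : ℝ) : ℂ) * z) stdCN (scalarCN p) :=
    ⟨by fun_prop, rfl⟩
  refine MeasurePreserving.of_semiconj h measurePreserving_neg_stdCN (fun z => ?_) measurable_neg
  ring

lemma measurePreserving_flipSource (p : ℝ) (a : Fin 3) :
    MeasurePreserving (flipSource (N := N) a) (signalLaw p N) (signalLaw p N) := by
  have key : ∀ (μ : Measure ℂ), MeasurePreserving (fun z : ℂ => -z) μ μ → ∀ b : Fin 3,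
      MeasurePreserving (fun z : ℂ => if a = b then -z else z) μ μ := by
    intro μ hμ b
    split_ifs
    · exact hμ
    · exact MeasurePreserving.id μ
  exact (key _ (measurePreserving_neg_scalarCN p) 0).prod
    ((MeasurePreserving.id (stdVecCN N)).prod
      ((key _ measurePreserving_neg_stdCN 1).prod (key _ measurePreserving_neg_stdCN 2)))

lemma source_flipSource_self (a : Fin 3) (q : ℂ × DownNoise N) :
    source N (Sum.inl a) (flipSource a q) = -source N (Sum.inl a) q := by
  fin_cases a <;> simp [source, flipSource]

lemma source_flipSource_of_ne (a : Fin 3) {l : Fin 3 ⊕ Fin N} (hl : l ≠ Sum.inl a)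
    (q : ℂ × DownNoise N) : source N l (flipSource a q) = source N l q := by
  rcases l with l | i
  · have h : a ≠ l := fun h => hl (by rw [h])
    fin_cases l <;> simp_all [source, flipSource]
  · rfl

/-- Reversing the sign of one of the two sources reverses the product. Two antenna noises are
instead covered by the identity covariance of the standard vector. -/
lemma integral_source_mul_conj (p : ℝ) {k l : Fin 3 ⊕ Fin N} (hkl : k ≠ l) :
    ∫ q, source N k q * star (source N l q) ∂(signalLaw p N) = 0 := by
  have hm : AEStronglyMeasurable (fun q => source N k q * star (source N l q)) (signalLaw p N) :=
    (integrable_mul_conj (memLp_source p k) (memLp_source p l)).1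
  have hne : (-1 : ℂ) ≠ 1 := by norm_num
  rcases k with a | i
  · refine integral_eq_zero_of_semi_invariant (measurePreserving_flipSource p a) hm hne fun q => ?_
    rw [source_flipSource_self, source_flipSource_of_ne a hkl.symm]
    ring
  · rcases l with a | j
    · refine integral_eq_zero_of_semi_invariant (measurePreserving_flipSource p a) hm hne
        fun q => ?_
      rw [source_flipSource_self, source_flipSource_of_ne a hkl, star_neg]
      ring
    · have hij : i ≠ j := fun h => hkl (by rw [h])
      have h := isCov_stdVecCN (N := N)
      have h1 := h.integral_eq i j
      rw [Matrix.one_apply_ne hij] at h1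
      rw [← h1]
      exact integral_comp_measurePreserving (measurePreserving_txNoise p) (h.integrable i j).1

/-- The coefficients of the sources in the received downlink signal. -/
noncomputable def rxCoeff (P : Params) (pBS σ2 : ℝ) (h w : Vec N) : Fin 3 ⊕ Fin N → ℂ :=
  Sum.elim ![h ⬝ᵥ w, ((Real.sqrt (P.κrUT * pBS) * ‖h ⬝ᵥ w‖ : ℝ) : ℂ), ((Real.sqrt σ2 : ℝ) : ℂ)]
    (fun i => h i * ((Real.sqrt (P.κtBS * pBS) * ‖w i‖ : ℝ) : ℂ))

/-- The distortions depend on the channel and on w only through coefficients that multiply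
independent sources, so the signal is bilinear and the preceding moment formulas apply. -/
lemma received_eq_sum (P : Params) (pBS σ2 : ℝ) (h w : Vec N) (q : ℂ × DownNoise N) :
    received P pBS σ2 h w q.1 q.2 = ∑ k, rxCoeff P pBS σ2 h w k * source N k q := by
  rw [Fintype.sum_sum_type, Fin.sum_univ_three]
  simp only [received, rxCoeff, source, Sum.elim_inl, Sum.elim_inr, Matrix.cons_val_zero,
    Matrix.cons_val_one, Matrix.cons_val, dotProduct, mul_add, Finset.sum_add_distrib,
    Finset.sum_mul, mul_assoc]
  ring

variable {α : Type*} [MeasurableSpace α] {M : Measure α} [IsProbabilityMeasure M]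
  {P : Params} {p σ2 : ℝ} {H W : α → Vec N}

lemma measurable_received (hH : Measurable H) (hW : Measurable W) :
    Measurable fun q : α × (ℂ × DownNoise N) =>
      received P p σ2 (H q.1) (W q.1) q.2.1 q.2.2 := by
  have hH' := measurable_pi_iff.1 hH
  have hW' := measurable_pi_iff.1 hW
  have hd := measurable_dotProduct hH hW
  have hc : ∀ k, Measurable fun x => rxCoeff P p σ2 (H x) (W x) k := by
    rintro (k | i)
    · fin_cases k
      · exact hd
      · exact Complex.measurable_ofReal.comp (hd.norm.const_mul _)
      · exact measurable_const
    · exact (hH' i).mul (Complex.measurable_ofReal.comp ((hW' i).norm.const_mul _))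
  have hs : ∀ k, Measurable (source N k) := fun k => (measurePreserving_source 1 k).measurable
  simp_rw [received_eq_sum]
  exact Finset.measurable_sum _ fun k _ =>
    ((hc k).comp measurable_fst).mul ((hs k).comp measurable_snd)

lemma memLp_rxCoeff (hg : MemLp (fun x => H x ⬝ᵥ W x) 2 M)
    (hHW : ∀ i, MemLp (fun x => H x i * ((‖W x i‖ : ℝ) : ℂ)) 2 M) (k : Fin 3 ⊕ Fin N) :
    MemLp (fun x => rxCoeff P p σ2 (H x) (W x) k) 2 M := by
  rcases k with k | i
  · fin_cases k
    · exact hg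
    · exact (hg.norm.const_mul (Real.sqrt (P.κrUT * p))).ofReal
    · exact memLp_const _
  · refine ((hHW i).const_mul (((Real.sqrt (P.κtBS * p) : ℝ) : ℂ))).congr_norm ?_ ?_
    · have h1 := ((hHW i).const_mul (((Real.sqrt (P.κtBS * p) : ℝ) : ℂ))).1
      refine h1.congr (ae_of_all _ fun x => ?_)
      simp [rxCoeff]; ring
    · refine ae_of_all _ fun x => ?_
      congr 1
      simp [rxCoeff]; ring

lemma received_moments (hp : 0 ≤ p) (hσ : 0 ≤ σ2) (hg : MemLp (fun x => H x ⬝ᵥ W x) 2 M)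
    (hHW : ∀ i, MemLp (fun x => H x i * ((‖W x i‖ : ℝ) : ℂ)) 2 M) :
    MemLp (fun q : α × (ℂ × DownNoise N) => received P p σ2 (H q.1) (W q.1) q.2.1 q.2.2) 2
      (M.prod (signalLaw p N)) ∧
    ∫ q : α × (ℂ × DownNoise N), q.2.1 * star (received P p σ2 (H q.1) (W q.1) q.2.1 q.2.2)
      ∂(M.prod (signalLaw p N)) = p * star (∫ x, H x ⬝ᵥ W x ∂M) ∧
    ∫ q : α × (ℂ × DownNoise N), ‖received P p σ2 (H q.1) (W q.1) q.2.1 q.2.2‖ ^ 2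
      ∂(M.prod (signalLaw p N)) = p * ((1 + P.κrUT) * ∫ x, ‖H x ⬝ᵥ W x‖ ^ 2 ∂M +
        P.κtBS * ∑ i, ∫ x, ‖H x i‖ ^ 2 * ‖W x i‖ ^ 2 ∂M) + σ2 := by
  have hX := memLp_rxCoeff (P := P) (p := p) (σ2 := σ2) hg hHW
  have hZ := memLp_source (N := N) p
  have h0 : ∀ k l, k ≠ l → ∫ q, source N k q * star (source N l q) ∂(signalLaw p N) = 0 :=
    fun k l hkl => integral_source_mul_conj p hkl
  simp_rw [received_eq_sum]
  refine ⟨memLp_two_bilinear hX hZ, ?_, ?_⟩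
  · have h1 := integral_mul_conj_bilinear hX hZ h0 (memLp_const (1 : ℂ)) (Sum.inl 0)
    simp only [one_mul] at h1
    refine h1.trans ?_
    rw [integral_complex_ofReal, integral_norm_sq_source hp, mul_comm]
    congr 1
    simp_rw [RCLike.star_def]
    exact integral_conj
  · rw [integral_norm_sq_bilinear hX hZ h0, Fintype.sum_sum_type, Fin.sum_univ_three]
    simp_rw [integral_norm_sq_source hp]
    simp only [rxCoeff, sourceVar, Sum.elim_inl, Sum.elim_inr, Matrix.cons_val_zero,
      Matrix.cons_val_one, Matrix.cons_val, Complex.norm_real, norm_mul, norm_norm, mul_pow,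
      Real.norm_of_nonneg (Real.sqrt_nonneg _), Real.sq_sqrt hσ,
      Real.sq_sqrt (mul_nonneg P.κrUT_nonneg hp), Real.sq_sqrt (mul_nonneg P.κtBS_nonneg hp),
      integral_const_mul, integral_const, probReal_univ, one_smul, mul_one]
    have e : ∀ i, ∫ x, ‖H x i‖ ^ 2 * (P.κtBS * p * ‖W x i‖ ^ 2) ∂M =
        P.κtBS * p * ∫ x, ‖H x i‖ ^ 2 * ‖W x i‖ ^ 2 ∂M := by
      intro i
      rw [← integral_const_mul]
      exact integral_congr_ae (ae_of_all _ fun x => by ring)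
    simp_rw [e, ← Finset.mul_sum]
    ring

end Received

/-! ### Almost sure nonvanishing of the channel estimate. -/

lemma stdVecCN_hyperplane {N : ℕ} {b : Vec N} (hb : b ≠ 0) (t : ℂ) :
    stdVecCN N {g | b ⬝ᵥ g = t} = 0 := by
  obtain ⟨j, hj⟩ := Function.ne_iff.1 hb
  obtain ⟨n, rfl⟩ : ∃ n, N = n + 1 := ⟨N - 1, by have := j.pos; omega⟩
  have hT := measurePreserving_piFinSuccAbove (fun _ : Fin (n + 1) => stdCN) j
  set B : Set (ℂ × Vec n) := {q | b j * q.1 + ∑ k, b (j.succAbove k) * q.2 k = t} with hB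
  have hBm : MeasurableSet B := by
    have hm : Measurable fun q : ℂ × Vec n => b j * q.1 + ∑ k, b (j.succAbove k) * q.2 k := by
      fun_prop
    exact hm (measurableSet_singleton t)
  have h1 : {g : Vec (n + 1) | b ⬝ᵥ g = t} =
      (MeasurableEquiv.piFinSuccAbove (fun _ : Fin (n + 1) => ℂ) j) ⁻¹' B := by
    ext g
    simp only [Set.mem_ofPred_eq, Set.mem_preimage, hB, dotProduct]
    rw [Fin.sum_univ_succAbove _ j]
    rfl
  have h2 := noAtoms_stdCN
  unfold stdVecCN
  rw [h1, hT.measure_preimage hBm.nullMeasurableSet, Measure.prod_apply_symm hBm]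
  -- With all coordinates but the j-th fixed, where b_j ≠ 0, the equation has a single solution, and
  -- the scalar law has no atoms.
  refine (lintegral_congr fun y => ?_).trans lintegral_zero
  refine measure_mono_null (t := {(t - ∑ k, b (j.succAbove k) * y k) / b j}) (fun x hx => ?_)
    (measure_singleton _)
  have hx' : b j * x + ∑ k, b (j.succAbove k) * y k = t := hx
  rw [Set.mem_singleton_iff, eq_div_iff hj, ← hx']
  ring

section Estimate

variable {N : ℕ} {P : Params} {ρ c₀ : ℝ} {R S : Matrix (Fin N) (Fin N) ℂ}

/-- As S is invertible, a nonzero row of A remains nonzero after multiplication by the square root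
of S, which reduces the claim to the standard law. -/
lemma vecCN_hyperplane (hS : S.PosDef) {A : Matrix (Fin N) (Fin N) ℂ} {i : Fin N}
    (hA : A i ≠ 0) (t : ℂ) : vecCN S {x | (A *ᵥ x) i = t} = 0 := by
  obtain ⟨L, hL, hLS, -, -⟩ := exists_vecCN_eq_map hS.posSemidef
  have hm : MeasurableSet {x : Vec N | (A *ᵥ x) i = t} :=
    (measurable_pi_iff.1 (measurable_mulVec A) i) (measurableSet_singleton t)
  rw [hL, Measure.map_apply (measurable_mulVec L) hm]
  have hb : (A * L) i ≠ 0 := by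
    intro h
    refine hA ?_
    have hu : IsUnit S.det := (Matrix.isUnit_iff_isUnit_det _).1 hS.isUnit
    have h1 : (A * S) i = 0 := by
      rw [← hLS, ← Matrix.mul_assoc]
      ext k
      rw [Matrix.mul_apply]
      simp [h]
    have h2 : A = A * S * S⁻¹ := by rw [Matrix.mul_assoc, Matrix.mul_nonsing_inv _ hu, mul_one]
    rw [h2]
    ext k
    rw [Matrix.mul_apply]
    simp [h1]
  convert stdVecCN_hyperplane hb t using 2
  ext g
  simp only [Set.mem_preimage, Set.mem_ofPred_eq, Matrix.mulVec_mulVec]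
  rfl

/-- With everything but ν fixed, a vanishing entry of ĥ from a nonzero row of A confines ν to an
affine hyperplane. -/
lemma chanEst_ne_zero_ae (hS : S.PosDef) (hA : lmmseMatrix P R S ≠ 0) :
    ∀ᵐ ω ∂(uplinkLaw P R S), chanEst P R S ω ≠ 0 := by
  obtain ⟨i, hi⟩ := Function.ne_iff.1 hA
  set Z : Set (Uplink N) := {ω | chanEst P R S ω i = 0} with hZ
  have hZm : MeasurableSet Z :=
    (measurable_pi_iff.1 measurable_chanEst i) (measurableSet_singleton 0)
  have h0 : uplinkLaw P R S Z = 0 := by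
    unfold uplinkLaw
    rw [Measure.measure_prod_null hZm]
    refine ae_of_all _ fun h => ?_
    have hZ1 := measurable_prodMk_left (x := h) hZm
    simp only [Pi.zero_apply]
    rw [Measure.measure_prod_null hZ1]
    refine ae_of_all _ fun η => ?_
    have hZ2 := measurable_prodMk_left (x := η) hZ1
    simp only [Pi.zero_apply]
    rw [Measure.prod_apply_symm hZ2]
    refine (lintegral_congr fun ξ => ?_).trans lintegral_zero
    set c : Vec N := fun k => h k * (P.d + η) + etaRBS P (h, η, 0, ξ) k
    refine measure_mono_null (fun x hx => ?_)
      (vecCN_hyperplane hS hi (-(lmmseMatrix P R S *ᵥ c) i))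
    have hx' : (lmmseMatrix P R S *ᵥ pilotObs P (h, η, x, ξ)) i = 0 := hx
    have e : pilotObs P (h, η, x, ξ) = c + x := by
      ext k
      simp only [pilotObs, etaRBS, Pi.add_apply, c]
      ring
    rw [e, Matrix.mulVec_add, Pi.add_apply] at hx'
    exact eq_neg_of_add_eq_zero_right hx'
  refine measure_mono_null (fun ω hω => ?_) h0
  have : chanEst P R S ω = 0 := by simpa using hω
  simp [hZ, this]

lemma UplinkBounds.lmmseMatrix_ne_zero (h : UplinkBounds P ρ c₀ R S) (hN : 1 ≤ N) :
    lmmseMatrix P R S ≠ 0 := by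
  intro h0
  have hn : (0 : ℝ) < N := by exact_mod_cast hN
  have h1 := (mul_pos (h.powerLower_pos hN) hn).trans_le (h.estNoisePower_ge hN)
  rw [estNoisePower, h0] at h1
  simp at h1

end Estimate

/-! ### The capacity lower bound. -/

section Capacity

variable {N : ℕ} {P : Params} {ρ c₀ : ℝ} {R S : Matrix (Fin N) (Fin N) ℂ}

open Classical in
/-- Maximum ratio transmission, extended to a unit vector where the estimate is zero. -/
noncomputable def unitMrt (i₀ : Fin N) (x : Vec N) : Vec N :=
  if x = 0 then Pi.single i₀ 1 else mrt x

lemma measurable_unitMrt (i₀ : Fin N) : Measurable (unitMrt i₀) :=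
  Measurable.ite (measurableSet_singleton 0) measurable_const measurable_mrt

lemma eucNorm_unitMrt (i₀ : Fin N) (x : Vec N) : eucNorm (unitMrt i₀ x) = 1 := by
  have h : eucNorm (unitMrt i₀ x) ^ 2 = 1 := by
    unfold unitMrt
    split_ifs with hx
    · rw [eucNorm_sq, Finset.sum_eq_single i₀]
      · simp
      · intro j _ hj
        simp [hj]
      · simp
    · have h1 : eucNorm x ^ 2 ≠ 0 := by
        rw [eucNorm_sq]
        intro h0
        refine hx (funext fun i => ?_)
        have := (Finset.sum_eq_zero_iff_of_nonneg fun i _ => by positivity).1 h0 i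
          (Finset.mem_univ i)
        simpa using this
      rw [eucNorm_sq]
      simp only [mrt, norm_div, norm_star, Complex.norm_real, div_pow,
        Real.norm_of_nonneg (eucNorm_nonneg x)]
      rw [← Finset.sum_div, ← eucNorm_sq, div_self h1]
  have h0 := eucNorm_nonneg (unitMrt i₀ x)
  nlinarith

lemma norm_unitMrt_apply_sq_le (i₀ : Fin N) (x : Vec N) (i : Fin N) :
    ‖unitMrt i₀ x i‖ ^ 2 ≤ 1 := by
  have h := eucNorm_sq (unitMrt i₀ x)
  rw [eucNorm_unitMrt, one_pow] at h
  rw [h]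
  exact Finset.single_le_sum (f := fun i => ‖unitMrt i₀ x i‖ ^ 2) (fun _ _ => by positivity)
    (Finset.mem_univ i)

/-- The capacity requires a unit vector for every value of the estimate, and `mrt` fails this at
zero only. Changing it there affects a null event and no expectation. -/
lemma unitMrt_chanEst_ae (h : UplinkBounds P ρ c₀ R S) (hN : 1 ≤ N) (i₀ : Fin N) :
    ∀ᵐ ω ∂(uplinkLaw P R S), unitMrt i₀ (chanEst P R S ω) = mrt (chanEst P R S ω) := by
  filter_upwards [chanEst_ne_zero_ae h.posDef (h.lmmseMatrix_ne_zero hN)] with ω hω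
  rw [unitMrt, if_neg hω]

lemma sinrTilde_congr {v v' : Vec N → Vec N}
    (hv : ∀ᵐ ω ∂(uplinkLaw P R S), v (chanEst P R S ω) = v' (chanEst P R S ω)) (pBS σ2 : ℝ) :
    sinrTilde P R S v pBS σ2 = sinrTilde P R S v' pBS σ2 := by
  have h1 : effChan P R S v =ᵐ[uplinkLaw P R S] effChan P R S v' := by
    filter_upwards [hv] with ω hω
    rw [effChan, effChan, hω]
  have h2 : (fun ω => ‖effChan P R S v ω‖ ^ 2) =ᵐ[uplinkLaw P R S]
      fun ω => ‖effChan P R S v' ω‖ ^ 2 := by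
    filter_upwards [h1] with ω hω
    rw [hω]
  have h3 : ∀ i, (fun ω => ‖chan ω i‖ ^ 2 * ‖v (chanEst P R S ω) i‖ ^ 2) =ᵐ[uplinkLaw P R S]
      fun ω => ‖chan ω i‖ ^ 2 * ‖v' (chanEst P R S ω) i‖ ^ 2 := by
    intro i
    filter_upwards [hv] with ω hω
    rw [hω]
  unfold sinrTilde
  rw [integral_congr_ae h1, integral_congr_ae h2]
  simp_rw [fun i => integral_congr_ae (h3 i)]

lemma norm_integral_sq_le {Ω : Type*} [MeasurableSpace Ω] {μ : Measure Ω} [IsProbabilityMeasure μ]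
    {f : Ω → ℂ} (hf : MemLp f 2 μ) : ‖∫ x, f x ∂μ‖ ^ 2 ≤ ∫ x, ‖f x‖ ^ 2 ∂μ :=
  (pow_le_pow_left₀ (norm_nonneg _) (norm_integral_le_integral_norm f) 2).trans
    (integral_sq_le_sq_integral hf.norm)

/-- The worst-case Gaussian noise bound on the mutual information of the downlink. -/
lemma ofReal_log_sinrTilde_le {U : Type} [MeasurableSpace U]
    (K : Kernel (Vec N × Vec N × Vec N) U) [IsMarkovKernel K] {w : Vec N → Vec N}
    (hw : Measurable w) (hw1 : ∀ x i, ‖w x i‖ ^ 2 ≤ 1) (hR : R.PosSemidef)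
    (hg : MemLp (effChan P R S w) 2 (uplinkLaw P R S)) {pBS σ2 : ℝ} (hp : 0 < pBS) (hσ : 0 < σ2) :
    ENNReal.ofReal (Real.log (1 + sinrTilde P R S w pBS σ2)) ≤
      mutualInfo (downlinkLaw P R S K w (scalarCN pBS)) (fun q => q.2.1)
        (fun q => (received P pBS σ2 q.1.1.1 q.1.1.2.2 q.2.1 q.2.2, q.1.2)) := by
  set T : Uplink N → Vec N × Vec N × Vec N :=
    fun ω => (chan ω, chanEst P R S ω, w (chanEst P R S ω)) with hT
  have hTm : Measurable T :=
    measurable_fst.prodMk (measurable_chanEst.prodMk (hw.comp measurable_chanEst))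
  have hν : IsProbabilityMeasure ((uplinkLaw P R S).map T) :=
    Measure.isProbabilityMeasure_map hTm.aemeasurable
  set M := (uplinkLaw P R S).map T ⊗ₘ K with hM
  have hTP : MeasurePreserving T (uplinkLaw P R S) ((uplinkLaw P R S).map T) := ⟨hTm, rfl⟩
  have hMP : MeasurePreserving (fun q : (Vec N × Vec N × Vec N) × U => q.1) M
      ((uplinkLaw P R S).map T) := ⟨measurable_fst, Measure.fst_compProd _ K⟩
  -- Since the kernel is Markov, functions of (h, ĥ, w) have the same mean whether or not u is
  -- adjoined.
  have hint : ∀ {E : Type} [NormedAddCommGroup E] [NormedSpace ℝ E]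
      {G : Vec N × Vec N × Vec N → E}, AEStronglyMeasurable G ((uplinkLaw P R S).map T) →
      ∫ q, G q.1 ∂M = ∫ ω, G (T ω) ∂(uplinkLaw P R S) := by
    intro E _ _ G hG
    rw [integral_comp_measurePreserving hMP hG, integral_comp_measurePreserving hTP hG]
  set H : (Vec N × Vec N × Vec N) × U → Vec N := fun q => q.1.1
  set W : (Vec N × Vec N × Vec N) × U → Vec N := fun q => q.1.2.2
  have hHm : Measurable H := measurable_fst.comp measurable_fst
  have hWm : Measurable W := measurable_snd.comp (measurable_snd.comp measurable_fst)
  have g1 : Measurable fun x : Vec N × Vec N × Vec N => x.1 ⬝ᵥ x.2.2 :=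
    measurable_dotProduct measurable_fst (measurable_snd.comp measurable_snd)
  have g2 : ∀ i, Measurable fun x : Vec N × Vec N × Vec N =>
      ‖x.1 i‖ ^ 2 * ‖x.2.2 i‖ ^ 2 := fun i => by fun_prop
  have g3 : ∀ i, Measurable fun x : Vec N × Vec N × Vec N =>
      x.1 i * ((‖x.2.2 i‖ : ℝ) : ℂ) := fun i => by fun_prop
  have eg : ∫ q, H q ⬝ᵥ W q ∂M = ∫ ω, effChan P R S w ω ∂(uplinkLaw P R S) :=
    hint g1.aestronglyMeasurable
  have eg2 : ∫ q, ‖H q ⬝ᵥ W q‖ ^ 2 ∂M = ∫ ω, ‖effChan P R S w ω‖ ^ 2 ∂(uplinkLaw P R S) :=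
    hint (g1.norm.pow_const 2).aestronglyMeasurable
  have eg3 : ∀ i, ∫ q, ‖H q i‖ ^ 2 * ‖W q i‖ ^ 2 ∂M =
      ∫ ω, ‖chan ω i‖ ^ 2 * ‖w (chanEst P R S ω) i‖ ^ 2 ∂(uplinkLaw P R S) :=
    fun i => hint (g2 i).aestronglyMeasurable
  have hgM : MemLp (fun q => H q ⬝ᵥ W q) 2 M := by
    have h1 : MemLp (fun x : Vec N × Vec N × Vec N => x.1 ⬝ᵥ x.2.2) 2
        ((uplinkLaw P R S).map T) :=
      (memLp_map_measure_iff g1.aestronglyMeasurable hTm.aemeasurable).2 hg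
    exact h1.comp_measurePreserving hMP
  have hHW : ∀ i, MemLp (fun q => H q i * ((‖W q i‖ : ℝ) : ℂ)) 2 M := by
    intro i
    have h1 : MemLp (fun x : Vec N × Vec N × Vec N => x.1 i * ((‖x.2.2 i‖ : ℝ) : ℂ)) 2
        ((uplinkLaw P R S).map T) := by
      rw [memLp_map_measure_iff (g3 i).aestronglyMeasurable hTm.aemeasurable,
        memLp_two_iff_integrable_sq_norm ((g3 i).comp hTm).aestronglyMeasurable]
      refine (integrable_txDistortion (P := P) (S := S) hR hw hw1 i).congr
        (ae_of_all _ fun ω => ?_)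
      simp only [Function.comp_apply, hT, norm_mul, Complex.norm_real, norm_norm, mul_pow]
    exact h1.comp_measurePreserving hMP
  obtain ⟨m1, m2, m3⟩ := received_moments (P := P) hp.le hσ.le hgM hHW
  rw [eg] at m2
  rw [eg2] at m3
  simp_rw [eg3] at m3
  set D := ∑ i, ∫ ω, ‖chan ω i‖ ^ 2 * ‖w (chanEst P R S ω) i‖ ^ 2 ∂(uplinkLaw P R S) with hD
  set E := ∫ ω, effChan P R S w ω ∂(uplinkLaw P R S) with hE
  set G := ∫ ω, ‖effChan P R S w ω‖ ^ 2 ∂(uplinkLaw P R S) with hG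
  have hEG : ‖E‖ ^ 2 ≤ G := norm_integral_sq_le hg
  have hG0 : 0 ≤ G := (sq_nonneg _).trans hEG
  have hD0 : 0 ≤ D := Finset.sum_nonneg fun i _ => integral_nonneg fun ω => by positivity
  have hκ := P.κrUT_nonneg
  have hκ' := P.κtBS_nonneg
  have hc : ‖(pBS : ℂ) * star E‖ ^ 2 = pBS ^ 2 * ‖E‖ ^ 2 := by
    rw [norm_mul, norm_star, Complex.norm_real, Real.norm_of_nonneg hp.le, mul_pow]
  have hk1 : 0 ≤ P.κrUT * G := mul_nonneg hκ hG0
  have hk2 : 0 ≤ P.κtBS * D := mul_nonneg hκ' hD0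
  have hden : 0 < (1 + P.κrUT) * G - ‖E‖ ^ 2 + P.κtBS * D + σ2 / pBS := by
    have : 0 < σ2 / pBS := div_pos hσ hp
    nlinarith
  have he : 0 < pBS * ((1 + P.κrUT) * G + P.κtBS * D) + σ2 := by positivity
  -- p E|y|² − |E s y*|² is p² times the denominator of the SINR, so the ratio in the mutual
  -- information bound is the SINR itself. Strict positivity comes from σ² > 0.
  have hce : pBS * (pBS * ((1 + P.κrUT) * G + P.κtBS * D) + σ2) - pBS ^ 2 * ‖E‖ ^ 2 =
      pBS ^ 2 * ((1 + P.κrUT) * G - ‖E‖ ^ 2 + P.κtBS * D + σ2 / pBS) := by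
    field_simp
    ring
  have key := ofReal_log_le_mutualInfo (μ := M.prod (signalLaw pBS N))
    (s := fun q => q.2.1) (y := fun q => received P pBS σ2 (H q.1) (W q.1) q.2.1 q.2.2)
    (u := fun q => q.1.2) (measurable_fst.comp measurable_snd) (measurable_received hHm hWm)
    (measurable_snd.comp measurable_fst) hp
    ((measurePreserving_signal pBS).comp measurePreserving_snd).map_eq m1 (by rw [m3]; exact he)
    (by
      rw [m2, m3, hc, ← sub_pos, hce]
      exact mul_pos (pow_pos hp 2) hden)
  rw [m2, m3, hc, hce, mul_div_mul_left _ _ (pow_pos hp 2).ne'] at key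
  exact key

lemma ofReal_capacityLower_le_capacity (h : UplinkBounds P ρ c₀ R S) (hN : 1 ≤ N) {pBS σ2 : ℝ}
    (hp : 0 < pBS) (hσ : 0 < σ2) {U : Type} [MeasurableSpace U]
    (K : Kernel (Vec N × Vec N × Vec N) U) [IsMarkovKernel K] :
    ENNReal.ofReal (capacityLower P R S mrt pBS σ2) ≤ capacity P R S pBS σ2 K := by
  have hae := unitMrt_chanEst_ae h hN (⟨0, hN⟩ : Fin N)
  set w := unitMrt (⟨0, hN⟩ : Fin N)
  have hg : MemLp (effChan P R S w) 2 (uplinkLaw P R S) := by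
    refine (memLp_effChan (P := P) (S := S) h.posSemidef).ae_eq ?_
    filter_upwards [hae] with ω hω
    rw [effChan, effChan, hω]
  have hpow : ∫⁻ s, ‖s‖ₑ ^ 2 ∂(scalarCN pBS) ≤ ENNReal.ofReal pBS := by
    have h2 : MemLp (fun z : ℂ => z) 2 (scalarCN pBS) := by
      exact_mod_cast memLp_id_scalarCN pBS 2
    rw [lintegral_enorm_sq_eq h2, integral_norm_sq_scalarCN hp.le]
  have key := ofReal_log_sinrTilde_le K (measurable_unitMrt (⟨0, hN⟩ : Fin N))
    (norm_unitMrt_apply_sq_le _) h.posSemidef hg hp hσ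
  rw [sinrTilde_congr hae] at key
  unfold capacity
  refine le_iSup_of_le w (le_iSup_of_le (measurable_unitMrt _) (le_iSup_of_le (eucNorm_unitMrt _)
    (le_iSup_of_le (scalarCN pBS) (le_iSup_of_le inferInstance (le_iSup_of_le hpow ?_)))))
  rw [capacityLower, Real.logb, ENNReal.ofReal_div_of_pos (Real.log_pos one_lt_two)]
  exact ENNReal.div_le_div_right key _

end Capacity

/-! ### Exact error terms and the exchange of the noise term. -/

section Family

variable {N : ℕ} {P : Params} {ρ c₀ : ℝ} {R S : Matrix (Fin N) (Fin N) ℂ}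

/-- The scaled difference of the squared mean of the effective channel and its limit. -/
noncomputable def signalError (P : Params) (R S : Matrix (Fin N) (Fin N) ℂ) : ℝ :=
  ‖∫ ω, effChan P R S mrt ω ∂(uplinkLaw P R S)‖ ^ 2 / estPower P R S - sqMeanGain P R S

/-- The scaled difference of the interference power and its limit. -/
noncomputable def interferenceError (P : Params) (R S : Matrix (Fin N) (Fin N) ℂ) : ℝ :=
  (1 + P.κrUT) * ((∫ ω, ‖effChan P R S mrt ω‖ ^ 2 ∂(uplinkLaw P R S)) / estPower P R S -
    meanSqGain P R S) - signalError P R S + P.κtBS * (txDistortion P R S mrt / estPower P R S)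

/-- An exact identity, obtained by dividing numerator and denominator by tr(R − C). The error terms
are defined as what is left over, and they involve neither σ² nor p^BS; this yields the version of
the bound that is uniform in these parameters. -/
lemma capacityLower_eq (hT : 0 < estPower P R S) (pBS σ2 : ℝ) :
    capacityLower P R S mrt pBS σ2 =
      Real.logb 2 (1 + (sqMeanGain P R S + signalError P R S) /
        ((1 + P.κrUT) * meanSqGain P R S - sqMeanGain P R S + σ2 / (pBS * estPower P R S) +
          interferenceError P R S)) := by
  unfold capacityLower sinrTilde
  congr 2
  rw [← div_div_div_cancel_right₀ hT.ne']
  congr 1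
  · rw [signalError]; ring
  · rw [interferenceError, signalError, txDistortion, ← div_div]; ring

lemma abs_signalError_le (h : UplinkBounds P ρ c₀ R S) (hN : 1 ≤ N) :
    |signalError P R S| ≤ sqMeanConst P ρ c₀ * (1 / Real.sqrt N) :=
  abs_sqMean_sub_le h hN

lemma abs_interferenceError_le (h : UplinkBounds P ρ c₀ R S) (hN : 1 ≤ N) :
    |interferenceError P R S| ≤ ((1 + P.κrUT) * meanSqConst P ρ c₀ + sqMeanConst P ρ c₀ +
      P.κtBS * txConst P ρ c₀) * (1 / Real.sqrt N) := by
  have hκ : 0 ≤ 1 + P.κrUT := add_nonneg zero_le_one P.κrUT_nonneg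
  have h1 := mul_le_mul_of_nonneg_left (abs_meanSq_sub_le h hN) hκ
  have h2 := abs_signalError_le h hN
  have h3 := mul_le_mul_of_nonneg_left (txDistortion_mrt_le h hN) P.κtBS_nonneg
  have h4 : 0 ≤ txDistortion P R S mrt / estPower P R S :=
    div_nonneg (txDistortion_nonneg _) (h.estPower_pos hN).le
  unfold interferenceError
  refine (abs_add_le _ _).trans ?_
  rw [abs_of_nonneg (mul_nonneg P.κtBS_nonneg h4)]
  refine (add_le_add (abs_sub _ _) le_rfl).trans ?_
  rw [abs_mul, abs_of_nonneg hκ]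
  linarith

end Family

lemma isBigO_of_abs_le {f g : ℕ → ℝ} {K : ℝ} (hg : ∀ N, 0 ≤ g N)
    (h : ∀ N : ℕ, 1 ≤ N → |f N| ≤ K * g N) : f =O[atTop] g := by
  refine IsBigO.of_bound K ?_
  filter_upwards [eventually_ge_atTop 1] with N hN
  rw [Real.norm_eq_abs, Real.norm_of_nonneg (hg N)]
  exact h N hN

/-- No cancellation takes place: with σ² = O(√N) and T at least of order N, each of the two noise
terms is already O(1/√N). -/
lemma isBigO_div_sub_div {σ2 T : ℕ → ℝ} {c a b : ℝ} (hc : 0 < c)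
    (hT : ∀ N : ℕ, 1 ≤ N → c * N ≤ T N) (hσ : σ2 =O[atTop] fun N : ℕ => Real.sqrt N) :
    (fun N : ℕ => σ2 N / (a * T N) - 1 / N * (σ2 N / (b * a))) =O[atTop]
      fun N : ℕ => 1 / Real.sqrt N := by
  obtain ⟨K, hK⟩ := hσ.bound
  refine IsBigO.of_bound (K * (|a|⁻¹ * c⁻¹ + |b * a|⁻¹)) ?_
  filter_upwards [hK, eventually_ge_atTop 1] with N hN h1
  have hn : (0 : ℝ) < N := by exact_mod_cast h1
  have hs := Real.sqrt_pos.2 hn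
  have hss : Real.sqrt N * Real.sqrt N = N := Real.mul_self_sqrt hn.le
  rw [Real.norm_eq_abs, Real.norm_of_nonneg hs.le] at hN
  rw [Real.norm_eq_abs, Real.norm_of_nonneg (one_div_pos.2 hs).le]
  have hTN := hT N h1
  have hcN : 0 < c * N := mul_pos hc hn
  have e : K * (|a|⁻¹ * c⁻¹ + |b * a|⁻¹) * (1 / Real.sqrt N) =
      K * Real.sqrt N * (|a|⁻¹ * (c * N)⁻¹) + (N : ℝ)⁻¹ * (K * Real.sqrt N * |b * a|⁻¹) := by
    generalize Real.sqrt N = s at hs hss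
    rw [← hss]
    field_simp
  rw [e]
  refine (abs_sub _ _).trans (add_le_add ?_ ?_)
  · rw [abs_div, div_eq_mul_inv, abs_mul, mul_inv, abs_of_pos (hcN.trans_le hTN)]
    have hTi := inv_anti₀ hcN hTN
    have hTi0 : 0 ≤ (T N)⁻¹ := inv_nonneg.2 (hcN.le.trans hTN)
    exact mul_le_mul hN (mul_le_mul_of_nonneg_left hTi (by positivity)) (by positivity)
      ((abs_nonneg _).trans hN)
  · rw [abs_mul, abs_of_pos (one_div_pos.2 hn), one_div, abs_div, div_eq_mul_inv]
    gcongr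

end Miso

/-! ### Assembly of the claims. -/

theorem corollary3 (P : Miso.Params)
    (R S : (N : ℕ) → Matrix (Fin N) (Fin N) ℂ)
    (hR : ∀ N, (R N).PosSemidef) (hS : ∀ N, (S N).PosDef)
    (hRbdd : ∃ c : ℝ, ∀ N, Miso.specNorm (R N) ≤ c)
    (hSbdd : ∃ c : ℝ, ∀ N, Miso.specNorm (S N) ≤ c)
    (hRtr : ∃ c : ℝ, 0 < c ∧ ∀ N : ℕ, 1 ≤ N → c * N ≤ (R N).trace.re)
    (hΨ : ∃ c : ℝ, 0 < c ∧ ∀ N : ℕ,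
      (Miso.psi P (R N) (S N) - (c : ℂ) • (1 : Matrix (Fin N) (Fin N) ℂ)).PosSemidef) :
    -- `ĥ` is the linear minimum mean square error estimator
    (∀ N : ℕ, ∀ B : Matrix (Fin N) (Fin N) ℂ,
      Miso.mse P (R N) (S N) (Miso.lmmseMatrix P (R N) (S N)) ≤ Miso.mse P (R N) (S N) B) ∧
    -- the expectations in the bound and in the rewritten bound exist
    (∀ N : ℕ, 1 ≤ N →
      MemLp (Miso.effChan P (R N) (S N) Miso.mrt) 2 (Miso.uplinkLaw P (R N) (S N)) ∧
      Integrable (Miso.gain P (R N) (S N)) (Miso.scalarCN (P.κtUT * P.pUT)) ∧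
      Integrable (fun η => ‖1 + P.d⁻¹ * η‖ ^ 2 * Miso.estPower P (R N) (S N) /
        Miso.condPower P (R N) (S N) η) (Miso.scalarCN (P.κtUT * P.pUT))) ∧
    -- `C ≥ C_lower`, whatever the receiver knows about the channel
    (∀ N : ℕ, 1 ≤ N → ∀ pBS σ2 : ℝ, 0 < pBS → 0 < σ2 →
      ∀ (U : Type) [MeasurableSpace U] (K : Kernel (Miso.Vec N × Miso.Vec N × Miso.Vec N) U)
        [IsMarkovKernel K],
        ENNReal.ofReal (Miso.capacityLower P (R N) (S N) Miso.mrt pBS σ2) ≤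
          Miso.capacity P (R N) (S N) pBS σ2 K) ∧
    -- the rewritten bound, for a noise variance that may depend on `N`
    (∀ (pBS : ℝ) (σ2 : ℕ → ℝ), 0 < pBS → (∀ N, 0 < σ2 N) →
      σ2 =O[atTop] (fun N : ℕ => Real.sqrt N) →
      ∃ a b : ℕ → ℝ,
        a =O[atTop] (fun N : ℕ => 1 / Real.sqrt N) ∧
        b =O[atTop] (fun N : ℕ => 1 / Real.sqrt N) ∧
        ∀ N : ℕ, 1 ≤ N →
          Miso.capacityLower P (R N) (S N) Miso.mrt pBS (σ2 N) =
            Real.logb 2 (1 + (Miso.sqMeanGain P (R N) (S N) + a N) /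
              ((1 + P.κrUT) * Miso.meanSqGain P (R N) (S N) - Miso.sqMeanGain P (R N) (S N)
                + 1 / N * (σ2 N / (P.pUT * pBS)) + b N))) ∧
    -- the same with the exact noise term: error terms that do not depend on `p^BS` and `σ_UT^2`
    (∃ a b : ℕ → ℝ,
        a =O[atTop] (fun N : ℕ => 1 / Real.sqrt N) ∧
        b =O[atTop] (fun N : ℕ => 1 / Real.sqrt N) ∧
        ∀ N : ℕ, 1 ≤ N → ∀ pBS σ2 : ℝ, 0 < pBS → 0 < σ2 →
          Miso.capacityLower P (R N) (S N) Miso.mrt pBS σ2 =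
            Real.logb 2 (1 + (Miso.sqMeanGain P (R N) (S N) + a N) /
              ((1 + P.κrUT) * Miso.meanSqGain P (R N) (S N) - Miso.sqMeanGain P (R N) (S N)
                + σ2 / (pBS * Miso.estPower P (R N) (S N)) + b N))) ∧
    -- `tr(R - C)` grows linearly in `N`
    (∃ c C : ℝ, 0 < c ∧ ∀ N : ℕ, 1 ≤ N →
      c * N ≤ Miso.estPower P (R N) (S N) ∧ Miso.estPower P (R N) (S N) ≤ C * N) ∧
    -- the other terms remain strictly positive
    (∃ δ : ℝ, 0 < δ ∧ ∀ N : ℕ, 1 ≤ N →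
      δ ≤ Miso.sqMeanGain P (R N) (S N) ∧ δ ≤ Miso.meanSqGain P (R N) (S N)) ∧
    (0 < P.κrUT ∨ 0 < P.κtUT → ∃ δ : ℝ, 0 < δ ∧ ∀ N : ℕ, 1 ≤ N →
      δ ≤ (1 + P.κrUT) * Miso.meanSqGain P (R N) (S N) - Miso.sqMeanGain P (R N) (S N)) := by
  obtain ⟨ρR, hρR⟩ := hRbdd
  obtain ⟨ρS, hρS⟩ := hSbdd
  obtain ⟨cR, hcR, htr⟩ := hRtr
  obtain ⟨cΨ, hcΨ, hpsi⟩ := hΨ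
  set ρ := max ρR ρS
  set c₀ := min cR cΨ
  have hc₀ : 0 < c₀ := lt_min hcR hcΨ
  have hB : ∀ N : ℕ, 1 ≤ N → Miso.UplinkBounds P ρ c₀ (R N) (S N) := by
    intro N hN
    refine ⟨hR N, hS N, (hρR N).trans (le_max_left _ _), (hρS N).trans (le_max_right _ _), hc₀,
      (mul_le_mul_of_nonneg_right (min_le_left _ _) (Nat.cast_nonneg N)).trans (htr N hN), ?_⟩
    have h1 : Miso.psi P (R N) (S N) - (c₀ : ℂ) • (1 : Matrix (Fin N) (Fin N) ℂ) =
        (Miso.psi P (R N) (S N) - (cΨ : ℂ) • (1 : Matrix (Fin N) (Fin N) ℂ)) +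
          ((cΨ - c₀ : ℝ) : ℂ) • (1 : Matrix (Fin N) (Fin N) ℂ) := by
      push_cast
      rw [sub_smul]
      abel
    rw [h1]
    refine (hpsi N).add (Matrix.PosSemidef.one.smul ?_)
    exact_mod_cast sub_nonneg.2 (min_le_right cR cΨ)
  -- The constants do not depend on N; the instance N = 1 serves to certify that they are positive.
  have h1 := hB 1 le_rfl
  have hsq : ∀ N : ℕ, 0 ≤ 1 / Real.sqrt N := fun N => by positivity
  have ha : (fun N : ℕ => Miso.signalError P (R N) (S N)) =O[atTop]
      fun N : ℕ => 1 / Real.sqrt N :=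
    Miso.isBigO_of_abs_le hsq fun N hN => Miso.abs_signalError_le (hB N hN) hN
  have hb : (fun N : ℕ => Miso.interferenceError P (R N) (S N)) =O[atTop]
      fun N : ℕ => 1 / Real.sqrt N :=
    Miso.isBigO_of_abs_le hsq fun N hN => Miso.abs_interferenceError_le (hB N hN) hN
  refine ⟨fun N B => Miso.mse_lmmseMatrix_le (hR N) (hS N) B, ?_, ?_, ?_, ?_, ?_, ?_, ?_⟩
  · intro N hN
    refine ⟨Miso.memLp_effChan (hR N), Miso.integrable_gain (hB N hN) hN, ?_⟩
    simp_rw [← Miso.norm_gain_sq (hB N hN) hN]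
    exact Miso.integrable_norm_gain_sq (hB N hN) hN
  · intro N hN pBS σ2 hp hσ U _ K _
    exact Miso.ofReal_capacityLower_le_capacity (hB N hN) hN hp hσ K
  · intro pBS σ2 _ _ hO
    -- The difference of the two noise terms is absorbed into the second error sequence.
    refine ⟨_, _, ha, hb.add (Miso.isBigO_div_sub_div (a := pBS) (b := P.pUT)
      (h1.powerLower_pos le_rfl) (fun N hN => (hB N hN).estPower_ge hN) hO), fun N hN => ?_⟩
    rw [Miso.capacityLower_eq ((hB N hN).estPower_pos hN)]
    congr 3
    ring
  · exact ⟨_, _, ha, hb, fun N hN pBS σ2 _ _ =>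
      Miso.capacityLower_eq ((hB N hN).estPower_pos hN) pBS σ2⟩
  · exact ⟨_, _, h1.powerLower_pos le_rfl, fun N hN =>
      ⟨(hB N hN).estPower_ge hN, (hB N hN).estPower_le⟩⟩
  · exact ⟨_, pow_pos (Miso.meanGainLower_pos h1 le_rfl) 2, fun N hN =>
      ⟨Miso.sqMeanGain_ge (hB N hN) hN, (Miso.sqMeanGain_ge (hB N hN) hN).trans
        (Miso.sqMeanGain_le_meanSqGain (hB N hN) hN)⟩⟩
  · rintro (hκ | hκ)
    -- (1 + κ_r) q − m = (q − m) + κ_r q with q ≥ m, so the receiver distortion alone keeps the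
    -- expression away from zero.
    · refine ⟨_, mul_pos hκ (pow_pos (Miso.meanGainLower_pos h1 le_rfl) 2), fun N hN => ?_⟩
      have h2 := Miso.sqMeanGain_ge (hB N hN) hN
      have h3 := Miso.sqMeanGain_le_meanSqGain (hB N hN) hN
      have h4 := mul_le_mul_of_nonneg_left (h2.trans h3) hκ.le
      linarith
    -- Here q − m is itself bounded below, being at least the second moment of the imaginary part of
    -- the gain.
    · refine ⟨_, Miso.varGainLower_pos h1 le_rfl hκ, fun N hN => ?_⟩
      have h2 := Miso.varGainLower_le (hB N hN) hN
      have h3 := mul_nonneg P.κrUT_nonneg ((sq_nonneg _).trans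
        ((Miso.sqMeanGain_ge (hB N hN) hN).trans (Miso.sqMeanGain_le_meanSqGain (hB N hN) hN)))
      linarith
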